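/- Let $d\in\{1,2,3\}$, and for $\sigma\ge 0$, $s\in\mathbb R$ let $G^{\sigma,s}(\mathbb R^d)$ be the Gevrey space with norm $\|f\|_{G^{\sigma,s}}=\|e^{\sigma\|D\|}\langle D\rangle^s f\|_{L^2(\mathbb R^d)}$, where $D=-i\nabla$, $\|\xi\|=\sum_{i=1}^d|\xi_i|$ and $\langle\xi\rangle=\sqrt{1+|\xi|^2}$. Consider the Cauchy problem for the Klein–Gordon–Schrödinger system $$ \begin{cases} i\partial_t u+\Delta u=-un, & u(0,x)=u_0(x),\\ \partial_t^2 n+(1-\Delta)n=|u|^2, & (n,\partial_t n)(0,x)=(n_0,n_1)(x), \end{cases} $$ for $u:\mathbb R^{1+d}\to\mathbb C$ and $n:\mathbb R^{1+d}\to\mathbb R$. Let $\sigma_0>0$ and $r,s\in\mathbb R$, let $(u_0,n_0,n_1)\in G^{\sigma_0,r}(\mathbb R^d)\times G^{\sigma_0,s}(\mathbb R^d)\times G^{\sigma_0,s-1}(\mathbb R^d)$, and let $(u,n)$ be the global $C^\infty$ solution of this problem, that is, $u$ and $n$ are $C^\infty$ on $\mathbb R^{1+d}$, solve the system, and $u,n,\partial_t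 n\in C(\mathbb R;H^k(\mathbb R^d))$ for every $k\in\mathbb N$. Put $p=\max\{8/(4-d),4\}$. Then for every $\varepsilon>0$ there is a function $\sigma:\mathbb R\to(0,\infty)$ such that $$ (u,n,\partial_t n)(t)\in G^{\sigma(t),r}(\mathbb R^d)\times G^{\sigma(t),s}(\mathbb R^d)\times G^{\sigma(t),s-1}(\mathbb R^d)\quad\text{for all } t\in\mathbb R $$ and $$ \sigma(t)\ \ge\ c\,|t|^{-(p+\varepsilon)}\quad\text{for all } |t|\ge T, $$ where the constants $c>0$ and $T>0$ depend only on $d$, $\varepsilon$, $\sigma_0$, $r$, $s$ and an upper bound for the norm $\|u_0\|_{G^{\sigma_0,r}}+\|n_0\|_{G^{\sigma_0,s}}+\|n_1\|_{G^{\sigma_0,s-1}}$ of the data. -/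

import Mathlib

open MeasureTheory Filter Topology
open scoped ENNReal NNReal ContDiff FourierTransform Laplacian

namespace KGS

noncomputable section

/-- The symbol `e^{σ‖η‖} ⟨η⟩^s`, with `‖η‖ = ∑ |η_i|` and `⟨η⟩ = √(1+|η|²)`, of the Fourier
multiplier `e^{σ‖D‖} ⟨D⟩^s`, `D = -i∇`. -/
def gevreySymbol {d : ℕ} (σ s : ℝ) (η : EuclideanSpace ℝ (Fin d)) : ℝ :=
  Real.exp (σ * ∑ i, |η i|) * Real.sqrt (1 + ‖η‖ ^ 2) ^ s

open Classical in
/-- The norm `‖f‖_{G^{σ,s}} = ‖e^{σ‖D‖} ⟨D⟩^s f‖_{L²}` of a function on `ℝ^d`, as an extended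
nonnegative number, computed on the Fourier side. The Fourier transform is the unitary one on
`L²` with kernel `e^{-2πi x·ξ}`, so that `D` is multiplication by `2πξ`.
Every element of `G^{σ,s}` with `σ > 0`, or with `σ = 0` and `s ≥ 0`, is an `L²` function; the
norm is infinite on functions outside `L²`. -/
def gevreyNorm {d : ℕ} (σ s : ℝ) (f : EuclideanSpace ℝ (Fin d) → ℂ) : ℝ≥0∞ :=
  if hf : MemLp f 2 volume then
    eLpNorm (fun ξ => (gevreySymbol σ s ((2 * Real.pi) • ξ) : ℂ) *
      (𝓕 (hf.toLp f) : Lp ℂ 2 (volume : Measure (EuclideanSpace ℝ (Fin d)))) ξ) 2 volume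
  else ⊤

/-- Membership in the Gevrey space `G^{σ,s}(ℝ^d)` (for `σ > 0`, or `σ = 0` and `s ≥ 0`). -/
def MemGevrey {d : ℕ} (σ s : ℝ) (f : EuclideanSpace ℝ (Fin d) → ℂ) : Prop :=
  gevreyNorm σ s f < ⊤

/-- `t ↦ f t` is a continuous curve in the Sobolev space `H^k(ℝ^d) = G^{0,k}(ℝ^d)`. -/
def ContinuousInSobolev {d : ℕ} (k : ℕ) (f : ℝ → EuclideanSpace ℝ (Fin d) → ℂ) : Prop :=
  (∀ t, MemGevrey 0 k (f t)) ∧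
    ∀ t₀, Tendsto (fun t => gevreyNorm 0 k (fun x => f t x - f t₀ x)) (𝓝 t₀) (𝓝 0)

/-- `(u, n)` is the global `C^∞` solution of the Klein–Gordon–Schrödinger Cauchy problem
`i ∂ₜu + Δu = -un`, `∂ₜ²n + (1-Δ)n = |u|²`, `(u, n, ∂ₜn)(0) = (u₀, n₀, n₁)`:
`u` and `n` are smooth on space-time and solve the system pointwise, and `u`, `n`, `∂ₜn` are
continuous in time with values in every Sobolev space `H^k` (the class given by the
well-posedness theory in Sobolev spaces; the solution is unique in it).
The data are elements of `L²`-based spaces, hence attained up to null sets. -/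
structure IsGlobalSmoothSolution {d : ℕ}
    (u₀ : EuclideanSpace ℝ (Fin d) → ℂ) (n₀ n₁ : EuclideanSpace ℝ (Fin d) → ℝ)
    (u : ℝ → EuclideanSpace ℝ (Fin d) → ℂ) (n : ℝ → EuclideanSpace ℝ (Fin d) → ℝ) : Prop where
  smooth_u : ContDiff ℝ ∞ (fun p : ℝ × EuclideanSpace ℝ (Fin d) => u p.1 p.2)
  smooth_n : ContDiff ℝ ∞ (fun p : ℝ × EuclideanSpace ℝ (Fin d) => n p.1 p.2)
  sobolev_u : ∀ k : ℕ, ContinuousInSobolev k u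
  sobolev_n : ∀ k : ℕ, ContinuousInSobolev k (fun t x => (n t x : ℂ))
  sobolev_dn : ∀ k : ℕ, ContinuousInSobolev k (fun t x => ((deriv (fun τ => n τ x) t : ℝ) : ℂ))
  schrodinger : ∀ t x,
    Complex.I * deriv (fun τ => u τ x) t + Δ (u t) x = -(u t x * (n t x : ℂ))
  kleinGordon : ∀ t x,
    iteratedDeriv 2 (fun τ => n τ x) t + (n t x - Δ (n t) x) = ‖u t x‖ ^ 2
  init_u : u 0 =ᵐ[volume] u₀
  init_n : n 0 =ᵐ[volume] n₀
  init_dn : (fun x => deriv (fun τ => n τ x) 0) =ᵐ[volume] n₁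

end

end KGS

/-! The Fourier transforms of `u`, `n`, `∂ₜn` are multiplied by the weight `w(ξ) = exp (min
(σ‖2πξ‖₁) M)`. The truncation `M` keeps `w` bounded, so the weighted transforms `A`, `B`, `D`, with
any power of `⟨ξ⟩`, are differentiable curves in `L²`. The bounds are uniform in `M`, and `M → ∞` at
the end by Fatou.

The weighted functions solve the same system, except that products carry the factor `w(ξ) / (w(ξ -
η) w(η)) ∈ (0, 1]` (`FrequencySolution.weighted`). The exponent of `w` is even and subadditive, so
one minus this factor is at most `(2dσ)^θ ⟨ζ⟩^θ` for `ζ = η` and for `ζ = ξ - η`. Hence mass and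
energy of the weighted solution are conserved up to errors with the small factor `gain = (2dσ)^θ`
(`hasDerivAt_mass`, `hasDerivAt_energy`). The loss of `θ` derivatives is affordable when `d < 2(2 -
θ)`, because `⟨η⟩^{-(2-θ)}` is then square integrable.

The energy error contains the second order quantity `V = ∂ₜA`, which no conservation law controls.
Its growth is estimated instead: the Schrödinger equation is differentiated in time, and the wave
energy is taken one derivative higher. If the first order norms are at most `K` and `V`, `B 2`, `D
1` have norm at most `L`, interpolation bounds the derivatives of the squared second order norms by
a multiple of `L^{2-θ}`, up to a term with the factor `gain`. So `L ∼ T^{1/θ}` is consistent on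
`[-T, T]`. The energy drift is then of size `gain · L · T ∼ σ^θ T^{1+1/θ}`, and the bootstrap closes
for `σ ∼ T^{-(1+1/θ)/θ}` (`sum_sq_le_of_small`, `exists_uniform_bound`).

The indices `r`, `s` play no role beyond constants: any power of `⟨ξ⟩` is absorbed by halving the
radius, once for the data and once for the conclusion. Suitable values of `θ` give the exponents
`15/4` for `d ≤ 2` and `117/16` for `d = 3`, both below `p`. -/

namespace KGS

noncomputable section

/-- The frequency space `ℝ^d`. -/
abbrev Space (d : ℕ) := EuclideanSpace ℝ (Fin d)

/-- Square integrable functions on `ℝ^d`. -/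
abbrev L2 (d : ℕ) := Lp ℂ 2 (volume : Measure (Space d))

variable {d : ℕ}

/-! ### The Japanese bracket -/

/-- The symbol of `⟨D⟩` in the normalisation of the Fourier transform with kernel
`e^{-2πi x·ξ}`. -/
def bracket (ξ : Space d) : ℝ := Real.sqrt (1 + ‖(2 * Real.pi) • ξ‖ ^ 2)

lemma one_le_bracket (ξ : Space d) : 1 ≤ bracket ξ := by
  unfold bracket
  rw [Real.one_le_sqrt]
  nlinarith [sq_nonneg ‖(2 * Real.pi) • ξ‖]

lemma bracket_pos (ξ : Space d) : 0 < bracket ξ := lt_of_lt_of_le one_pos (one_le_bracket ξ)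

lemma bracket_ne_zero (ξ : Space d) : bracket ξ ≠ 0 := (bracket_pos ξ).ne'

@[fun_prop]
lemma continuous_bracket : Continuous (bracket : Space d → ℝ) := by
  unfold bracket; fun_prop

@[fun_prop]
lemma measurable_bracket : Measurable (bracket : Space d → ℝ) := continuous_bracket.measurable

lemma bracket_neg (ξ : Space d) : bracket (-ξ) = bracket ξ := by simp [bracket]

lemma bracket_sq (ξ : Space d) : bracket ξ ^ 2 = 1 + ‖(2 * Real.pi) • ξ‖ ^ 2 := by
  unfold bracket; rw [Real.sq_sqrt]; positivity

lemma norm_le_bracket (ξ : Space d) : ‖(2 * Real.pi) • ξ‖ ≤ bracket ξ := by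
  unfold bracket
  exact Real.le_sqrt_of_sq_le (by linarith)

lemma bracket_le_add (ξ η : Space d) : bracket ξ ≤ bracket (ξ - η) + bracket η := by
  have h1 := bracket_sq (ξ - η)
  have h2 := bracket_sq η
  have hx := norm_le_bracket (ξ - η)
  have hy := norm_le_bracket η
  have h3 : ‖(2 * Real.pi) • ξ‖ ≤ ‖(2 * Real.pi) • (ξ - η)‖ + ‖(2 * Real.pi) • η‖ := by
    rw [show (2 * Real.pi) • ξ = (2 * Real.pi) • (ξ - η) + (2 * Real.pi) • η by
      rw [← smul_add]; congr 1; abel]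
    exact norm_add_le _ _
  have h4 := bracket_sq ξ
  have : bracket ξ ^ 2 ≤ (bracket (ξ - η) + bracket η) ^ 2 := by
    have := mul_le_mul hx hy (norm_nonneg _) (bracket_pos _).le
    nlinarith [norm_nonneg ((2 * Real.pi) • ξ)]
  exact le_of_sq_le_sq this (by linarith [bracket_pos (ξ - η), bracket_pos η])
where
  le_of_sq_le_sq {a b : ℝ} (h : a ^ 2 ≤ b ^ 2) (hb : 0 ≤ b) : a ≤ b := by
    by_contra! hlt
    nlinarith

lemma rpow_neg_bracket_le_one (ξ : Space d) {s : ℝ} (hs : 0 ≤ s) : bracket ξ ^ (-s) ≤ 1 :=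
  Real.rpow_le_one_of_one_le_of_nonpos (one_le_bracket ξ) (by linarith)

lemma sq_rpow_neg_bracket_le (ξ : Space d) {s : ℝ} (hs : 0 ≤ s) :
    (bracket ξ ^ (-s)) ^ 2 ≤ (1 + ‖ξ‖ ^ 2) ^ (-(2 * s) / 2) := by
  have h1 : 1 + ‖ξ‖ ^ 2 ≤ bracket ξ ^ 2 := by
    rw [bracket_sq, norm_smul, Real.norm_of_nonneg (by positivity), mul_pow]
    have : 1 ≤ (2 * Real.pi) ^ 2 := by nlinarith [Real.pi_gt_three]
    nlinarith [sq_nonneg ‖ξ‖]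
  have h2 : (bracket ξ ^ (-s)) ^ 2 = (bracket ξ ^ 2) ^ (-s) := by
    rw [← Real.rpow_natCast, ← Real.rpow_natCast, ← Real.rpow_mul (bracket_pos ξ).le,
      ← Real.rpow_mul (bracket_pos ξ).le]
    congr 1; push_cast; ring
  rw [h2, show -(2 * s) / 2 = -s by ring]
  exact Real.rpow_le_rpow_of_nonpos (by positivity) h1 (by linarith)

/-- The square of the `L²` norm of `⟨ξ⟩^{-s}`. -/
def decayConst (d : ℕ) (s : ℝ) : ℝ≥0∞ := ∫⁻ ξ : Space d, ENNReal.ofReal (bracket ξ ^ (-s)) ^ 2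

lemma decayConst_lt_top {s : ℝ} (hs : (d : ℝ) < 2 * s) : decayConst d s < ⊤ := by
  have hs0 : 0 ≤ s := by
    have : (0 : ℝ) ≤ d := Nat.cast_nonneg d
    linarith
  have h : Integrable (fun ξ : Space d => (1 + ‖ξ‖ ^ 2) ^ (-(2 * s) / 2)) volume :=
    integrable_rpow_neg_one_add_norm_sq (by simpa using hs)
  refine lt_of_le_of_lt (lintegral_mono fun ξ => ?_) h.lintegral_lt_top
  rw [← ENNReal.ofReal_pow (Real.rpow_nonneg (bracket_pos ξ).le _)]
  exact ENNReal.ofReal_le_ofReal (sq_rpow_neg_bracket_le ξ hs0)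

/-! ### Bilinear operators with smoothing kernels -/

lemma ennreal_add_sq_le (a b : ℝ≥0∞) : (a + b) ^ 2 ≤ 2 * a ^ 2 + 2 * b ^ 2 := by
  have := ENNReal.rpow_add_le_mul_rpow_add_rpow a b (p := 2) (by norm_num)
  norm_num at this
  simpa [mul_add] using this

lemma lintegral_mul_sq_le {α : Type*} [MeasurableSpace α] {μ : Measure α} {f g : α → ℝ≥0∞}
    (hf : AEMeasurable f μ) (hg : AEMeasurable g μ) :
    (∫⁻ a, f a * g a ∂μ) ^ 2 ≤ (∫⁻ a, f a ^ 2 ∂μ) * ∫⁻ a, g a ^ 2 ∂μ := by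
  have h := ENNReal.lintegral_mul_le_Lp_mul_Lq μ Real.HolderConjugate.two_two hf hg
  have h2 := pow_le_pow_left' h 2
  simp only [Pi.mul_apply, mul_pow, ENNReal.rpow_ofNat] at h2
  refine h2.trans (le_of_eq ?_)
  simp only [← ENNReal.rpow_natCast, ← ENNReal.rpow_mul]
  norm_num

/-- The function `⟨ξ - η⟩^{-s} + ⟨η⟩^{-s}`, by which kernels are dominated. -/
def decayKernel (s : ℝ) (ξ η : Space d) : ℝ := bracket (ξ - η) ^ (-s) + bracket η ^ (-s)

lemma lintegral_decayKernel_sq_le (s : ℝ) (ξ : Space d) :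
    ∫⁻ η, ENNReal.ofReal (decayKernel s ξ η) ^ 2 ≤ 4 * decayConst d s := by
  have hm : Measurable fun η : Space d => ENNReal.ofReal (bracket η ^ (-s)) ^ 2 := by fun_prop
  calc ∫⁻ η, ENNReal.ofReal (decayKernel s ξ η) ^ 2
      ≤ ∫⁻ η, (2 * ENNReal.ofReal (bracket (ξ - η) ^ (-s)) ^ 2 +
          2 * ENNReal.ofReal (bracket η ^ (-s)) ^ 2) := by
        refine lintegral_mono fun η => ?_
        unfold decayKernel
        rw [ENNReal.ofReal_add (Real.rpow_nonneg (bracket_pos _).le _)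
          (Real.rpow_nonneg (bracket_pos _).le _)]
        exact ennreal_add_sq_le _ _
    _ = 4 * decayConst d s := by
        rw [lintegral_add_right _ (by fun_prop), lintegral_const_mul _ (by fun_prop),
          lintegral_const_mul _ hm,
          lintegral_sub_left_eq_self (fun η => ENNReal.ofReal (bracket η ^ (-s)) ^ 2) ξ]
        unfold decayConst
        rw [← add_mul]; norm_num

/-- Cauchy–Schwarz in `η` separates the kernel, whose `L²` norm in `η` is bounded uniformly in `ξ`,
from `f (ξ - η) g η`, whose square integrates over `(ξ, η)` to the product of the squared norms.
Every product estimate below reduces to this one. -/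
lemma lintegral_sq_lintegral_decayKernel_le (s : ℝ) {f g : Space d → ℝ≥0∞} (hf : Measurable f)
    (hg : Measurable g) :
    ∫⁻ ξ, (∫⁻ η, ENNReal.ofReal (decayKernel s ξ η) * (f (ξ - η) * g η)) ^ 2 ≤
      4 * decayConst d s * ((∫⁻ ξ, f ξ ^ 2) * ∫⁻ ξ, g ξ ^ 2) := by
  calc ∫⁻ ξ, (∫⁻ η, ENNReal.ofReal (decayKernel s ξ η) * (f (ξ - η) * g η)) ^ 2
      ≤ ∫⁻ ξ, 4 * decayConst d s * ∫⁻ η, (f (ξ - η) * g η) ^ 2 := by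
        refine lintegral_mono fun ξ => ?_
        refine (lintegral_mul_sq_le ?_ ?_).trans ?_
        · unfold decayKernel; fun_prop
        · fun_prop
        · gcongr
          exact lintegral_decayKernel_sq_le s ξ
    _ = 4 * decayConst d s * ∫⁻ ξ, ∫⁻ η, (f (ξ - η) * g η) ^ 2 := by
        rw [lintegral_const_mul]
        exact Measurable.lintegral_prod_right'
          (f := fun p : Space d × Space d => (f (p.1 - p.2) * g p.2) ^ 2) (by fun_prop)
    _ = 4 * decayConst d s * ((∫⁻ ξ, f ξ ^ 2) * ∫⁻ ξ, g ξ ^ 2) := by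
        congr 1
        rw [lintegral_lintegral_swap (by
          exact Measurable.aemeasurable (f := fun p : Space d × Space d =>
            (f (p.1 - p.2) * g p.2) ^ 2) (by fun_prop))]
        simp_rw [mul_pow]
        have : ∀ η : Space d, ∫⁻ ξ, f (ξ - η) ^ 2 * g η ^ 2 = (∫⁻ ξ, f ξ ^ 2) * g η ^ 2 := by
          intro η
          rw [lintegral_mul_const _ (by fun_prop),
            lintegral_sub_right_eq_self (fun ξ => f ξ ^ 2) η]
        simp_rw [this]
        rw [lintegral_const_mul _ (by fun_prop)]

lemma eLpNorm_two_sq {f : Space d → ℂ} : eLpNorm f 2 volume ^ 2 = ∫⁻ ξ, ‖f ξ‖ₑ ^ 2 := by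
  rw [eLpNorm_eq_lintegral_rpow_enorm_toReal (by norm_num) (by norm_num), ← ENNReal.rpow_natCast,
    ← ENNReal.rpow_mul]
  norm_num

lemma lintegral_enorm_sq (f : L2 d) : ∫⁻ ξ, ‖f ξ‖ₑ ^ 2 = ENNReal.ofReal (‖f‖ ^ 2) := by
  rw [← eLpNorm_two_sq, ENNReal.ofReal_pow (norm_nonneg _), Lp.norm_def,
    ENNReal.ofReal_toReal (Lp.eLpNorm_ne_top f)]

lemma L2.measurable (f : L2 d) : Measurable (f : Space d → ℂ) := (Lp.stronglyMeasurable f).measurable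

/-- A real kernel `K(ξ, η)` dominated by a multiple of `⟨ξ - η⟩^{-s} + ⟨η⟩^{-s}`, with `s > d/2`. -/
structure SmoothingKernel (d : ℕ) (s : ℝ) where
  /-- the kernel -/
  toFun : Space d → Space d → ℝ
  measurable : Measurable (fun p : Space d × Space d => toFun p.1 p.2)
  /-- the factor in the bound -/
  const : ℝ
  const_nonneg : 0 ≤ const
  bound : ∀ ξ η, |toFun ξ η| ≤ const * decayKernel s ξ η
  decay : (d : ℝ) < 2 * s

/-- The integral `∫ K(ξ, η) f(ξ - η) g(η) dη`. -/
def kernelConv (K : Space d → Space d → ℝ) (f g : Space d → ℂ) (ξ : Space d) : ℂ :=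
  ∫ η, (K ξ η : ℂ) * (f (ξ - η) * g η)

variable {s : ℝ}

namespace SmoothingKernel

lemma enorm_le (K : SmoothingKernel d s) (ξ η : Space d) (z : ℂ) :
    ‖(K.toFun ξ η : ℂ) * z‖ₑ ≤
      ENNReal.ofReal K.const * (ENNReal.ofReal (decayKernel s ξ η) * ‖z‖ₑ) := by
  rw [enorm_mul, ← mul_assoc, ← ENNReal.ofReal_mul K.const_nonneg]
  gcongr
  rw [← ofReal_norm, Complex.norm_real]
  exact ENNReal.ofReal_le_ofReal (K.bound ξ η)

lemma lintegral_sq_le (K : SmoothingKernel d s) (f g : L2 d) :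
    ∫⁻ ξ, (∫⁻ η, ‖(K.toFun ξ η : ℂ) * (f (ξ - η) * g η)‖ₑ) ^ 2 ≤
      ENNReal.ofReal ((2 * Real.sqrt (decayConst d s).toReal * K.const * ‖f‖ * ‖g‖) ^ 2) := by
  have hf := L2.measurable f
  have hg := L2.measurable g
  calc ∫⁻ ξ, (∫⁻ η, ‖(K.toFun ξ η : ℂ) * (f (ξ - η) * g η)‖ₑ) ^ 2
      ≤ ∫⁻ ξ, ENNReal.ofReal K.const ^ 2 * (∫⁻ η, ENNReal.ofReal (decayKernel s ξ η) *
          (‖f (ξ - η)‖ₑ * ‖g η‖ₑ)) ^ 2 := by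
        refine lintegral_mono fun ξ => ?_
        rw [← mul_pow, ← lintegral_const_mul' _ _ ENNReal.ofReal_ne_top]
        gcongr with η
        simpa [enorm_mul] using K.enorm_le ξ η (f (ξ - η) * g η)
    _ ≤ ENNReal.ofReal K.const ^ 2 * (4 * decayConst d s *
          ((∫⁻ ξ, ‖f ξ‖ₑ ^ 2) * ∫⁻ ξ, ‖g ξ‖ₑ ^ 2)) := by
        rw [lintegral_const_mul' _ _ (by simp)]
        gcongr
        exact lintegral_sq_lintegral_decayKernel_le s hf.enorm hg.enorm
    _ = _ := by
        rw [lintegral_enorm_sq, lintegral_enorm_sq,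
          ← ENNReal.ofReal_toReal (decayConst_lt_top K.decay).ne,
          ← ENNReal.ofReal_pow K.const_nonneg, ← ENNReal.ofReal_mul (by positivity),
          show (4 : ℝ≥0∞) = ENNReal.ofReal 4 by norm_num, ← ENNReal.ofReal_mul (by positivity),
          ← ENNReal.ofReal_mul (by positivity), ← ENNReal.ofReal_mul (by positivity)]
        congr 1
        simp only [mul_pow, Real.sq_sqrt ENNReal.toReal_nonneg,
          ENNReal.toReal_ofReal ENNReal.toReal_nonneg]
        ring

lemma measurable_integrand (K : SmoothingKernel d s) (f g : L2 d) :
    Measurable (fun p : Space d × Space d => (K.toFun p.1 p.2 : ℂ) * (f (p.1 - p.2) * g p.2)) := by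
  have hf := L2.measurable f
  have hg := L2.measurable g
  have hK := K.measurable
  fun_prop

/-- A square integrable function of `ξ` is finite almost everywhere; here it is the integral of the
absolute values. Additivity of `kernelConv` in each argument rests on this. -/
lemma ae_integrable (K : SmoothingKernel d s) (f g : L2 d) :
    ∀ᵐ ξ, Integrable (fun η => (K.toFun ξ η : ℂ) * (f (ξ - η) * g η)) := by
  have hm := K.measurable_integrand f g
  have h := lt_of_le_of_lt (K.lintegral_sq_le f g) ENNReal.ofReal_lt_top
  filter_upwards [ae_lt_top (by
    exact (Measurable.lintegral_prod_right hm.enorm).pow_const 2) h.ne] with ξ hξ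
  refine ⟨(hm.comp measurable_prodMk_left).aestronglyMeasurable, ?_⟩
  rw [hasFiniteIntegral_iff_enorm]
  by_contra hcon
  rw [not_lt, top_le_iff] at hcon
  rw [hcon] at hξ
  simp at hξ

lemma enorm_kernelConv_le (K : SmoothingKernel d s) (f g : L2 d) (ξ : Space d) :
    ‖kernelConv K.toFun f g ξ‖ₑ ≤ ∫⁻ η, ‖(K.toFun ξ η : ℂ) * (f (ξ - η) * g η)‖ₑ :=
  enorm_integral_le_lintegral_enorm _

lemma eLpNorm_le (K : SmoothingKernel d s) (f g : L2 d) :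
    eLpNorm (kernelConv K.toFun f g) 2 volume ≤
      ENNReal.ofReal (2 * Real.sqrt (decayConst d s).toReal * K.const * ‖f‖ * ‖g‖) := by
  have h : eLpNorm (kernelConv K.toFun f g) 2 volume ^ 2 ≤
      ENNReal.ofReal (2 * Real.sqrt (decayConst d s).toReal * K.const * ‖f‖ * ‖g‖) ^ 2 := by
    have := K.const_nonneg
    rw [eLpNorm_two_sq, ← ENNReal.ofReal_pow (by positivity)]
    exact (lintegral_mono fun ξ => pow_le_pow_left' (K.enorm_kernelConv_le f g ξ) 2).trans
      (K.lintegral_sq_le f g)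
  exact (ENNReal.pow_le_pow_left_iff two_ne_zero).1 h

lemma memLp (K : SmoothingKernel d s) (f g : L2 d) : MemLp (kernelConv K.toFun f g) 2 volume :=
  ⟨((K.measurable_integrand f g).stronglyMeasurable.integral_prod_right).aestronglyMeasurable,
    lt_of_le_of_lt (K.eLpNorm_le f g) ENNReal.ofReal_lt_top⟩

/-- The bilinear operator `L² × L² → L²` with a smoothing kernel. -/
def op (K : SmoothingKernel d s) : L2 d →L[ℂ] L2 d →L[ℂ] L2 d :=
  LinearMap.mkContinuous₂
    (LinearMap.mk₂ ℂ (fun f g => (K.memLp f g).toLp _)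
      (by
        intro f f' g
        rw [← MemLp.toLp_add, MemLp.toLp_eq_toLp_iff]
        filter_upwards [K.ae_integrable f g, K.ae_integrable f' g] with ξ h1 h2
        simp only [kernelConv, Pi.add_apply]
        rw [← integral_add h1 h2]
        refine integral_congr_ae ?_
        filter_upwards [(quasiMeasurePreserving_sub_left_of_right_invariant volume ξ).ae_eq_comp
          (Lp.coeFn_add f f')] with η hη
        simp only [Function.comp, Pi.add_apply] at hη
        rw [hη]; ring)
      (by
        intro c f g
        rw [← MemLp.toLp_const_smul, MemLp.toLp_eq_toLp_iff]
        refine Filter.Eventually.of_forall fun ξ => ?_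
        simp only [kernelConv, Pi.smul_apply, smul_eq_mul]
        rw [← integral_const_mul]
        refine integral_congr_ae ?_
        filter_upwards [(quasiMeasurePreserving_sub_left_of_right_invariant volume ξ).ae_eq_comp
          (Lp.coeFn_smul c f)] with η hη
        simp only [Function.comp, Pi.smul_apply, smul_eq_mul] at hη
        rw [hη]; ring)
      (by
        intro f g g'
        rw [← MemLp.toLp_add, MemLp.toLp_eq_toLp_iff]
        filter_upwards [K.ae_integrable f g, K.ae_integrable f g'] with ξ h1 h2
        simp only [kernelConv, Pi.add_apply]
        rw [← integral_add h1 h2]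
        refine integral_congr_ae ?_
        filter_upwards [Lp.coeFn_add g g'] with η hη
        rw [hη, Pi.add_apply]; ring)
      (by
        intro c f g
        rw [← MemLp.toLp_const_smul, MemLp.toLp_eq_toLp_iff]
        refine Filter.Eventually.of_forall fun ξ => ?_
        simp only [kernelConv, Pi.smul_apply, smul_eq_mul]
        rw [← integral_const_mul]
        refine integral_congr_ae ?_
        filter_upwards [Lp.coeFn_smul c g] with η hη
        rw [hη, Pi.smul_apply, smul_eq_mul]; ring))
    (2 * Real.sqrt (decayConst d s).toReal * K.const)
    (by
      intro f g
      have := K.const_nonneg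
      simp only [LinearMap.mk₂_apply, Lp.norm_toLp]
      exact ENNReal.toReal_le_of_le_ofReal (by positivity) (K.eLpNorm_le f g))

lemma coeFn_op (K : SmoothingKernel d s) (f g : L2 d) :
    (K.op f g : Space d → ℂ) =ᵐ[volume] kernelConv K.toFun f g := by
  simp only [op, LinearMap.mkContinuous₂_apply, LinearMap.mk₂_apply]
  exact MemLp.coeFn_toLp _

lemma norm_op_le (K : SmoothingKernel d s) (f g : L2 d) :
    ‖K.op f g‖ ≤ 2 * Real.sqrt (decayConst d s).toReal * K.const * ‖f‖ * ‖g‖ := by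
  have := K.const_nonneg
  simp only [op, LinearMap.mkContinuous₂_apply, LinearMap.mk₂_apply, Lp.norm_toLp]
  exact ENNReal.toReal_le_of_le_ofReal (by positivity) (K.eLpNorm_le f g)

end SmoothingKernel

/-- Weights may be moved from the arguments of a bilinear operator into its kernel. -/
lemma kernelConv_congr {K K' : Space d → Space d → ℝ} {f f' g g' : Space d → ℂ}
    {χ ψ : Space d → ℝ} (hf : f' =ᵐ[volume] fun ξ => (χ ξ : ℂ) * f ξ)
    (hg : g' =ᵐ[volume] fun ξ => (ψ ξ : ℂ) * g ξ) {ξ : Space d} {c : ℝ}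
    (hK : ∀ η, c * K ξ η = K' ξ η * χ (ξ - η) * ψ η) :
    (c : ℂ) * kernelConv K f g ξ = kernelConv K' f' g' ξ := by
  unfold kernelConv
  rw [← integral_const_mul]
  refine integral_congr_ae ?_
  filter_upwards [(quasiMeasurePreserving_sub_left_of_right_invariant volume ξ).ae_eq_comp hf, hg]
    with η h1 h2
  simp only [Function.comp] at h1
  rw [h1, h2]
  have := congrArg (fun x : ℝ => (x : ℂ)) (hK η)
  push_cast at this
  linear_combination (f (ξ - η) * g η) * this

end

end KGS

/-! ### Weighted bounds, adjoints and symmetries of the bilinear operators; multipliers. -/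

namespace KGS

noncomputable section

variable {d : ℕ} {s : ℝ}

open ComplexConjugate

namespace SmoothingKernel

/-- A weighted bound for a bilinear operator: it suffices to dominate the kernel relative to
weights on the two arguments and on the result. -/
lemma norm_le_of_weights (K : SmoothingKernel d s) {f g f' g' q : L2 d} {χ ψ τ : Space d → ℝ}
    (hχm : Measurable χ) (hψm : Measurable ψ) (hτm : Measurable τ)
    (hχ : ∀ ξ, 0 < χ ξ) (hψ : ∀ ξ, 0 < ψ ξ)
    (hf : (f' : Space d → ℂ) =ᵐ[volume] fun ξ => (χ ξ : ℂ) * f ξ)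
    (hg : (g' : Space d → ℂ) =ᵐ[volume] fun ξ => (ψ ξ : ℂ) * g ξ)
    (hq : (q : Space d → ℂ) =ᵐ[volume] fun ξ => (τ ξ : ℂ) * K.op f g ξ)
    {C : ℝ} (hC : 0 ≤ C)
    (hK : ∀ ξ η, |τ ξ * K.toFun ξ η| ≤ C * decayKernel s ξ η * χ (ξ - η) * ψ η) :
    ‖q‖ ≤ 2 * Real.sqrt (decayConst d s).toReal * C * ‖f'‖ * ‖g'‖ := by
  -- The weights are moved into the kernel: `K'` acts on the weighted arguments and produces `q`.
  have hKm := K.measurable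
  let K' : SmoothingKernel d s :=
    { toFun := fun ξ η => τ ξ * K.toFun ξ η / (χ (ξ - η) * ψ η)
      measurable := by fun_prop
      const := C
      const_nonneg := hC
      bound := fun ξ η => by
        rw [abs_div, abs_of_pos (mul_pos (hχ _) (hψ _)), div_le_iff₀ (mul_pos (hχ _) (hψ _))]
        linarith [hK ξ η]
      decay := K.decay }
  have : q = K'.op f' g' := by
    apply Lp.ext
    filter_upwards [hq, K.coeFn_op f g, K'.coeFn_op f' g'] with ξ h1 h2 h3
    rw [h1, h2, h3]
    refine kernelConv_congr hf hg fun η => ?_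
    have h1 := (hχ (ξ - η)).ne'
    have h2 := (hψ η).ne'
    simp only [K']
    field_simp
  rw [this]
  exact K'.norm_op_le f' g'

/-- Absolute convergence of the trilinear form, which licenses the exchanges of integrals in the two
duality lemmas. -/
lemma integrable_trilinear (K : SmoothingKernel d s) (f g h : L2 d) :
    Integrable (fun p : Space d × Space d =>
      (K.toFun p.1 p.2 : ℂ) * (g (p.1 - p.2) * h p.2) * conj (f p.1)) (volume.prod volume) := by
  have hm := K.measurable_integrand g h
  have hf := L2.measurable f
  have hm' : Measurable (fun p : Space d × Space d =>
      (K.toFun p.1 p.2 : ℂ) * (g (p.1 - p.2) * h p.2) * conj (f p.1)) :=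
    hm.mul (Complex.continuous_conj.measurable.comp (hf.comp measurable_fst))
  refine ⟨hm'.aestronglyMeasurable, ?_⟩
  rw [hasFiniteIntegral_iff_enorm, lintegral_prod _ hm'.enorm.aemeasurable]
  have hI : ∀ ξ, ∫⁻ η, ‖(K.toFun ξ η : ℂ) * (g (ξ - η) * h η) * conj (f ξ)‖ₑ =
      (∫⁻ η, ‖(K.toFun ξ η : ℂ) * (g (ξ - η) * h η)‖ₑ) * ‖f ξ‖ₑ := by
    intro ξ
    rw [← lintegral_mul_const' _ _ enorm_ne_top]
    simp_rw [enorm_mul]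
    simp
  simp_rw [hI]
  have h1 := lintegral_mul_sq_le (μ := volume)
    (Measurable.lintegral_prod_right' (ν := volume) hm.enorm).aemeasurable hf.enorm.aemeasurable
  have h2 := lt_of_le_of_lt (K.lintegral_sq_le g h) ENNReal.ofReal_lt_top
  have h3 : ∫⁻ ξ, ‖f ξ‖ₑ ^ 2 < ⊤ := by rw [lintegral_enorm_sq]; exact ENNReal.ofReal_lt_top
  have h4 := lt_of_le_of_lt h1 (ENNReal.mul_lt_top h2 h3)
  by_contra hcon
  rw [not_lt, top_le_iff] at hcon
  rw [hcon] at h4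
  simp at h4

lemma inner_op (K : SmoothingKernel d s) (f g h : L2 d) :
    inner ℂ f (K.op g h) =
      ∫ ξ, ∫ η, (K.toFun ξ η : ℂ) * (g (ξ - η) * h η) * conj (f ξ) := by
  rw [L2.inner_def]
  refine integral_congr_ae ?_
  filter_upwards [K.coeFn_op g h] with ξ hξ
  rw [RCLike.inner_apply, hξ, kernelConv, integral_mul_const]

/-- Convolution with a Hermitian function is symmetric. -/
lemma inner_op_symm (K : SmoothingKernel d s) {k : Space d → ℝ} (hk : ∀ ξ η, K.toFun ξ η = k η)
    (hk' : ∀ η, k (-η) = k η) (f g h : L2 d) (hh : ∀ᵐ η, h (-η) = conj (h η)) :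
    inner ℂ (K.op g h) f = inner ℂ g (K.op f h) := by
  rw [← inner_conj_symm, K.inner_op, K.inner_op, ← integral_conj]
  simp_rw [← integral_conj]
  have e1 : ∀ ξ, ∫ η, conj ((K.toFun ξ η : ℂ) * (g (ξ - η) * h η) * conj (f ξ)) =
      ∫ η, (K.toFun ξ η : ℂ) * (conj (g (ξ + η)) * h η) * f ξ := by
    intro ξ
    -- Replacing `η` by `-η` uses up the Hermitian symmetry of `h`; the shift of `ξ` by `η` after
    -- exchanging the integrals then carries one form into the other.
    rw [← integral_neg_eq_self]
    refine integral_congr_ae ?_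
    filter_upwards [hh] with η hη
    simp only [map_mul, Complex.conj_conj, Complex.conj_ofReal, hη, sub_neg_eq_add, hk, hk']
  simp_rw [e1]
  refine (integral_integral_swap ?_).trans
    ((?_ : _ = _).trans (integral_integral_swap (K.integrable_trilinear g f h)).symm)
  rotate_left
  · refine integral_congr_ae (Eventually.of_forall fun η => ?_)
    simp only [hk]
    rw [← integral_sub_right_eq_self (fun ξ => (k η : ℂ) * (conj (g (ξ + η)) * h η) * f ξ) η]
    refine integral_congr_ae (Eventually.of_forall fun ξ => ?_)
    simp only [sub_add_cancel]
    ring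
  · have h1 := (K.integrable_trilinear g f h)
    have hmp : MeasurePreserving (fun p : Space d × Space d => (p.1 + p.2, p.2))
        (volume.prod volume) (volume.prod volume) := by
      have := (measurePreserving_add_prod (G := Space d) (volume : Measure (Space d)) volume)
      exact this
    have h2 := hmp.integrable_comp_of_integrable h1
    refine h2.congr (Eventually.of_forall fun p => ?_)
    simp only [Function.comp, Function.uncurry, add_sub_cancel_right, hk]
    ring

/-- Duality between convolution and correlation. -/
lemma inner_op_eq_inner_op_corr (K : SmoothingKernel d s) {k : Space d → ℝ}
    (hk : ∀ ξ η, K.toFun ξ η = k η) (f g h h₀ g' : L2 d)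
    (hh : (h₀ : Space d → ℂ) =ᵐ[volume] fun η => (k η : ℂ) * h η)
    (hg : ∀ᵐ ζ, (k ζ : ℂ) * g' ζ = conj (g (-ζ))) :
    inner ℂ f (K.op g h) = inner ℂ (K.op f g') h₀ := by
  rw [K.inner_op, integral_integral_swap (K.integrable_trilinear f g h), L2.inner_def]
  refine integral_congr_ae ?_
  filter_upwards [K.coeFn_op f g', hh] with η hη hhη
  rw [RCLike.inner_apply, hη, kernelConv, ← integral_conj, ← integral_const_mul]
  -- The substitution `ξ = η - ζ` turns `g (ξ - η)` into `g (-ζ)`, which `hg` expresses through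
  -- `g'`.
  rw [← integral_sub_left_eq_self _ volume η]
  refine integral_congr_ae ?_
  filter_upwards [hg] with ζ hζ
  have : η - ζ - η = -ζ := by abel
  rw [this, hk, hk, hhη]
  simp only [map_mul, Complex.conj_ofReal]
  have h2 := congrArg conj hζ
  simp only [map_mul, Complex.conj_conj, Complex.conj_ofReal] at h2
  rw [← h2]; ring

end SmoothingKernel

/-! ### Fourier multipliers and conjugate reflection on the frequency side -/

/-- A bounded measurable real function. -/
structure Multiplier (d : ℕ) where
  /-- the function -/
  toFun : Space d → ℝ
  measurable : Measurable toFun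
  /-- the bound -/
  const : ℝ
  bound : ∀ ξ, |toFun ξ| ≤ const

namespace Multiplier

lemma memLp (χ : Multiplier d) (f : L2 d) : MemLp (fun ξ => (χ.toFun ξ : ℂ) * f ξ) 2 volume := by
  refine MemLp.of_le_mul (c := χ.const) (Lp.memLp f) ?_ (Eventually.of_forall fun ξ => ?_)
  · have := χ.measurable
    have := L2.measurable f
    exact Measurable.aestronglyMeasurable (by fun_prop)
  · rw [norm_mul, Complex.norm_real]
    gcongr
    exact χ.bound ξ

/-- Multiplication by a bounded function on `L²`. -/
def op (χ : Multiplier d) : L2 d →L[ℂ] L2 d :=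
  LinearMap.mkContinuous
    { toFun := fun f => (χ.memLp f).toLp _
      map_add' := fun f g => by
        rw [← MemLp.toLp_add, MemLp.toLp_eq_toLp_iff]
        filter_upwards [Lp.coeFn_add f g] with ξ hξ
        rw [hξ]; simp [mul_add]
      map_smul' := fun c f => by
        rw [RingHom.id_apply, ← MemLp.toLp_const_smul, MemLp.toLp_eq_toLp_iff]
        filter_upwards [Lp.coeFn_smul c f] with ξ hξ
        rw [hξ]; simp; ring }
    χ.const
    (fun f => by
      refine Lp.norm_le_mul_norm_of_ae_le_mul ?_
      simp only [LinearMap.coe_mk, AddHom.coe_mk]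
      filter_upwards [MemLp.coeFn_toLp (χ.memLp f)] with ξ hξ
      rw [hξ, norm_mul, Complex.norm_real]
      gcongr
      exact χ.bound ξ)

lemma coeFn_op (χ : Multiplier d) (f : L2 d) :
    (χ.op f : Space d → ℂ) =ᵐ[volume] fun ξ => (χ.toFun ξ : ℂ) * f ξ :=
  MemLp.coeFn_toLp (χ.memLp f)

end Multiplier

lemma memLp_conjReflect (f : L2 d) : MemLp (fun ξ => conj (f (-ξ))) 2 volume :=
  ((Lp.memLp f).comp_measurePreserving (Measure.measurePreserving_neg volume)).star

/-- The function `ξ ↦ conj (f (-ξ))`, the Fourier transform of the complex conjugate. -/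
def conjReflect (f : L2 d) : L2 d := (memLp_conjReflect f).toLp _

lemma coeFn_conjReflect (f : L2 d) :
    (conjReflect f : Space d → ℂ) =ᵐ[volume] fun ξ => conj (f (-ξ)) :=
  MemLp.coeFn_toLp _

lemma ae_comp_neg {p : Space d → Prop} (h : ∀ᵐ ξ, p ξ) : ∀ᵐ ξ, p (-ξ) :=
  (Measure.measurePreserving_neg (volume : Measure (Space d))).quasiMeasurePreserving.ae h

lemma conjReflect_sub (f g : L2 d) : conjReflect (f - g) = conjReflect f - conjReflect g := by
  apply Lp.ext
  filter_upwards [coeFn_conjReflect (f - g), coeFn_conjReflect f, coeFn_conjReflect g,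
    Lp.coeFn_sub (conjReflect f) (conjReflect g), ae_comp_neg (Lp.coeFn_sub f g)] with ξ h1 h2 h3 h4 h5
  rw [h1, h4, Pi.sub_apply, h2, h3, h5, Pi.sub_apply, map_sub]

lemma norm_conjReflect (f : L2 d) : ‖conjReflect f‖ = ‖f‖ := by
  rw [conjReflect, Lp.norm_toLp, Lp.norm_def]
  congr 1
  rw [← eLpNorm_comp_measurePreserving (Lp.aestronglyMeasurable f)
    (Measure.measurePreserving_neg volume)]
  exact eLpNorm_congr_norm_ae (Eventually.of_forall fun ξ => by simp)

lemma continuous_conjReflect : Continuous (conjReflect : L2 d → L2 d) := by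
  refine (Isometry.of_dist_eq fun f g => ?_).continuous
  rw [dist_eq_norm, dist_eq_norm, ← conjReflect_sub, norm_conjReflect]

end

end KGS

/-! ### Transfer of the system from space-time to the frequency side. -/

namespace KGS

noncomputable section

variable {d : ℕ} {s : ℝ}

open ComplexConjugate

/-! ### The inverse Fourier transform of integrable functions -/

lemma integral_fourierInv_mul_eq {f g : Space d → ℂ} (hf : Integrable f) (hg : Integrable g) :
    ∫ x, 𝓕⁻ f x * g x = ∫ x, f x * 𝓕⁻ g x := by
  have h := VectorFourier.integral_fourierIntegral_smul_eq_flip (μ := (volume : Measure (Space d)))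
    (ν := (volume : Measure (Space d))) (L := innerₗ (Space d)) Real.continuous_fourierChar
    continuous_inner hf.comp_neg hg
  have e1 : ∀ x, VectorFourier.fourierIntegral Real.fourierChar volume (innerₗ (Space d))
      (fun x => f (-x)) x = 𝓕⁻ f x := fun x => by
    rw [Real.fourierInv_eq_fourier_comp_neg]; rfl
  have e2 : ∀ x, VectorFourier.fourierIntegral Real.fourierChar volume (innerₗ (Space d)).flip
      g x = 𝓕⁻ g (-x) := fun x => by
    rw [Real.fourierInv_eq_fourier_neg, neg_neg, flip_innerₗ]; rfl
  simp only [e1, e2, smul_eq_mul] at h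
  rw [h, ← integral_neg_eq_self]
  simp

lemma continuous_fourierInv {f : Space d → ℂ} (hf : Integrable f) : Continuous (𝓕⁻ f) := by
  rw [Real.fourierInv_eq_fourier_comp_neg]
  exact VectorFourier.fourierIntegral_continuous Real.continuous_fourierChar
    (by exact continuous_inner) hf.comp_neg

/-- The inverse Fourier transform on `L²` is given by the integral on integrable functions. -/
lemma coeFn_fourierInv_ae_eq (g : L2 d) (hg : Integrable (g : Space d → ℂ)) :
    ((𝓕⁻ g : L2 d) : Space d → ℂ) =ᵐ[volume] 𝓕⁻ (g : Space d → ℂ) := by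
  have hc := continuous_fourierInv hg
  have h := ae_eq_zero_of_integral_contDiff_smul_eq_zero
    (μ := (volume : Measure (Space d)))
    (f := fun x => (𝓕⁻ g : L2 d) x - 𝓕⁻ (g : Space d → ℂ) x)
    (((Lp.memLp (𝓕⁻ g : L2 d)).locallyIntegrable (by norm_num)).sub hc.locallyIntegrable) ?_
  · filter_upwards [h] with x hx
    exact sub_eq_zero.1 hx
  intro φ hφ hφc
  -- The test function is regarded as a Schwartz function, so that the `L²` transform can be moved
  -- onto it by duality of tempered distributions.
  have hφ₁ : HasCompactSupport (Complex.ofRealCLM ∘ φ) := hφc.comp_left rfl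
  have hφ₂ : ContDiff ℝ ∞ (Complex.ofRealCLM ∘ φ) := by fun_prop
  set Φ := hφ₁.toSchwartzMap hφ₂ with hΦ
  have hΦx : ∀ x, Φ x = (φ x : ℂ) := fun x => rfl
  have h1 : ∫ x, Φ x • (𝓕⁻ g : L2 d) x = ∫ x, (𝓕⁻ Φ) x • g x := by
    rw [← Lp.toTemperedDistribution_apply, ← Lp.toTemperedDistribution_apply,
      ← Lp.fourierInv_toTemperedDistribution_eq, TemperedDistribution.fourierInv_apply]
  have h2 : ∫ x, (𝓕⁻ Φ) x • g x = ∫ x, Φ x • 𝓕⁻ (g : Space d → ℂ) x := by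
    have := integral_fourierInv_mul_eq (f := (Φ : Space d → ℂ)) Φ.integrable hg
    simpa [smul_eq_mul, SchwartzMap.fourierInv_coe] using this
  have i1 : Integrable (fun x => Φ x • (𝓕⁻ g : L2 d) x) := by
    have := (Φ.memLp 2 volume).integrable_mul (Lp.memLp (𝓕⁻ g : L2 d))
    exact this
  have i2 : Integrable (fun x => Φ x • 𝓕⁻ (g : Space d → ℂ) x) := by
    refine Continuous.integrable_of_hasCompactSupport (by fun_prop) ?_
    exact hφ₁.smul_right
  have : ∀ x, φ x • ((𝓕⁻ g : L2 d) x - 𝓕⁻ (g : Space d → ℂ) x) =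
      Φ x • (𝓕⁻ g : L2 d) x - Φ x • 𝓕⁻ (g : Space d → ℂ) x := by
    intro x
    rw [hΦx, ← smul_sub, Complex.real_smul, smul_eq_mul]
  simp_rw [this]
  rw [integral_sub i1 i2, h1, h2, sub_self]

lemma eq_fourierInv_of_continuous {f : Space d → ℂ} (hc : Continuous f) (hf : MemLp f 2 volume)
    (hi : Integrable ((𝓕 (hf.toLp f) : L2 d) : Space d → ℂ)) :
    f = 𝓕⁻ ((𝓕 (hf.toLp f) : L2 d) : Space d → ℂ) := by
  refine (Continuous.ae_eq_iff_eq volume hc (continuous_fourierInv hi)).1 ?_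
  have h := coeFn_fourierInv_ae_eq _ hi
  rw [FourierTransform.fourierInv_fourier_eq] at h
  exact (MemLp.coeFn_toLp hf).symm.trans h

lemma eq_zero_of_fourierInv_eq_zero (h : L2 d) (hi : Integrable (h : Space d → ℂ))
    (h0 : ∀ x, 𝓕⁻ (h : Space d → ℂ) x = 0) : h = 0 := by
  have h1 : (𝓕⁻ h : L2 d) = 0 := by
    apply Lp.ext
    filter_upwards [coeFn_fourierInv_ae_eq h hi, Lp.coeFn_zero ℂ 2 (volume : Measure (Space d))]
      with x hx h0'
    rw [hx, h0, h0', Pi.zero_apply]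
  have h2 : (𝓕 (𝓕⁻ h : L2 d) : L2 d) = h := FourierTransform.fourier_fourierInv_eq h
  rw [← h2, h1]
  exact (Lp.fourierTransformₗᵢ (Space d) ℂ).map_zero

lemma fourierInv_mul_eq {f g : Space d → ℂ} (hf : Integrable f) (hg : Integrable g) (x : Space d) :
    𝓕⁻ f x * 𝓕⁻ g x = 𝓕⁻ (kernelConv (fun _ _ => 1) f g) x := by
  rw [Real.fourierInv_eq_fourier_neg, Real.fourierInv_eq_fourier_neg,
    Real.fourierInv_eq_fourier_neg, mul_comm, ← Real.fourier_mul_convolution_eq hg hf]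
  refine congrArg (fun F : Space d → ℂ => 𝓕 F (-x)) (funext fun ξ => ?_)
  simp only [convolution, kernelConv, ContinuousLinearMap.mul_apply']
  congr 1
  ext η
  push_cast
  ring

lemma conj_fourierInv (f : Space d → ℂ) (x : Space d) :
    conj (𝓕⁻ f x) = 𝓕⁻ (fun ξ => conj (f (-ξ))) x := by
  rw [Real.fourierInv_eq', Real.fourierInv_eq', ← integral_conj, ← integral_neg_eq_self]
  congr 1
  ext ξ
  simp only [smul_eq_mul, map_mul, ← Complex.exp_conj, inner_neg_left]
  congr 2
  simp [Complex.conj_ofNat]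

lemma integrable_pow_mul {f : Space d → ℂ} (hf : AEStronglyMeasurable f volume)
    (hi : Integrable (fun ξ => ((bracket ξ : ℂ) ^ 2) * f ξ)) (n : ℕ) (hn : n ≤ 2) :
    Integrable (fun ξ => ‖ξ‖ ^ n * ‖f ξ‖) := by
  refine hi.norm.mono' (by fun_prop) (Eventually.of_forall fun ξ => ?_)
  have h1 : ‖ξ‖ ≤ bracket ξ := by
    refine le_trans ?_ (norm_le_bracket ξ)
    rw [norm_smul, Real.norm_of_nonneg (by positivity)]
    nlinarith [Real.pi_gt_three, norm_nonneg ξ]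
  have h2 : ‖ξ‖ ^ n ≤ bracket ξ ^ 2 :=
    (pow_le_pow_left₀ (norm_nonneg _) h1 n).trans (pow_le_pow_right₀ (one_le_bracket ξ) hn)
  rw [norm_mul, norm_mul, norm_pow, norm_norm, norm_norm, norm_pow, Complex.norm_real,
    Real.norm_of_nonneg (bracket_pos ξ).le]
  gcongr

/-- The symbol of `Δ` is `-‖2πξ‖² = 1 - ⟨ξ⟩²`; two moments of `f` permit differentiation under the
integral. -/
lemma laplacian_fourierInv {f : Space d → ℂ} (hf : AEStronglyMeasurable f volume)
    (hi : Integrable (fun ξ => ((bracket ξ : ℂ) ^ 2) * f ξ)) (x : Space d) :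
    Δ (𝓕⁻ f) x = 𝓕⁻ (fun ξ => (1 - (bracket ξ : ℂ) ^ 2) * f ξ : Space d → ℂ) x := by
  rw [Real.fourierInv_eq_fourier_comp_neg, Real.fourierInv_eq_fourier_comp_neg]
  set h := fun ξ => f (-ξ) with hh
  have hm : AEStronglyMeasurable h volume :=
    hf.comp_measurePreserving (Measure.measurePreserving_neg volume)
  have hi' : Integrable (fun ξ => ((bracket ξ : ℂ) ^ 2) * h ξ) := by
    have := hi.comp_neg
    simpa only [bracket_neg] using this
  have hN : ∀ n : ℕ, (n : ℕ∞) ≤ (2 : ℕ∞) → Integrable (fun v => ‖v‖ ^ n * ‖h v‖) := fun n hn =>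
    integrable_pow_mul hm hi' n (by exact_mod_cast hn)
  have h2 := Real.iteratedFDeriv_fourier (N := 2) hN hm (n := 2) (by norm_num)
  rw [InnerProductSpace.laplacian_eq_iteratedFDeriv_orthonormalBasis _
    (EuclideanSpace.basisFun (Fin d) ℝ), h2]
  have hI := VectorFourier.integrable_fourierPowSMulRight (μ := (volume : Measure (Space d)))
    (innerSL ℝ) (hN 2 le_rfl) hm
  simp_rw [Real.fourier_continuousMultilinearMap_apply hI]
  simp only [Real.fourier_eq]
  rw [← integral_finsetSum]
  · congr 1
    ext ξ
    rw [← Finset.smul_sum]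
    congr 1
    simp only [VectorFourier.fourierPowSMulRight_apply, Fin.prod_univ_two, bracket_neg]
    rw [← Finset.smul_sum]
    simp only [Matrix.cons_val_zero, Matrix.cons_val_one,
      EuclideanSpace.basisFun_apply, Matrix.cons_val_fin_one]
    rw [← Finset.sum_smul]
    have e : ∑ i, inner ℝ ξ (EuclideanSpace.single i (1 : ℝ)) *
        inner ℝ ξ (EuclideanSpace.single i (1 : ℝ)) = ‖ξ‖ ^ 2 := by
      rw [EuclideanSpace.norm_sq_eq]
      simp [EuclideanSpace.inner_single_right, sq]
    refine (congrArg (fun r : ℝ => (-(2 * (Real.pi : ℂ) * Complex.I)) ^ 2 • r • h ξ) e).trans ?_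
    have hb := congrArg (fun x : ℝ => (x : ℂ)) (bracket_sq ξ)
    rw [norm_smul, Real.norm_of_nonneg (by positivity)] at hb
    push_cast at hb
    rw [hb]
    simp only [smul_eq_mul, Complex.real_smul]
    push_cast
    have : (Complex.I) ^ 2 = -1 := Complex.I_sq
    linear_combination (4 * Real.pi ^ 2 * ‖ξ‖ ^ 2 * h ξ) * this
  · intro i _
    rw [Real.fourierIntegral_convergent_iff]
    refine hI.norm.const_mul ‖EuclideanSpace.basisFun (Fin d) ℝ i‖ |>.const_mul
      ‖EuclideanSpace.basisFun (Fin d) ℝ i‖ |>.mono' ?_ (Eventually.of_forall fun ξ => ?_)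
    · exact (ContinuousMultilinearMap.apply ℝ (fun _ : Fin 2 => Space d) ℂ _).continuous
        |>.comp_aestronglyMeasurable hI.1
    · refine (ContinuousMultilinearMap.le_opNorm _ _).trans (le_of_eq ?_)
      simp [Fin.prod_univ_two]

end

end KGS

namespace KGS

noncomputable section

variable {d : ℕ} {s : ℝ}

open ComplexConjugate

/-! ### Scales of weighted curves -/

/-- `a k t = ⟨ξ⟩^k a 0 t` for all `k`. -/
def IsScale (a : ℕ → ℝ → L2 d) : Prop :=
  ∀ k t, (a k t : Space d → ℂ) =ᵐ[volume] fun ξ => (bracket ξ : ℂ) ^ k * a 0 t ξ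

lemma bracket_ne_zero' (ξ : Space d) : (bracket ξ : ℂ) ≠ 0 :=
  Complex.ofReal_ne_zero.2 (bracket_ne_zero ξ)

lemma IsScale.ae_eq {a : ℕ → ℝ → L2 d} (ha : IsScale a) (j k : ℕ) (t : ℝ) :
    (a (j + k) t : Space d → ℂ) =ᵐ[volume] fun ξ => (bracket ξ : ℂ) ^ k * a j t ξ := by
  filter_upwards [ha (j + k) t, ha j t] with ξ h1 h2
  rw [h1, h2]; ring

lemma IsScale.conjReflect {a : ℕ → ℝ → L2 d} (ha : IsScale a) :
    IsScale (fun k t => conjReflect (a k t)) := by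
  intro k t
  filter_upwards [coeFn_conjReflect (a k t), coeFn_conjReflect (a 0 t), ae_comp_neg (ha k t)]
    with ξ h1 h2 h3
  rw [h1, h2, h3, bracket_neg]
  simp

/-- Multiplication by `⟨ξ⟩^{-k}`. -/
def bracketInv (d k : ℕ) : Multiplier d where
  toFun ξ := (bracket ξ ^ k)⁻¹
  measurable := by fun_prop
  const := 1
  bound ξ := by
    have := one_le_bracket ξ
    rw [abs_of_pos (by have := bracket_pos ξ; positivity)]
    exact inv_le_one_of_one_le₀ (one_le_pow₀ this)

lemma IsScale.bracketInv_op {a : ℕ → ℝ → L2 d} (ha : IsScale a) (j k : ℕ) (t : ℝ) :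
    (bracketInv d k).op (a (j + k) t) = a j t := by
  apply Lp.ext
  filter_upwards [(bracketInv d k).coeFn_op (a (j + k) t), ha.ae_eq j k t] with ξ h1 h2
  have := bracket_ne_zero' ξ
  rw [h1, h2, bracketInv]
  push_cast
  field_simp

lemma memLp_bracket_inv_sq (hd : d ≤ 3) :
    MemLp (fun ξ : Space d => ((bracket ξ : ℂ) ^ 2)⁻¹) 2 volume := by
  refine ⟨by
    have : Measurable (fun ξ : Space d => ((bracket ξ : ℂ) ^ 2)⁻¹) := by fun_prop
    exact this.aestronglyMeasurable, ?_⟩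
  have hs : (d : ℝ) < 2 * 2 := by
    have : (d : ℝ) ≤ 3 := by exact_mod_cast hd
    linarith
  have h := decayConst_lt_top (d := d) hs
  have h2 : eLpNorm (fun ξ : Space d => ((bracket ξ : ℂ) ^ 2)⁻¹) 2 volume ^ 2 = decayConst d 2 := by
    rw [eLpNorm_two_sq, decayConst]
    refine lintegral_congr fun ξ => ?_
    rw [← ofReal_norm]
    congr 2
    rw [norm_inv, norm_pow, Complex.norm_real, Real.norm_of_nonneg (bracket_pos ξ).le,
      Real.rpow_neg (bracket_pos ξ).le]
    norm_num
  rw [← h2] at h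
  by_contra hcon
  rw [not_lt, top_le_iff] at hcon
  rw [hcon] at h
  simp at h

lemma integrable_bracket_inv_sq_mul (hd : d ≤ 3) (f : L2 d) :
    Integrable (fun ξ => ((bracket ξ : ℂ) ^ 2)⁻¹ * f ξ) :=
  (memLp_bracket_inv_sq hd).integrable_mul (Lp.memLp f)

lemma IsScale.integrable {a : ℕ → ℝ → L2 d} (ha : IsScale a) (hd : d ≤ 3) (k : ℕ) (t : ℝ) :
    Integrable (a k t : Space d → ℂ) := by
  refine (integrable_bracket_inv_sq_mul hd (a (k + 2) t)).congr ?_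
  filter_upwards [ha.ae_eq k 2 t] with ξ h1
  have := bracket_ne_zero' ξ
  rw [h1]
  field_simp

lemma memLp_evalVec (hd : d ≤ 3) (x : Space d) :
    MemLp (fun ξ : Space d => (Real.fourierChar (-inner ℝ ξ x) : ℂ) * ((bracket ξ : ℂ) ^ 2)⁻¹) 2
      volume := by
  refine (memLp_bracket_inv_sq hd).of_le ?_ (Eventually.of_forall fun ξ => ?_)
  · refine Continuous.aestronglyMeasurable (Continuous.mul ?_ ?_)
    · exact continuous_subtype_val.comp (Real.continuous_fourierChar.comp (by fun_prop))
    · exact Continuous.inv₀ (by fun_prop) fun ξ => pow_ne_zero _ (bracket_ne_zero' ξ)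
  · rw [norm_mul, Circle.norm_coe, one_mul]

/-- The functional `f ↦ (⟨D⟩^{-2} f^∨)(x)` on `L²` of the frequency space. -/
def evalFun (hd : d ≤ 3) (x : Space d) : L2 d →L[ℂ] ℂ :=
  innerSL ℂ ((memLp_evalVec hd x).toLp _)

lemma evalFun_apply (hd : d ≤ 3) (x : Space d) (f : L2 d) :
    evalFun hd x f = 𝓕⁻ (fun ξ => ((bracket ξ : ℂ) ^ 2)⁻¹ * f ξ : Space d → ℂ) x := by
  rw [evalFun, innerSL_apply_apply, L2.inner_def, Real.fourierInv_eq]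
  refine integral_congr_ae ?_
  filter_upwards [MemLp.coeFn_toLp (memLp_evalVec hd x)] with ξ h1
  rw [RCLike.inner_apply, h1, Circle.smul_def]
  simp only [map_mul, AddChar.map_neg_eq_inv, smul_eq_mul]
  rw [Circle.coe_inv_eq_conj, Complex.conj_conj]
  simp
  ring

/-- Point evaluations, bounded on `L²` after applying `⟨D⟩^{-2}`, separate points. They are the
bridge from the pointwise equations to equations in `L²`. -/
lemma eq_zero_of_evalFun (hd : d ≤ 3) (f : L2 d) (h : ∀ x, evalFun hd x f = 0) : f = 0 := by
  have h1 := (bracketInv d 2).coeFn_op f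
  have h2 : ((bracketInv d 2).op f : Space d → ℂ) =ᵐ[volume]
      fun ξ => ((bracket ξ : ℂ) ^ 2)⁻¹ * f ξ := by
    filter_upwards [h1] with ξ h
    rw [h, bracketInv]; push_cast; rfl
  have h3 : (bracketInv d 2).op f = 0 := by
    refine eq_zero_of_fourierInv_eq_zero _ ((integrable_bracket_inv_sq_mul hd f).congr h2.symm) ?_
    intro x
    rw [← h x, evalFun_apply]
    exact Real.fourierInv_congr_ae h2 x
  apply Lp.ext
  rw [h3] at h2
  filter_upwards [h2, Lp.coeFn_zero ℂ 2 (volume : Measure (Space d))] with ξ h4 h5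
  rw [h5] at h4 ⊢
  have := bracket_ne_zero' ξ
  simpa [this] using h4.symm

/-- A curve is differentiable if it is so against a separating family of functionals, with a
continuous candidate for the derivative. -/
lemma hasDerivAt_of_separating {ι F : Type*} [NormedAddCommGroup F] [NormedSpace ℂ F]
    [CompleteSpace F] (l : ι → F →L[ℂ] ℂ) (hl : ∀ f, (∀ i, l i f = 0) → f = 0) {f g : ℝ → F}
    (hg : Continuous g) (h : ∀ i t, HasDerivAt (fun τ => l i (f τ)) (l i (g t)) t) (t : ℝ) :
    HasDerivAt f (g t) t := by
  have hG : ∀ t, HasDerivAt (fun τ => ∫ r in (0 : ℝ)..τ, g r) (g t) t := fun t =>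
    intervalIntegral.integral_hasDerivAt_right (hg.intervalIntegrable _ _)
      (hg.stronglyMeasurableAtFilter _ _) hg.continuousAt
  -- Against each functional, `f` minus the primitive of `g` has zero derivative, hence is constant;
  -- separation makes it constant in `F`.
  have hconst : ∀ t, f t = (∫ r in (0 : ℝ)..t, g r) + f 0 := by
    intro t
    rw [← sub_eq_zero]
    refine hl _ fun i => ?_
    have hd : ∀ τ, HasDerivAt (fun τ => l i (f τ) - l i (∫ r in (0 : ℝ)..τ, g r)) 0 τ := fun τ => by
      have h1 := (h i τ).sub (((l i).restrictScalars ℝ).hasFDerivAt.comp_hasDerivAt τ (hG τ))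
      rw [show (l i) (g τ) - ((l i).restrictScalars ℝ) (g τ) = 0 from sub_self _] at h1
      exact h1
    have := is_const_of_deriv_eq_zero (fun τ => (hd τ).differentiableAt) (fun τ => (hd τ).deriv) t 0
    simp only [intervalIntegral.integral_same, map_zero, sub_zero] at this
    rw [map_sub, map_add, ← this]
    ring
  have := (hG t).add_const (f 0)
  exact this.congr_of_eventuallyEq (Eventually.of_forall hconst)

/-- Pointwise differentiability in time improves to differentiability in every weighted `L²` space.
One works at level `k + 2`, from which point values of the level `0` inverse transform are bounded
functionals, and then returns to level `k` by a bounded multiplier. -/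
lemma hasDerivAt_of_fourierInv (hd : d ≤ 3) {a g : ℕ → ℝ → L2 d} (ha : IsScale a)
    (hg : IsScale g) (hgc : ∀ k, Continuous (g k))
    (h : ∀ t x, HasDerivAt (fun τ => 𝓕⁻ (a 0 τ : Space d → ℂ) x) (𝓕⁻ (g 0 t : Space d → ℂ) x) t)
    (k : ℕ) (t : ℝ) : HasDerivAt (a k) (g k t) t := by
  have key : ∀ {c : ℕ → ℝ → L2 d}, IsScale c → ∀ x τ,
      (evalFun hd x ∘L (bracketInv d k).op) (c (k + 2) τ) = 𝓕⁻ (c 0 τ : Space d → ℂ) x := by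
    intro c hc x τ
    have e : (bracketInv d k).op (c (k + 2) τ) = c 2 τ := by
      rw [add_comm]; exact hc.bracketInv_op 2 k τ
    rw [ContinuousLinearMap.comp_apply, e, evalFun_apply]
    refine Real.fourierInv_congr_ae ?_ x
    filter_upwards [hc 2 τ] with ξ h1
    have := bracket_ne_zero' ξ
    rw [h1]; field_simp
  have h2 : HasDerivAt (a (k + 2)) (g (k + 2) t) t := by
    refine hasDerivAt_of_separating (fun x => evalFun hd x ∘L (bracketInv d k).op) ?_ (hgc _) ?_ t
    · intro f hf
      have h0 : (bracketInv d k).op f = 0 := eq_zero_of_evalFun hd _ hf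
      apply Lp.ext
      have h1 := (bracketInv d k).coeFn_op f
      rw [h0] at h1
      filter_upwards [h1, Lp.coeFn_zero ℂ 2 (volume : Measure (Space d))] with ξ h4 h5
      rw [h5] at h4 ⊢
      have := bracket_ne_zero' ξ
      simpa [this, bracketInv, bracket_ne_zero] using h4.symm
    · intro x τ
      simp only [key ha, key hg]
      exact h τ x
  have h3 := (((bracketInv d 2).op).restrictScalars ℝ).hasFDerivAt.comp_hasDerivAt t h2
  have e1 : ∀ τ, a k τ = (((bracketInv d 2).op).restrictScalars ℝ) (a (k + 2) τ) := fun τ =>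
    (ha.bracketInv_op k 2 τ).symm
  have e2 : g k t = (((bracketInv d 2).op).restrictScalars ℝ) (g (k + 2) t) :=
    (hg.bracketInv_op k 2 t).symm
  rw [e2]
  exact h3.congr_of_eventuallyEq (Eventually.of_forall e1)

/-! ### The Fourier transform of a curve in all Sobolev spaces -/

/-- The weighted curves `a k t = ⟨ξ⟩^k û(t)` of a continuous curve in every Sobolev space. -/
structure IsProfile (f : ℝ → Space d → ℂ) (a : ℕ → ℝ → L2 d) : Prop where
  scale : IsScale a
  continuous : ∀ k, Continuous (a k)
  fourier : ∀ t, ∃ hf : MemLp (f t) 2 volume, a 0 t = 𝓕 (hf.toLp (f t))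

lemma gevreySymbol_zero_nat (k : ℕ) (ξ : Space d) :
    gevreySymbol 0 k ((2 * Real.pi) • ξ) = bracket ξ ^ k := by
  simp [gevreySymbol, bracket]

lemma gevreyNorm_zero_nat (k : ℕ) {f : Space d → ℂ} (hf : MemLp f 2 volume) :
    gevreyNorm 0 k f = eLpNorm (fun ξ => (bracket ξ : ℂ) ^ k * (𝓕 (hf.toLp f) : L2 d) ξ) 2
      volume := by
  rw [gevreyNorm, dif_pos hf]
  simp_rw [gevreySymbol_zero_nat]
  push_cast
  rfl

lemma MemGevrey.memLp {σ r : ℝ} {f : Space d → ℂ} (h : MemGevrey σ r f) : MemLp f 2 volume := by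
  by_contra hcon
  rw [MemGevrey, gevreyNorm, dif_neg hcon] at h
  exact lt_irrefl _ h

lemma exists_isProfile {f : ℝ → Space d → ℂ} (h : ∀ k : ℕ, ContinuousInSobolev k f) :
    ∃ a, IsProfile f a := by
  have hf : ∀ t, MemLp (f t) 2 volume := fun t => ((h 0).1 t).memLp
  have hm : ∀ k t, MemLp (fun ξ => (bracket ξ : ℂ) ^ k * (𝓕 ((hf t).toLp (f t)) : L2 d) ξ) 2
      volume := by
    intro k t
    have hk := (h k).1 t
    rw [MemGevrey, gevreyNorm_zero_nat k (hf t)] at hk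
    refine ⟨?_, hk⟩
    have := L2.measurable (𝓕 ((hf t).toLp (f t)) : L2 d)
    exact Measurable.aestronglyMeasurable (by fun_prop)
  have h0 : ∀ t, (hm 0 t).toLp _ = 𝓕 ((hf t).toLp (f t)) := by
    intro t
    apply Lp.ext
    filter_upwards [MemLp.coeFn_toLp (hm 0 t)] with ξ h1
    rw [h1]; simp
  refine ⟨fun k t => (hm k t).toLp _, ?_, ?_, fun t => ⟨hf t, h0 t⟩⟩
  · intro k t
    simp only [h0]
    exact MemLp.coeFn_toLp (hm k t)
  · intro k
    rw [continuous_iff_continuousAt]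
    intro t₀
    rw [ContinuousAt, tendsto_iff_norm_sub_tendsto_zero]
    have h1 := (h k).2 t₀
    have e : ∀ t, gevreyNorm 0 k (fun x => f t x - f t₀ x) =
        ENNReal.ofReal ‖(hm k t).toLp _ - (hm k t₀).toLp _‖ := by
      intro t
      change gevreyNorm 0 k (f t - f t₀) = _
      rw [gevreyNorm_zero_nat k ((hf t).sub (hf t₀)), ← MemLp.toLp_sub, Lp.norm_toLp,
        ENNReal.ofReal_toReal ((hm k t).sub (hm k t₀)).2.ne]
      refine eLpNorm_congr_ae ?_
      have e1 : (𝓕 (((hf t).sub (hf t₀)).toLp (f t - f t₀)) : L2 d) =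
          𝓕 ((hf t).toLp (f t)) - 𝓕 ((hf t₀).toLp (f t₀)) := by
        rw [MemLp.toLp_sub]
        exact (Lp.fourierTransformₗᵢ (Space d) ℂ).map_sub _ _
      have e2 := Lp.coeFn_sub (𝓕 ((hf t).toLp (f t)) : L2 d) (𝓕 ((hf t₀).toLp (f t₀)) : L2 d)
      rw [← e1] at e2
      filter_upwards [e2] with ξ h2
      simp only [Pi.sub_apply] at h2 ⊢
      rw [← mul_sub, ← h2]
    simp only [e] at h1
    have h2 := (ENNReal.tendsto_toReal ENNReal.zero_ne_top).comp h1
    simpa [Function.comp_def] using h2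

lemma IsProfile.eq_fourierInv {f : ℝ → Space d → ℂ} {a : ℕ → ℝ → L2 d} (h : IsProfile f a)
    (hd : d ≤ 3) {t : ℝ} (hc : Continuous (f t)) : f t = 𝓕⁻ (a 0 t : Space d → ℂ) := by
  obtain ⟨hf, e⟩ := h.fourier t
  have hi := h.scale.integrable hd 0 t
  rw [e] at hi ⊢
  exact eq_fourierInv_of_continuous hc hf hi

lemma IsProfile.laplacian {f : ℝ → Space d → ℂ} {a : ℕ → ℝ → L2 d} (h : IsProfile f a)
    (hd : d ≤ 3) {t : ℝ} (hc : Continuous (f t)) (x : Space d) :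
    Δ (f t) x = 𝓕⁻ (a 0 t : Space d → ℂ) x - 𝓕⁻ (a 2 t : Space d → ℂ) x := by
  have h2 := h.scale 2 t
  have hi := h.scale.integrable hd 2 t
  conv_lhs => rw [h.eq_fourierInv hd hc]
  rw [laplacian_fourierInv (Lp.aestronglyMeasurable _) (hi.congr h2),
    Real.fourierInv_eq, Real.fourierInv_eq, Real.fourierInv_eq, ← integral_sub]
  · refine integral_congr_ae ?_
    filter_upwards [h2] with ξ hξ
    rw [hξ, ← smul_sub]
    congr 1; ring
  · have := (Real.fourierIntegral_convergent_iff (-x)).2 (h.scale.integrable hd 0 t)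
    simpa [inner_neg_right] using this
  · have := (Real.fourierIntegral_convergent_iff (-x)).2 hi
    simpa [inner_neg_right] using this

end

end KGS

namespace KGS

noncomputable section

variable {d : ℕ} {s : ℝ}

open ComplexConjugate

/-! ### The system on the frequency side -/

/-- The kernel by which `⟨D⟩^k (f g)` is computed from `⟨D⟩^k f` and `⟨D⟩^{k+2} g`. -/
def prodKernel (hd : d ≤ 3) (k : ℕ) : SmoothingKernel d 2 where
  toFun ξ η := bracket ξ ^ k * ((bracket (ξ - η) ^ k)⁻¹ * (bracket η ^ (k + 2))⁻¹)
  measurable := by fun_prop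
  const := 2 ^ k
  const_nonneg := by positivity
  bound ξ η := by
    have ha := one_le_bracket (ξ - η)
    have hb := one_le_bracket η
    have h0 := bracket_pos ξ
    -- Both brackets on the right are at least one, so their sum is at most twice their product; the
    -- `k`-th power gives the constant `2 ^ k`.
    have h1 : bracket ξ ≤ 2 * (bracket (ξ - η) * bracket η) := by
      nlinarith [bracket_le_add ξ η]
    have h2 := pow_le_pow_left₀ h0.le h1 k
    have ha0 := bracket_pos (ξ - η)
    have hb0 := bracket_pos η
    rw [abs_of_pos (by positivity)]
    have h3 : bracket η ^ (-(2 : ℝ)) ≤ decayKernel 2 ξ η :=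
      le_add_of_nonneg_left (Real.rpow_nonneg ha0.le _)
    refine le_trans ?_ (mul_le_mul_of_nonneg_left h3 (by positivity))
    have h4 : bracket η ^ (-(2 : ℝ)) = (bracket η ^ 2)⁻¹ := by
      rw [Real.rpow_neg hb0.le]; norm_num
    rw [h4]
    refine (mul_le_mul_of_nonneg_right h2 (by positivity)).trans (le_of_eq ?_)
    rw [mul_pow, mul_pow, pow_add]
    field_simp
  decay := by
    have : (d : ℝ) ≤ 3 := by exact_mod_cast hd
    linarith

lemma isScale_prodKernel (hd : d ≤ 3) {a b : ℕ → ℝ → L2 d} (ha : IsScale a) (hb : IsScale b) :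
    IsScale (fun k t => (prodKernel hd k).op (a k t) (b (k + 2) t)) := by
  intro k t
  filter_upwards [(prodKernel hd k).coeFn_op (a k t) (b (k + 2) t),
    (prodKernel hd 0).coeFn_op (a 0 t) (b (0 + 2) t)] with ξ h1 h2
  rw [h1, h2, ← Complex.ofReal_pow]
  refine (kernelConv_congr (χ := fun ξ => bracket ξ ^ k) (ψ := fun ξ => bracket ξ ^ k) ?_ ?_
    fun η => ?_).symm
  · simpa using ha k t
  · have := hb.ae_eq 2 k t
    rw [add_comm 2 k] at this
    simpa using this
  · simp only [prodKernel]
    have ha0 := bracket_ne_zero (ξ - η)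
    have hb0 := bracket_ne_zero η
    field_simp
    ring

lemma continuous_prodKernel (hd : d ≤ 3) (k : ℕ) {f g : ℝ → L2 d} (hf : Continuous f)
    (hg : Continuous g) : Continuous (fun t => (prodKernel hd k).op (f t) (g t)) :=
  ((prodKernel hd k).op.continuous.comp hf).clm_apply hg

/-- The factor `⟨η⟩^{-2}` of the kernel cancels the `⟨η⟩²` in `b 2`, leaving the plain convolution
of `a 0` and `b 0`. -/
lemma fourierInv_prodKernel (hd : d ≤ 3) {a b : ℕ → ℝ → L2 d} (ha : IsScale a) (hb : IsScale b)
    (t : ℝ) (x : Space d) :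
    𝓕⁻ ((prodKernel hd 0).op (a 0 t) (b 2 t) : Space d → ℂ) x =
      𝓕⁻ (a 0 t : Space d → ℂ) x * 𝓕⁻ (b 0 t : Space d → ℂ) x := by
  rw [fourierInv_mul_eq (ha.integrable hd 0 t) (hb.integrable hd 0 t)]
  refine Real.fourierInv_congr_ae ?_ x
  filter_upwards [(prodKernel hd 0).coeFn_op (a 0 t) (b 2 t)] with ξ h1
  rw [h1]
  have := kernelConv_congr (K := fun _ _ => 1) (K' := (prodKernel hd 0).toFun) (ξ := ξ) (c := 1)
    (χ := fun _ => 1) (ψ := fun ξ => bracket ξ ^ 2) (f := a 0 t) (f' := a 0 t) (g := b 0 t)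
    (g' := b 2 t) (by simp) (by simpa using hb 2 t) (fun η => by
      have hb0 := bracket_ne_zero η
      simp [prodKernel, hb0])
  simpa using this.symm

lemma fourierInv_add {f g : L2 d} (hf : Integrable (f : Space d → ℂ))
    (hg : Integrable (g : Space d → ℂ)) (x : Space d) :
    𝓕⁻ ((f + g : L2 d) : Space d → ℂ) x =
      𝓕⁻ (f : Space d → ℂ) x + 𝓕⁻ (g : Space d → ℂ) x := by
  have h1 : Integrable (fun ξ => Real.fourierChar (inner ℝ ξ x) • f ξ) := by
    have := (Real.fourierIntegral_convergent_iff (-x)).2 hf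
    simpa [inner_neg_right] using this
  have h2 : Integrable (fun ξ => Real.fourierChar (inner ℝ ξ x) • g ξ) := by
    have := (Real.fourierIntegral_convergent_iff (-x)).2 hg
    simpa [inner_neg_right] using this
  rw [Real.fourierInv_eq, Real.fourierInv_eq, Real.fourierInv_eq, ← integral_add h1 h2]
  refine integral_congr_ae ?_
  filter_upwards [Lp.coeFn_add f g] with ξ h
  rw [h, Pi.add_apply, smul_add]

lemma fourierInv_smul (c : ℂ) (f : L2 d) (x : Space d) :
    𝓕⁻ ((c • f : L2 d) : Space d → ℂ) x = c * 𝓕⁻ (f : Space d → ℂ) x := by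
  rw [Real.fourierInv_eq, Real.fourierInv_eq, ← integral_const_mul]
  refine integral_congr_ae ?_
  filter_upwards [Lp.coeFn_smul c f] with ξ h
  rw [h, Pi.smul_apply, smul_eq_mul, Circle.smul_def, Circle.smul_def, smul_eq_mul, smul_eq_mul]
  ring

lemma IsScale.add {a b : ℕ → ℝ → L2 d} (ha : IsScale a) (hb : IsScale b) :
    IsScale (fun k t => a k t + b k t) := by
  intro k t
  filter_upwards [Lp.coeFn_add (a k t) (b k t), Lp.coeFn_add (a 0 t) (b 0 t), ha k t, hb k t]
    with ξ h1 h2 h3 h4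
  rw [h1, h2, Pi.add_apply, Pi.add_apply, h3, h4]
  ring

lemma IsScale.smul {a : ℕ → ℝ → L2 d} (ha : IsScale a) (c : ℂ) :
    IsScale (fun k t => c • a k t) := by
  intro k t
  filter_upwards [Lp.coeFn_smul c (a k t), Lp.coeFn_smul c (a 0 t), ha k t] with ξ h1 h2 h3
  rw [h1, h2, Pi.smul_apply, Pi.smul_apply, h3, smul_eq_mul, smul_eq_mul]
  ring

lemma IsScale.neg {a : ℕ → ℝ → L2 d} (ha : IsScale a) : IsScale (fun k t => -a k t) := by
  simpa using ha.smul (-1)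

lemma IsScale.sub {a b : ℕ → ℝ → L2 d} (ha : IsScale a) (hb : IsScale b) :
    IsScale (fun k t => a k t - b k t) := by
  simpa [sub_eq_add_neg] using ha.add hb.neg

lemma IsScale.shift {a : ℕ → ℝ → L2 d} (ha : IsScale a) (j : ℕ) :
    IsScale (fun k t => a (k + j) t) := by
  intro k t
  simpa [add_comm] using ha.ae_eq j k t

/-- The scales `a`, `b`, `c` of the Fourier transforms of `u`, `n`, `∂ₜn` solve the
Klein–Gordon–Schrödinger system on the frequency side. -/
structure FrequencySolution (hd : d ≤ 3) (a b c : ℕ → ℝ → L2 d) : Prop where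
  scale_a : IsScale a
  scale_b : IsScale b
  scale_c : IsScale c
  deriv_a : ∀ k t, HasDerivAt (a k) (-Complex.I • (a (k + 2) t - a k t) +
    Complex.I • (prodKernel hd k).op (a k t) (b (k + 2) t)) t
  deriv_b : ∀ k t, HasDerivAt (b k) (c k t) t
  deriv_c : ∀ k t, HasDerivAt (c k) (-b (k + 2) t +
    (prodKernel hd k).op (a k t) (conjReflect (a (k + 2) t))) t
  hermitian_b : ∀ k t, ∀ᵐ ξ, b k t (-ξ) = conj (b k t ξ)

/-- A real function equals its conjugate, so `b 0` and `conjReflect (b 0)` have the same inverse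
transform. The symmetry makes multiplication by `n` a symmetric operator in the mass and energy
identities. -/
lemma IsProfile.hermitian {f : ℝ → Space d → ℝ} {b : ℕ → ℝ → L2 d}
    (h : IsProfile (fun t x => (f t x : ℂ)) b) (hd : d ≤ 3) (hc : ∀ t, Continuous (f t)) (k : ℕ)
    (t : ℝ) : ∀ᵐ ξ, b k t (-ξ) = conj (b k t ξ) := by
  have hcc : Continuous (fun x => (f t x : ℂ)) := Complex.continuous_ofReal.comp (hc t)
  have e := h.eq_fourierInv hd hcc
  have hi := h.scale.integrable hd 0 t
  have hi' := h.scale.conjReflect.integrable hd 0 t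
  have hae := Lp.coeFn_sub (b 0 t) (conjReflect (b 0 t))
  have h0 : b 0 t - conjReflect (b 0 t) = 0 := by
    refine eq_zero_of_fourierInv_eq_zero _ ((hi.sub hi').congr hae.symm) fun x => ?_
    have e1 : 𝓕⁻ (conjReflect (b 0 t) : Space d → ℂ) x = 𝓕⁻ (b 0 t : Space d → ℂ) x := by
      rw [Real.fourierInv_congr_ae (coeFn_conjReflect (b 0 t)) x, ← conj_fourierInv, ← e]
      simp
    have hn : Integrable ((-conjReflect (b 0 t) : L2 d) : Space d → ℂ) :=
      h.scale.conjReflect.neg.integrable hd 0 t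
    have e2 := fourierInv_smul (-1) (conjReflect (b 0 t)) x
    rw [neg_smul, one_smul] at e2
    rw [sub_eq_add_neg, fourierInv_add hi hn, e2, e1]
    ring
  rw [sub_eq_zero] at h0
  have h1 := coeFn_conjReflect (b 0 t)
  rw [← h0] at h1
  filter_upwards [h1, h.scale k t, ae_comp_neg (h.scale k t)] with ξ h2 h3 h4
  rw [h4, h3, h2, bracket_neg]
  simp

theorem IsGlobalSmoothSolution.exists_frequencySolution (hd : d ≤ 3) {u₀ : Space d → ℂ}
    {n₀ n₁ : Space d → ℝ} {u : ℝ → Space d → ℂ} {n : ℝ → Space d → ℝ}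
    (h : IsGlobalSmoothSolution u₀ n₀ n₁ u n) :
    ∃ a b c : ℕ → ℝ → L2 d, FrequencySolution hd a b c ∧ IsProfile u a ∧
      IsProfile (fun t x => (n t x : ℂ)) b ∧
      IsProfile (fun t x => ((deriv (fun τ => n τ x) t : ℝ) : ℂ)) c := by
  obtain ⟨a, ha⟩ := exists_isProfile h.sobolev_u
  obtain ⟨b, hb⟩ := exists_isProfile h.sobolev_n
  obtain ⟨c, hc⟩ := exists_isProfile h.sobolev_dn
  have hu_x : ∀ t, Continuous (u t) := fun t => 
    h.smooth_u.continuous.comp (Continuous.prodMk continuous_const continuous_id)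
  have hn_x : ∀ t, ContDiff ℝ ∞ (n t) := fun t =>
    h.smooth_n.comp (contDiff_const.prodMk contDiff_id)
  have hnC : ∀ t, Continuous (fun x => (n t x : ℂ)) := fun t =>
    Complex.continuous_ofReal.comp (hn_x t).continuous
  have hu_t : ∀ x, ContDiff ℝ ∞ (fun t => u t x) := fun x =>
    h.smooth_u.comp (contDiff_id.prodMk contDiff_const)
  have hn_t : ∀ x, ContDiff ℝ ∞ (fun t => n t x) := fun x =>
    h.smooth_n.comp (contDiff_id.prodMk contDiff_const)
  have hdn_x : ∀ t, Continuous (fun x => deriv (fun τ => n τ x) t) := by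
    intro t
    have e : ∀ x, deriv (fun τ => n τ x) t =
        fderiv ℝ (fun p : ℝ × Space d => n p.1 p.2) (t, x) (1, 0) := by
      intro x
      have h1 := ((h.smooth_n.differentiable (by simp)) (t, x)).hasFDerivAt
      have h2 : HasDerivAt (fun τ : ℝ => (τ, x)) ((1 : ℝ), (0 : Space d)) t :=
        (hasDerivAt_id t).prodMk (hasDerivAt_const t x)
      exact (h1.comp_hasDerivAt t h2).deriv
    simp_rw [e]
    have h3 := h.smooth_n.continuous_fderiv (by simp)
    exact (h3.comp (by fun_prop)).clm_apply continuous_const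
  have hdnC : ∀ t, Continuous (fun x => ((deriv (fun τ => n τ x) t : ℝ) : ℂ)) := fun t =>
    Complex.continuous_ofReal.comp (hdn_x t)
  have eu := fun t => ha.eq_fourierInv hd (hu_x t)
  have en := fun t => hb.eq_fourierInv hd (hnC t)
  have edn := fun t => hc.eq_fourierInv hd (hdnC t)
  have hac := ha.scale.conjReflect
  refine ⟨a, b, c, ⟨ha.scale, hb.scale, hc.scale, ?_, ?_, ?_,
    hb.hermitian hd fun t => (hn_x t).continuous⟩, ha, hb, hc⟩
  · refine hasDerivAt_of_fourierInv hd (g := fun k t => -Complex.I • (a (k + 2) t - a k t) +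
      Complex.I • (prodKernel hd k).op (a k t) (b (k + 2) t)) ha.scale ?_ ?_ ?_
    · exact (((ha.scale.shift 2).sub ha.scale).smul _).add
        ((isScale_prodKernel hd ha.scale hb.scale).smul _)
    · intro k
      exact (((ha.continuous (k + 2)).sub (ha.continuous k)).const_smul (-Complex.I)).add
        ((continuous_prodKernel hd k (ha.continuous k) (hb.continuous (k + 2))).const_smul Complex.I)
    · intro t x
      have hP := isScale_prodKernel hd ha.scale hb.scale
      have hD : HasDerivAt (fun τ => u τ x) (deriv (fun τ => u τ x) t) t :=
        ((hu_t x).differentiable (by simp) t).hasDerivAt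
      -- Continuity in `x` makes the inversion formula hold at every point, so the classical time
      -- derivative at fixed `x` can be used.
      have e0 : ∀ τ, 𝓕⁻ (a 0 τ : Space d → ℂ) x = u τ x := fun τ => by rw [← eu]
      simp_rw [e0]
      convert hD using 1
      have i0 := ha.scale.integrable hd 0 t
      have i2 := ha.scale.integrable hd 2 t
      have iP := hP.integrable hd 0 t
      have e1 : 𝓕⁻ ((-Complex.I • (a (0 + 2) t - a 0 t) +
          Complex.I • (prodKernel hd 0).op (a 0 t) (b (0 + 2) t) : L2 d) : Space d → ℂ) x =
          -Complex.I * (𝓕⁻ (a 2 t : Space d → ℂ) x - 𝓕⁻ (a 0 t : Space d → ℂ) x) +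
            Complex.I * (u t x * n t x) := by
        have e5 := fourierInv_prodKernel hd ha.scale hb.scale t x
        rw [e0, show 𝓕⁻ (b 0 t : Space d → ℂ) x = n t x by rw [← en]] at e5
        have i20 := (((ha.scale.shift 2).sub ha.scale).smul (-Complex.I)).integrable hd 0 t
        have iP' := ((isScale_prodKernel hd ha.scale hb.scale).smul Complex.I).integrable hd 0 t
        have e6 := fourierInv_smul (-1) (a 0 t) x
        rw [neg_smul, one_smul] at e6
        rw [fourierInv_add i20 iP', fourierInv_smul, fourierInv_smul, e5, sub_eq_add_neg,
          fourierInv_add i2 (ha.scale.neg.integrable hd 0 t), e6]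
        ring
      rw [e1]
      have hL := ha.laplacian hd (hu_x t) x
      have hS := h.schrodinger t x
      rw [hL] at hS
      linear_combination Complex.I * hS - (deriv (fun τ => u τ x) t) * Complex.I_sq
  · refine hasDerivAt_of_fourierInv hd hb.scale hc.scale hc.continuous fun t x => ?_
    have e0 : ∀ τ, 𝓕⁻ (b 0 τ : Space d → ℂ) x = n τ x := fun τ => by rw [← en]
    simp_rw [e0]
    have e1 : 𝓕⁻ (c 0 t : Space d → ℂ) x = ((deriv (fun τ => n τ x) t : ℝ) : ℂ) := by
      rw [← edn]
    rw [e1]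
    have h1 : HasDerivAt (fun τ => n τ x) (deriv (fun τ => n τ x) t) t :=
      ((hn_t x).differentiable (by simp) t).hasDerivAt
    exact h1.ofReal_comp
  · refine hasDerivAt_of_fourierInv hd (g := fun k t => -b (k + 2) t +
      (prodKernel hd k).op (a k t) (conjReflect (a (k + 2) t))) hc.scale ?_ ?_ ?_
    · have h1 : IsScale (fun k t => -b (k + 2) t) := (hb.scale.shift 2).neg
      have h2 : IsScale (fun k t => (prodKernel hd k).op (a k t) (conjReflect (a (k + 2) t))) :=
        isScale_prodKernel hd (b := fun k t => conjReflect (a k t)) ha.scale hac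
      exact h1.add h2
    · intro k
      exact (hb.continuous (k + 2)).neg.add (continuous_prodKernel hd k (ha.continuous k)
        (continuous_conjReflect.comp (ha.continuous (k + 2))))
    · intro t x
      have hP := isScale_prodKernel hd (b := fun k t => conjReflect (a k t)) ha.scale hac
      have hD : HasDerivAt (fun τ => ((deriv (fun τ => n τ x) τ : ℝ) : ℂ))
          ((iteratedDeriv 2 (fun τ => n τ x) t : ℝ) : ℂ) t := by
        have h1 : Differentiable ℝ (deriv (fun τ => n τ x)) :=
          ((contDiff_infty_iff_deriv.1 (hn_t x)).2).differentiable (by simp)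
        have h2 := (h1 t).hasDerivAt
        rw [iteratedDeriv_succ, iteratedDeriv_one]
        exact h2.ofReal_comp
      have e0 : ∀ τ, 𝓕⁻ (c 0 τ : Space d → ℂ) x = ((deriv (fun τ => n τ x) τ : ℝ) : ℂ) :=
        fun τ => by rw [← edn]
      simp_rw [e0]
      convert hD using 1
      have i2 := hb.scale.integrable hd 2 t
      have iP := hP.integrable hd 0 t
      have e1 : 𝓕⁻ ((-b (0 + 2) t +
          (prodKernel hd 0).op (a 0 t) (conjReflect (a (0 + 2) t)) : L2 d) : Space d → ℂ) x =
          -𝓕⁻ (b 2 t : Space d → ℂ) x + u t x * conj (u t x) := by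
        have e5 := fourierInv_prodKernel hd (b := fun k t => conjReflect (a k t)) ha.scale hac t x
        rw [Real.fourierInv_congr_ae (coeFn_conjReflect (a 0 t)) x, ← conj_fourierInv, ← eu] at e5
        have e6 := fourierInv_smul (-1) (b 2 t) x
        rw [neg_smul, one_smul] at e6
        rw [fourierInv_add ((hb.scale.shift 2).neg.integrable hd 0 t) iP, e5, e6]
        ring
      rw [e1]
      have hL := hb.laplacian hd (hnC t) x
      rw [← en] at hL
      have hL2 : Δ (fun x => (n t x : ℂ)) x = ((Δ (n t) x : ℝ) : ℂ) :=
        ContDiffAt.laplacian_CLM_comp_left (l := Complex.ofRealCLM) (f := n t) (x := x)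
          ((hn_x t).contDiffAt.of_le (WithTop.coe_le_coe.2 le_top))
      rw [hL2] at hL
      have hK := congrArg (fun r : ℝ => (r : ℂ)) (h.kleinGordon t x)
      push_cast at hK
      rw [Complex.mul_conj, Complex.normSq_eq_norm_sq]
      push_cast
      linear_combination -hL - hK

end

end KGS

/-! ### Almost conservation laws for exponentially weighted solutions. -/

namespace KGS

noncomputable section

variable {d : ℕ}

open ComplexConjugate

/-! ### Truncated exponential weights -/

/-- Parameters of the truncated weight `exp (min (σ‖2πξ‖₁) M)`, together with the power `θ` of `σ`
that is gained in the commutator estimates. -/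
structure GevreyParams (d : ℕ) where
  /-- the dimension is at most three -/
  dim_le : d ≤ 3
  /-- the power gained -/
  θ : ℝ
  θ_pos : 0 < θ
  θ_lt : θ < 1
  decay : (d : ℝ) < 2 * (2 - θ)
  /-- the radius of analyticity -/
  σ : ℝ
  σ_nonneg : 0 ≤ σ
  /-- the truncation -/
  M : ℝ
  M_nonneg : 0 ≤ M

/-- The norm `∑ |ξ_i|` of the frequency `2πξ`. -/
def taxicab (ξ : Space d) : ℝ := ∑ i, |((2 * Real.pi) • ξ) i|

lemma taxicab_nonneg (ξ : Space d) : 0 ≤ taxicab ξ := Finset.sum_nonneg fun _ _ => abs_nonneg _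

lemma taxicab_neg (ξ : Space d) : taxicab (-ξ) = taxicab ξ := by simp [taxicab]

lemma taxicab_le_add (ξ η : Space d) : taxicab ξ ≤ taxicab (ξ - η) + taxicab η := by
  unfold taxicab
  rw [← Finset.sum_add_distrib]
  refine Finset.sum_le_sum fun i _ => ?_
  have : ((2 * Real.pi) • ξ) i = ((2 * Real.pi) • (ξ - η)) i + ((2 * Real.pi) • η) i := by
    simp; ring
  rw [this]
  exact abs_add_le _ _

@[fun_prop]
lemma continuous_taxicab : Continuous (taxicab : Space d → ℝ) := by
  unfold taxicab; fun_prop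

lemma taxicab_le_bracket (ξ : Space d) : taxicab ξ ≤ d * bracket ξ := by
  have h : ∀ i, |((2 * Real.pi) • ξ) i| ≤ bracket ξ := fun i =>
    (PiLp.norm_apply_le ((2 * Real.pi) • ξ) i).trans (norm_le_bracket ξ)
  have := Finset.sum_le_sum (s := Finset.univ) fun i _ => h i
  simpa [taxicab] using this

namespace GevreyParams

variable (p : GevreyParams d)

/-- The exponent of the weight. -/
def phase (ξ : Space d) : ℝ := min (p.σ * taxicab ξ) p.M

lemma phase_nonneg (ξ : Space d) : 0 ≤ p.phase ξ :=
  le_min (mul_nonneg p.σ_nonneg (taxicab_nonneg ξ)) p.M_nonneg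

lemma phase_neg (ξ : Space d) : p.phase (-ξ) = p.phase ξ := by simp [phase, taxicab_neg]

/-- Truncating a nonnegative subadditive function at a nonnegative level preserves subadditivity:
once a summand on the right reaches `M`, it alone suffices. -/
lemma phase_le_add (ξ η : Space d) : p.phase ξ ≤ p.phase (ξ - η) + p.phase η := by
  have h0 := p.phase_nonneg (ξ - η)
  have h1 := p.phase_nonneg η
  unfold phase at h0 h1 ⊢
  have h := mul_le_mul_of_nonneg_left (taxicab_le_add ξ η) p.σ_nonneg
  rw [mul_add] at h
  rcases le_total (p.σ * taxicab (ξ - η)) p.M with h2 | h2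
  · rcases le_total (p.σ * taxicab η) p.M with h3 | h3
    · rw [min_eq_left h2, min_eq_left h3]
      exact (min_le_left _ _).trans h
    · rw [min_eq_right h3]
      exact (min_le_right _ _).trans (by linarith)
  · rw [min_eq_right h2]
    exact (min_le_right _ _).trans (by linarith)

lemma phase_le_bracket (ξ : Space d) : p.phase ξ ≤ d * p.σ * bracket ξ := by
  refine (min_le_left _ _).trans ?_
  have := mul_le_mul_of_nonneg_left (taxicab_le_bracket ξ) p.σ_nonneg
  linarith

@[fun_prop]
lemma continuous_phase : Continuous p.phase := by unfold phase; fun_prop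

@[fun_prop]
lemma measurable_phase : Measurable p.phase := p.continuous_phase.measurable

/-- The weight `exp (min (σ‖2πξ‖₁) M)` as a multiplier. -/
def weight : Multiplier d where
  toFun ξ := Real.exp (p.phase ξ)
  measurable := by fun_prop
  const := Real.exp p.M
  bound ξ := by
    rw [abs_of_pos (Real.exp_pos _)]
    exact Real.exp_le_exp.2 (min_le_right _ _)

/-- The quotient `w(ξ) / (w(ξ - η) w(η))` of weights. -/
def ratio (ξ η : Space d) : ℝ := Real.exp (p.phase ξ - p.phase (ξ - η) - p.phase η)

lemma ratio_pos (ξ η : Space d) : 0 < p.ratio ξ η := Real.exp_pos _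

lemma ratio_le_one (ξ η : Space d) : p.ratio ξ η ≤ 1 :=
  Real.exp_le_one_iff.2 (by linarith [p.phase_le_add ξ η])

@[fun_prop]
lemma measurable_ratio : Measurable (fun q : Space d × Space d => p.ratio q.1 q.2) := by
  unfold ratio; fun_prop

lemma ratio_mul (ξ η : Space d) :
    p.ratio ξ η * Real.exp (p.phase (ξ - η)) * Real.exp (p.phase η) = Real.exp (p.phase ξ) := by
  rw [ratio, ← Real.exp_add, ← Real.exp_add]
  congr 1; ring

/-- The small factor gained in the commutator estimates. -/
def gain : ℝ := (2 * d * p.σ) ^ p.θ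

lemma gain_nonneg : 0 ≤ p.gain :=
  Real.rpow_nonneg (mul_nonneg (by positivity) p.σ_nonneg) _

lemma one_sub_exp_neg_le_rpow {x θ : ℝ} (hx : 0 ≤ x) (h0 : 0 ≤ θ) (h1 : θ ≤ 1) :
    1 - Real.exp (-x) ≤ x ^ θ := by
  rcases le_total x 1 with h | h
  · have h2 : x ≤ x ^ θ := by
      rcases hx.eq_or_lt with rfl | hx
      · exact Real.rpow_nonneg le_rfl _
      · simpa using Real.rpow_le_rpow_of_exponent_ge hx h h1
    linarith [Real.add_one_le_exp (-x)]
  · have := Real.one_le_rpow h h0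
    linarith [Real.exp_pos (-x)]

/-- With `x` the defect of subadditivity, `1 - e^{-x} ≤ x^θ` trades `θ` derivatives on the frequency
`ζ` for the factor `σ^θ`. The bound is uniform in the truncation. -/
lemma one_sub_ratio_le_of_phase_le {ξ η ζ : Space d}
    (h : p.phase (ξ - η) + p.phase η - p.phase ξ ≤ 2 * p.phase ζ) :
    1 - p.ratio ξ η ≤ p.gain * bracket ζ ^ p.θ := by
  have hx : 0 ≤ p.phase (ξ - η) + p.phase η - p.phase ξ := by linarith [p.phase_le_add ξ η]
  have h1 := one_sub_exp_neg_le_rpow hx p.θ_pos.le p.θ_lt.le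
  have h2 : p.ratio ξ η = Real.exp (-(p.phase (ξ - η) + p.phase η - p.phase ξ)) := by
    rw [ratio]; congr 1; ring
  rw [← h2] at h1
  refine h1.trans ?_
  have h3 := p.phase_le_bracket ζ
  rw [gain, ← Real.mul_rpow (mul_nonneg (by positivity) p.σ_nonneg) (bracket_pos ζ).le]
  exact Real.rpow_le_rpow hx (by linarith) p.θ_pos.le

/-- Subadditivity and evenness give `phase (ξ - η) ≤ phase ξ + phase η`, so the defect is at most `2
* phase η`. By symmetry the loss may be placed on either factor, which the estimates below exploit.
-/
lemma one_sub_ratio_le_right (ξ η : Space d) :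
    1 - p.ratio ξ η ≤ p.gain * bracket η ^ p.θ := by
  refine p.one_sub_ratio_le_of_phase_le ?_
  have := p.phase_le_add (ξ - η) (-η)
  rw [sub_neg_eq_add, sub_add_cancel, phase_neg] at this
  linarith

lemma one_sub_ratio_le_left (ξ η : Space d) :
    1 - p.ratio ξ η ≤ p.gain * bracket (ξ - η) ^ p.θ := by
  refine p.one_sub_ratio_le_of_phase_le ?_
  have := p.phase_le_add η (-(ξ - η))
  rw [sub_neg_eq_add, add_sub_cancel, phase_neg] at this
  linarith

/-- The decay exponent of the kernels. -/
abbrev s : ℝ := 2 - p.θ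

/-- The smaller of `a` and `b` takes over the whole negative exponent. Decay shared by the two
factors is thereby as good as decay in one of them. -/
lemma rpow_mul_rpow_le {a b q r s : ℝ} (ha : 1 ≤ a) (hb : 1 ≤ b) (hq : 0 ≤ q) (hr : 0 ≤ r)
    (hs : s ≤ q + r) : a ^ (-q) * b ^ (-r) ≤ a ^ (-s) + b ^ (-s) := by
  have ha0 : 0 < a := by linarith
  have hb0 : 0 < b := by linarith
  rcases le_total a b with h | h
  · have h1 : b ^ (-r) ≤ a ^ (-r) := Real.rpow_le_rpow_of_nonpos ha0 h (by linarith)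
    calc a ^ (-q) * b ^ (-r) ≤ a ^ (-q) * a ^ (-r) := by gcongr
      _ = a ^ (-q + -r) := (Real.rpow_add ha0 _ _).symm
      _ ≤ a ^ (-s) := Real.rpow_le_rpow_of_exponent_le ha (by linarith)
      _ ≤ _ := le_add_of_nonneg_right (by positivity)
  · have h1 : a ^ (-q) ≤ b ^ (-q) := Real.rpow_le_rpow_of_nonpos hb0 h (by linarith)
    calc a ^ (-q) * b ^ (-r) ≤ b ^ (-q) * b ^ (-r) := by gcongr
      _ = b ^ (-q + -r) := (Real.rpow_add hb0 _ _).symm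
      _ ≤ b ^ (-s) := Real.rpow_le_rpow_of_exponent_le hb (by linarith)
      _ ≤ _ := le_add_of_nonneg_left (by positivity)

lemma inv_sq_eq_rpow {b : ℝ} (hb : 0 < b) : (b ^ 2)⁻¹ = b ^ (-(2 : ℝ)) := by
  rw [Real.rpow_neg hb.le]; norm_num

lemma inv_sq_le_decayKernel (ξ η : Space d) : (bracket η ^ 2)⁻¹ ≤ decayKernel p.s ξ η := by
  rw [inv_sq_eq_rpow (bracket_pos η)]
  refine le_trans ?_ (le_add_of_nonneg_left (Real.rpow_nonneg (bracket_pos _).le _))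
  exact Real.rpow_le_rpow_of_exponent_le (one_le_bracket η) (by
    have := p.θ_pos
    simp only [s]; linarith)

/-- The kernel of `(f, g) ↦ f * (⟨η⟩^{-2} g)`. -/
def plainKernel : SmoothingKernel d p.s where
  toFun _ η := (bracket η ^ 2)⁻¹
  measurable := by fun_prop
  const := 1
  const_nonneg := zero_le_one
  bound ξ η := by
    have := bracket_pos η
    rw [abs_of_pos (by positivity), one_mul]
    exact p.inv_sq_le_decayKernel ξ η
  decay := p.decay

/-- The kernel of the conjugation of `f * (⟨η⟩^{-2} g)` by the weight. -/
def weightedKernel : SmoothingKernel d p.s where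
  toFun ξ η := p.ratio ξ η * (bracket η ^ 2)⁻¹
  measurable := by fun_prop
  const := 1
  const_nonneg := zero_le_one
  bound ξ η := by
    have h0 := bracket_pos η
    have h1 := p.ratio_pos ξ η
    rw [abs_of_pos (by positivity), one_mul]
    exact (mul_le_of_le_one_left (by positivity) (p.ratio_le_one ξ η)).trans
      (p.inv_sq_le_decayKernel ξ η)
  decay := p.decay

/-- The difference of `plainKernel` and `weightedKernel`. -/
def errorKernel : SmoothingKernel d p.s where
  toFun ξ η := (1 - p.ratio ξ η) * (bracket η ^ 2)⁻¹
  measurable := by fun_prop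
  const := p.gain
  const_nonneg := p.gain_nonneg
  bound ξ η := by
    have h0 := bracket_pos η
    have h1 : 0 ≤ 1 - p.ratio ξ η := by linarith [p.ratio_le_one ξ η]
    rw [abs_of_nonneg (by positivity)]
    calc (1 - p.ratio ξ η) * (bracket η ^ 2)⁻¹
        ≤ p.gain * bracket η ^ p.θ * (bracket η ^ 2)⁻¹ := by
          gcongr; exact p.one_sub_ratio_le_right ξ η
      -- The lost `⟨η⟩^θ` lowers the decay from `2` to `s = 2 - θ`; this is why all kernels are
      -- measured with that exponent.
      _ = p.gain * bracket η ^ (-p.s) := by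
          rw [inv_sq_eq_rpow h0, mul_assoc, ← Real.rpow_add h0]
          congr 2; simp only [s]; ring
      _ ≤ p.gain * decayKernel p.s ξ η := by
          refine mul_le_mul_of_nonneg_left ?_ p.gain_nonneg
          exact le_add_of_nonneg_left (Real.rpow_nonneg (bracket_pos _).le _)
  decay := p.decay

lemma plainKernel_op_eq (f g : L2 d) :
    p.plainKernel.op f g = p.weightedKernel.op f g + p.errorKernel.op f g := by
  apply Lp.ext
  filter_upwards [p.plainKernel.coeFn_op f g, p.weightedKernel.coeFn_op f g,
    p.errorKernel.coeFn_op f g, Lp.coeFn_add (p.weightedKernel.op f g) (p.errorKernel.op f g),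
    p.weightedKernel.ae_integrable f g, p.errorKernel.ae_integrable f g] with ξ h1 h2 h3 h4 h5 h6
  rw [h1, h4, Pi.add_apply, h2, h3, kernelConv, kernelConv, kernelConv, ← integral_add h5 h6]
  congr 1
  ext η
  simp only [plainKernel, weightedKernel, errorKernel]
  push_cast
  ring

end GevreyParams

/-! ### The weighted system -/

/-- The weighted scales `A`, `B`, `D` of `û`, `n̂`, `(∂ₜn)^` with the time derivatives `V` of `A`
and `W` of `D`. -/
structure WeightedSolution (p : GevreyParams d) (A B D V W : ℕ → ℝ → L2 d) : Prop where
  scale_A : IsScale A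
  scale_B : IsScale B
  scale_D : IsScale D
  scale_V : IsScale V
  scale_W : IsScale W
  deriv_A : ∀ k t, HasDerivAt (A k) (V k t) t
  deriv_B : ∀ k t, HasDerivAt (B k) (D k t) t
  deriv_D : ∀ k t, HasDerivAt (D k) (W k t) t
  V_eq : ∀ t, V 0 t = -Complex.I • (A 2 t - A 0 t) +
    Complex.I • p.weightedKernel.op (A 0 t) (B 2 t)
  W_eq : ∀ t, W 0 t = -B 2 t + p.weightedKernel.op (A 0 t) (conjReflect (A 2 t))
  hermitian_B : ∀ k t, ∀ᵐ ξ, B k t (-ξ) = conj (B k t ξ)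

lemma IsScale.mul {a : ℕ → ℝ → L2 d} (ha : IsScale a) (χ : Multiplier d) :
    IsScale (fun k t => χ.op (a k t)) := by
  intro k t
  filter_upwards [χ.coeFn_op (a k t), χ.coeFn_op (a 0 t), ha k t] with ξ h1 h2 h3
  rw [h1, h2, h3]; ring

lemma weight_hermitian (p : GevreyParams d) {f : L2 d} (hf : ∀ᵐ ξ, f (-ξ) = conj (f ξ)) :
    ∀ᵐ ξ, p.weight.op f (-ξ) = conj (p.weight.op f ξ) := by
  filter_upwards [p.weight.coeFn_op f, ae_comp_neg (p.weight.coeFn_op f), hf] with ξ h1 h2 h3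
  rw [h1, h2, h3]
  simp only [GevreyParams.weight, p.phase_neg, map_mul, Complex.conj_ofReal]

/-- Distributing the weight over a convolution leaves exactly `ratio` in the kernel, so the weighted
functions solve a closed system. -/
lemma weight_op_prodKernel (p : GevreyParams d) (f g : L2 d) :
    p.weight.op ((prodKernel p.dim_le 0).op f g) =
      p.weightedKernel.op (p.weight.op f) (p.weight.op g) := by
  apply Lp.ext
  filter_upwards [p.weight.coeFn_op ((prodKernel p.dim_le 0).op f g),
    (prodKernel p.dim_le 0).coeFn_op f g,
    p.weightedKernel.coeFn_op (p.weight.op f) (p.weight.op g)] with ξ h1 h2 h3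
  rw [h1, h2, h3]
  refine kernelConv_congr (p.weight.coeFn_op f) (p.weight.coeFn_op g) fun η => ?_
  simp only [GevreyParams.weight, prodKernel, GevreyParams.weightedKernel]
  rw [← p.ratio_mul ξ η]
  simp; ring

lemma conjReflect_weight_op (p : GevreyParams d) (f : L2 d) :
    conjReflect (p.weight.op f) = p.weight.op (conjReflect f) := by
  apply Lp.ext
  filter_upwards [coeFn_conjReflect (p.weight.op f), p.weight.coeFn_op (conjReflect f),
    coeFn_conjReflect f, ae_comp_neg (p.weight.coeFn_op f)] with ξ h1 h2 h3 h4
  rw [h1, h2, h3, h4]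
  simp only [GevreyParams.weight, p.phase_neg, map_mul, Complex.conj_ofReal]

theorem FrequencySolution.weighted (p : GevreyParams d) {a b c : ℕ → ℝ → L2 d}
    (h : FrequencySolution p.dim_le a b c) :
    ∃ V W, WeightedSolution p (fun k t => p.weight.op (a k t)) (fun k t => p.weight.op (b k t))
      (fun k t => p.weight.op (c k t)) V W := by
  have hd : ∀ {f : ℝ → L2 d} {f' : L2 d} {t : ℝ}, HasDerivAt f f' t →
      HasDerivAt (fun τ => p.weight.op (f τ)) (p.weight.op f') t := fun hf =>
    (p.weight.op.restrictScalars ℝ).hasFDerivAt.comp_hasDerivAt _ hf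
  refine ⟨fun k t => p.weight.op (-Complex.I • (a (k + 2) t - a k t) +
    Complex.I • (prodKernel p.dim_le k).op (a k t) (b (k + 2) t)),
    fun k t => p.weight.op (-b (k + 2) t +
    (prodKernel p.dim_le k).op (a k t) (conjReflect (a (k + 2) t))),
    h.scale_a.mul _, h.scale_b.mul _, h.scale_c.mul _, ?_, ?_, fun k t => hd (h.deriv_a k t),
    fun k t => hd (h.deriv_b k t), fun k t => hd (h.deriv_c k t), fun t => ?_, fun t => ?_,
    fun k t => weight_hermitian p (h.hermitian_b k t)⟩
  · have h1 : IsScale (fun k t => -Complex.I • (a (k + 2) t - a k t)) :=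
      ((h.scale_a.shift 2).sub h.scale_a).smul _
    have h2 : IsScale (fun k t => Complex.I • (prodKernel p.dim_le k).op (a k t) (b (k + 2) t)) :=
      (isScale_prodKernel p.dim_le h.scale_a h.scale_b).smul _
    exact (h1.add h2).mul p.weight
  · have h1 : IsScale (fun k t => -b (k + 2) t) := (h.scale_b.shift 2).neg
    have h2 : IsScale (fun k t => (prodKernel p.dim_le k).op (a k t) (conjReflect (a (k + 2) t))) :=
      isScale_prodKernel p.dim_le (b := fun k t => conjReflect (a k t)) h.scale_a
        h.scale_a.conjReflect
    exact (h1.add h2).mul p.weight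
  · have e := weight_op_prodKernel p (a 0 t) (b 2 t)
    simp only [map_add, map_smul, map_sub]
    rw [← e]
  · have e := weight_op_prodKernel p (a 0 t) (conjReflect (a 2 t))
    rw [← conjReflect_weight_op] at e
    simp only [map_add, map_neg]
    rw [← e]

end

end KGS

namespace KGS

noncomputable section

variable {d : ℕ}

open ComplexConjugate

/-! ### Bilinear estimates -/

namespace GevreyParams

variable (p : GevreyParams d)

/-- The constant of the bilinear estimates. -/
def opConst : ℝ := 2 * Real.sqrt (decayConst d p.s).toReal

lemma opConst_nonneg : 0 ≤ p.opConst := by unfold opConst; positivity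

/-- Multiplication by `⟨ξ⟩^{-θ}`. -/
def fractional : Multiplier d where
  toFun ξ := bracket ξ ^ (-p.θ)
  measurable := by fun_prop
  const := 1
  bound ξ := by
    rw [abs_of_pos (Real.rpow_pos_of_pos (bracket_pos ξ) _)]
    exact rpow_neg_bracket_le_one ξ p.θ_pos.le

lemma rpow_mul_rpow_le_decayKernel {q r : ℝ} (hq : 0 ≤ q) (hr : 0 ≤ r) (h : p.s ≤ q + r)
    (ξ η : Space d) : bracket (ξ - η) ^ (-q) * bracket η ^ (-r) ≤ decayKernel p.s ξ η :=
  rpow_mul_rpow_le (one_le_bracket _) (one_le_bracket _) hq hr h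

variable {f g : ℕ → ℝ → L2 d}

lemma ae_eq_inv_one (hg : IsScale g) (t : ℝ) :
    (g 1 t : Space d → ℂ) =ᵐ[volume] fun ξ => (((bracket ξ)⁻¹ : ℝ) : ℂ) * g 2 t ξ := by
  filter_upwards [hg.ae_eq 1 1 t] with ξ h
  have := bracket_ne_zero' ξ
  rw [h]; push_cast; field_simp

lemma ae_eq_inv_zero (hg : IsScale g) (t : ℝ) :
    (g 0 t : Space d → ℂ) =ᵐ[volume] fun ξ => (((bracket ξ ^ 2)⁻¹ : ℝ) : ℂ) * g 2 t ξ := by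
  filter_upwards [hg 2 t] with ξ h
  have := bracket_ne_zero' ξ
  rw [h]; push_cast; field_simp

lemma ae_eq_fractional (hf : IsScale f) (k : ℕ) (t : ℝ) :
    (p.fractional.op (f k t) : Space d → ℂ) =ᵐ[volume]
      fun ξ => ((bracket ξ ^ (k - p.θ) : ℝ) : ℂ) * f 0 t ξ := by
  filter_upwards [hf k t, p.fractional.coeFn_op (f k t)] with ξ h1 h2
  rw [h2, h1, ← Complex.ofReal_pow, ← mul_assoc, ← Complex.ofReal_mul, fractional,
    sub_eq_neg_add, Real.rpow_add (bracket_pos ξ), Real.rpow_natCast]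

/-- The product `H¹ × H¹ → L²`: one power of decay remains on each frequency. -/
lemma norm_weighted_le (hf : IsScale f) (hg : IsScale g) (t : ℝ) :
    ‖p.weightedKernel.op (f 0 t) (g 2 t)‖ ≤ p.opConst * ‖f 1 t‖ * ‖g 1 t‖ := by
  have h := p.weightedKernel.norm_le_of_weights (f := f 0 t) (g := g 2 t) (f' := f 1 t)
    (g' := g 1 t) (q := p.weightedKernel.op (f 0 t) (g 2 t)) (χ := bracket)
    (ψ := fun ξ => (bracket ξ)⁻¹) (τ := fun _ => 1) (by fun_prop) (by fun_prop) (by fun_prop)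
    bracket_pos (fun ξ => inv_pos.2 (bracket_pos ξ)) (by simpa using hf 1 t)
    (ae_eq_inv_one hg t) (Eventually.of_forall fun ξ => by simp) (C := 1) zero_le_one
    (fun ξ η => ?_)
  · rw [mul_one] at h; exact h
  · have ha := bracket_pos (ξ - η)
    have hb := bracket_pos η
    have hr := p.ratio_pos ξ η
    have h1 := p.rpow_mul_rpow_le_decayKernel zero_le_one zero_le_one
      (by have := p.θ_pos; simp only [s]; linarith) ξ η
    simp only [Real.rpow_neg_one] at h1
    rw [weightedKernel, one_mul, abs_of_pos (by positivity), one_mul]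
    calc p.ratio ξ η * (bracket η ^ 2)⁻¹ ≤ (bracket η ^ 2)⁻¹ :=
          mul_le_of_le_one_left (by positivity) (p.ratio_le_one ξ η)
      _ = (bracket (ξ - η))⁻¹ * (bracket η)⁻¹ * bracket (ξ - η) * (bracket η)⁻¹ := by field_simp
      _ ≤ _ := by gcongr

/-- The loss `⟨ξ - η⟩^θ` is paid from the derivative of the first factor; the remaining decay `(1 -
θ) + 1` is exactly `s`. So first order norms control the commutator. -/
lemma norm_error_le (hf : IsScale f) (hg : IsScale g) (t : ℝ) :
    ‖p.errorKernel.op (f 0 t) (g 2 t)‖ ≤ p.opConst * p.gain * ‖f 1 t‖ * ‖g 1 t‖ := by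
  refine p.errorKernel.norm_le_of_weights (f := f 0 t) (g := g 2 t) (f' := f 1 t)
    (g' := g 1 t) (q := p.errorKernel.op (f 0 t) (g 2 t)) (χ := bracket)
    (ψ := fun ξ => (bracket ξ)⁻¹) (τ := fun _ => 1) (by fun_prop) (by fun_prop) (by fun_prop)
    bracket_pos (fun ξ => inv_pos.2 (bracket_pos ξ)) (by simpa using hf 1 t)
    (ae_eq_inv_one hg t) (Eventually.of_forall fun ξ => by simp) p.gain_nonneg
    (fun ξ η => ?_)
  have ha := bracket_pos (ξ - η)
  have hb := bracket_pos η
  have h0 : 0 ≤ 1 - p.ratio ξ η := by linarith [p.ratio_le_one ξ η]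
  have h1 := p.rpow_mul_rpow_le_decayKernel (q := 1 - p.θ) (by linarith [p.θ_lt]) zero_le_one
    (by simp only [s]; linarith) ξ η
  rw [Real.rpow_neg_one, neg_sub, Real.rpow_sub ha, Real.rpow_one] at h1
  rw [errorKernel, one_mul, abs_of_nonneg (by positivity)]
  calc (1 - p.ratio ξ η) * (bracket η ^ 2)⁻¹
      ≤ p.gain * bracket (ξ - η) ^ p.θ * (bracket η ^ 2)⁻¹ := by
        gcongr; exact p.one_sub_ratio_le_left ξ η
    _ = p.gain * (bracket (ξ - η) ^ p.θ / bracket (ξ - η) * (bracket η)⁻¹) * bracket (ξ - η) *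
          (bracket η)⁻¹ := by field_simp
    _ ≤ _ := by
        have := p.gain_nonneg
        gcongr

/-- The product `H^{2-θ} × L² → L²`, for the term `u ∂ₜn`, where `∂ₜn` is bounded only in `L²`. -/
lemma norm_weighted_le_fractional (hf : IsScale f) (hg : IsScale g) (t : ℝ) :
    ‖p.weightedKernel.op (f 0 t) (g 2 t)‖ ≤
      p.opConst * ‖p.fractional.op (f 2 t)‖ * ‖g 0 t‖ := by
  have h := p.weightedKernel.norm_le_of_weights (f := f 0 t) (g := g 2 t)
    (f' := p.fractional.op (f 2 t))
    (g' := g 0 t) (q := p.weightedKernel.op (f 0 t) (g 2 t)) (χ := fun ξ => bracket ξ ^ p.s)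
    (ψ := fun ξ => (bracket ξ ^ 2)⁻¹) (τ := fun _ => 1) (by fun_prop) (by fun_prop) (by fun_prop)
    (fun ξ => Real.rpow_pos_of_pos (bracket_pos ξ) _)
    (fun ξ => inv_pos.2 (pow_pos (bracket_pos ξ) 2))
    (by simpa using p.ae_eq_fractional hf 2 t)
    (ae_eq_inv_zero hg t) (Eventually.of_forall fun ξ => by simp) (C := 1) zero_le_one
    (fun ξ η => ?_)
  · rw [mul_one] at h; exact h
  · have ha := bracket_pos (ξ - η)
    have hb := bracket_pos η
    have hr := p.ratio_pos ξ η
    have h1 : bracket (ξ - η) ^ (-p.s) ≤ decayKernel p.s ξ η :=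
      le_add_of_nonneg_right (Real.rpow_nonneg hb.le _)
    have h2 : bracket (ξ - η) ^ (-p.s) * bracket (ξ - η) ^ p.s = 1 := by
      rw [← Real.rpow_add ha]; simp
    rw [weightedKernel, one_mul, abs_of_pos (by positivity), one_mul]
    calc p.ratio ξ η * (bracket η ^ 2)⁻¹ ≤ (bracket η ^ 2)⁻¹ :=
          mul_le_of_le_one_left (by positivity) (p.ratio_le_one ξ η)
      _ = bracket (ξ - η) ^ (-p.s) * bracket (ξ - η) ^ p.s * (bracket η ^ 2)⁻¹ := by
          rw [h2, one_mul]
      _ ≤ _ := by gcongr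

/-- The product `H¹ × H^{2-θ} → H¹`, for the wave source `|u|²`. The derivative falls on one factor
or the other, whence the constant two. -/
lemma norm_bracket_weighted_le (hf : IsScale f) (t : ℝ) {G q : L2 d}
    (hq : (q : Space d → ℂ) =ᵐ[volume]
      fun ξ => (bracket ξ : ℂ) * p.weightedKernel.op (f 0 t) (G) ξ) :
    ‖q‖ ≤ p.opConst * 2 * ‖f 1 t‖ * ‖p.fractional.op (G)‖ := by
  refine p.weightedKernel.norm_le_of_weights (f := f 0 t) (g := G) (f' := f 1 t)
    (g' := p.fractional.op (G)) (q := q) (χ := bracket)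
    (ψ := fun ξ => bracket ξ ^ (-p.θ)) (τ := bracket) (by fun_prop) (by fun_prop) (by fun_prop)
    bracket_pos (fun ξ => Real.rpow_pos_of_pos (bracket_pos ξ) _) (by simpa using hf 1 t)
    (p.fractional.coeFn_op (G)) hq zero_le_two (fun ξ η => ?_)
  have ha := bracket_pos (ξ - η)
  have hb := bracket_pos η
  have hx := bracket_pos ξ
  have hr := p.ratio_pos ξ η
  have h1 := p.rpow_mul_rpow_le_decayKernel (r := 1 - p.θ) zero_le_one (by linarith [p.θ_lt])
    (by simp only [s]; linarith) ξ η
  have h2 : bracket η ^ (-p.s) ≤ decayKernel p.s ξ η :=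
    le_add_of_nonneg_left (Real.rpow_nonneg ha.le _)
  have hbt : 0 < bracket η ^ (-p.θ) := Real.rpow_pos_of_pos hb _
  have e1 : bracket η ^ (-p.s) * bracket η ^ (-p.θ) = (bracket η ^ 2)⁻¹ := by
    rw [← Real.rpow_add hb, inv_sq_eq_rpow hb]; congr 1; simp only [s]; ring
  have e2 : bracket η ^ (-(1 - p.θ)) * bracket η ^ (-p.θ) = (bracket η)⁻¹ := by
    rw [← Real.rpow_add hb, ← Real.rpow_neg_one]; congr 1; ring
  rw [weightedKernel, abs_of_pos (by positivity)]
  rw [Real.rpow_neg_one] at h1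
  calc bracket ξ * (p.ratio ξ η * (bracket η ^ 2)⁻¹)
      ≤ (bracket (ξ - η) + bracket η) * (1 * (bracket η ^ 2)⁻¹) := by
        gcongr
        · exact bracket_le_add ξ η
        · exact p.ratio_le_one ξ η
    _ = bracket (ξ - η) * (bracket η ^ 2)⁻¹ + (bracket η)⁻¹ := by field_simp
    _ = bracket η ^ (-p.s) * (bracket (ξ - η) * bracket η ^ (-p.θ)) +
        (bracket (ξ - η))⁻¹ * bracket η ^ (-(1 - p.θ)) *
          (bracket (ξ - η) * bracket η ^ (-p.θ)) := by
        rw [← e1, ← e2]; field_simp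
    _ ≤ decayKernel p.s ξ η * (bracket (ξ - η) * bracket η ^ (-p.θ)) +
        decayKernel p.s ξ η * (bracket (ξ - η) * bracket η ^ (-p.θ)) := by gcongr
    _ = _ := by ring

/-- The product `H^{1-θ} × H¹ → L²`. The spare `θ` derivatives on `f` make the interaction energy
subordinate to the quadratic part. -/
lemma norm_plain_le (hf : IsScale f) (hg : IsScale g) (t : ℝ) :
    ‖p.plainKernel.op (f 0 t) (g 2 t)‖ ≤
      p.opConst * ‖p.fractional.op (f 1 t)‖ * ‖g 1 t‖ := by
  have h := p.plainKernel.norm_le_of_weights (f := f 0 t) (g := g 2 t)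
    (f' := p.fractional.op (f 1 t))
    (g' := g 1 t) (q := p.plainKernel.op (f 0 t) (g 2 t)) (χ := fun ξ => bracket ξ ^ (1 - p.θ))
    (ψ := fun ξ => (bracket ξ)⁻¹) (τ := fun _ => 1) (by fun_prop) (by fun_prop) (by fun_prop)
    (fun ξ => Real.rpow_pos_of_pos (bracket_pos ξ) _)
    (fun ξ => inv_pos.2 (bracket_pos ξ))
    (by simpa using p.ae_eq_fractional hf 1 t)
    (ae_eq_inv_one hg t) (Eventually.of_forall fun ξ => by simp) (C := 1) zero_le_one
    (fun ξ η => ?_)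
  · rw [mul_one] at h; exact h
  · have ha := bracket_pos (ξ - η)
    have hb := bracket_pos η
    have h1 := p.rpow_mul_rpow_le_decayKernel (q := 1 - p.θ) (by linarith [p.θ_lt]) zero_le_one
      (by simp only [s]; linarith) ξ η
    have h2 : bracket (ξ - η) ^ (-(1 - p.θ)) * bracket (ξ - η) ^ (1 - p.θ) = 1 := by
      rw [← Real.rpow_add ha]; simp
    rw [Real.rpow_neg_one] at h1
    rw [plainKernel, one_mul, abs_of_pos (by positivity), one_mul]
    calc (bracket η ^ 2)⁻¹ = bracket (ξ - η) ^ (-(1 - p.θ)) * (bracket η)⁻¹ *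
          bracket (ξ - η) ^ (1 - p.θ) * (bracket η)⁻¹ := by
          rw [mul_right_comm _ (bracket η)⁻¹, h2]; field_simp
      _ ≤ _ := by gcongr

/-- Interpolation with a free parameter, by splitting the frequencies at `⟨ξ⟩ = L`. -/
lemma norm_fractional_le (hf : IsScale f) (k : ℕ) (t : ℝ) {L : ℝ} (hL : 0 < L) :
    ‖p.fractional.op (f (k + 1) t)‖ ≤
      L ^ (1 - p.θ) * ‖f k t‖ + L ^ (-p.θ) * ‖f (k + 1) t‖ := by
  have hL1 : 0 < L ^ (1 - p.θ) := Real.rpow_pos_of_pos hL _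
  have hL2 : 0 < L ^ (-p.θ) := Real.rpow_pos_of_pos hL _
  have h : ‖p.fractional.op (f (k + 1) t)‖ ≤
      ‖((L ^ (1 - p.θ) : ℝ) : ℂ) • f k t + ((L ^ (-p.θ) : ℝ) : ℂ) • f (k + 1) t‖ := by
    refine Lp.norm_le_norm_of_ae_le ?_
    filter_upwards [p.fractional.coeFn_op (f (k + 1) t), hf.ae_eq k 1 t,
      Lp.coeFn_add (((L ^ (1 - p.θ) : ℝ) : ℂ) • f k t) (((L ^ (-p.θ) : ℝ) : ℂ) • f (k + 1) t),
      Lp.coeFn_smul ((L ^ (1 - p.θ) : ℝ) : ℂ) (f k t),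
      Lp.coeFn_smul ((L ^ (-p.θ) : ℝ) : ℂ) (f (k + 1) t)] with ξ h1 h2 h3 h4 h5
    have hJ := bracket_pos ξ
    rw [h1, h3, Pi.add_apply, h4, h5, Pi.smul_apply, Pi.smul_apply, h2, fractional, pow_one]
    simp only [smul_eq_mul]
    have e1 : ((L ^ (1 - p.θ) : ℝ) : ℂ) * f k t ξ +
        ((L ^ (-p.θ) : ℝ) : ℂ) * ((bracket ξ : ℂ) * f k t ξ) =
        ((L ^ (1 - p.θ) + L ^ (-p.θ) * bracket ξ : ℝ) : ℂ) * f k t ξ := by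
      push_cast; ring
    rw [e1, ← mul_assoc, ← Complex.ofReal_mul, norm_mul, norm_mul, Complex.norm_real,
      Complex.norm_real, Real.norm_of_nonneg (by positivity), Real.norm_of_nonneg (by positivity)]
    gcongr
    rcases le_total (bracket ξ) L with hc | hc
    · have e2 : bracket ξ ^ (-p.θ) * bracket ξ = bracket ξ ^ (1 - p.θ) := by
        rw [sub_eq_neg_add, Real.rpow_add hJ, Real.rpow_one]
      rw [e2]
      refine le_trans ?_ (le_add_of_nonneg_right (by positivity))
      exact Real.rpow_le_rpow hJ.le hc (by linarith [p.θ_lt])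
    · refine le_trans ?_ (le_add_of_nonneg_left hL1.le)
      refine mul_le_mul_of_nonneg_right ?_ hJ.le
      exact Real.rpow_le_rpow_of_nonpos hL hc (by linarith [p.θ_pos])
  refine h.trans ((norm_add_le _ _).trans (le_of_eq ?_))
  rw [norm_smul, norm_smul, Complex.norm_real, Complex.norm_real, Real.norm_of_nonneg hL1.le,
    Real.norm_of_nonneg hL2.le]

lemma norm_fractional_conjReflect (f : L2 d) :
    ‖p.fractional.op (conjReflect f)‖ = ‖p.fractional.op f‖ := by
  rw [← norm_conjReflect (p.fractional.op f)]
  congr 1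
  apply Lp.ext
  filter_upwards [coeFn_conjReflect (p.fractional.op f), p.fractional.coeFn_op (conjReflect f),
    coeFn_conjReflect f, ae_comp_neg (p.fractional.coeFn_op f)] with ξ h1 h2 h3 h4
  rw [h1, h2, h3, h4]
  simp only [fractional, bracket_neg, map_mul, Complex.conj_ofReal]

end GevreyParams

lemma IsScale.norm_le_succ {f : ℕ → ℝ → L2 d} (hf : IsScale f) (k : ℕ) (t : ℝ) :
    ‖f k t‖ ≤ ‖f (k + 1) t‖ := by
  refine Lp.norm_le_norm_of_ae_le ?_
  filter_upwards [hf.ae_eq k 1 t] with ξ h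
  rw [h, pow_one, norm_mul, Complex.norm_real, Real.norm_of_nonneg (bracket_pos ξ).le]
  exact le_mul_of_one_le_left (norm_nonneg _) (one_le_bracket ξ)

lemma IsScale.inner_shift {f g : ℕ → ℝ → L2 d} (hf : IsScale f) (hg : IsScale g) (i j k : ℕ)
    (t : ℝ) : inner ℂ (f i t) (g (j + k) t) = inner ℂ (f (i + k) t) (g j t) := by
  rw [L2.inner_def, L2.inner_def]
  refine integral_congr_ae ?_
  filter_upwards [hf.ae_eq i k t, hg.ae_eq j k t] with ξ h1 h2
  rw [h1, h2, RCLike.inner_apply, RCLike.inner_apply]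
  simp only [map_mul, map_pow, Complex.conj_ofReal]
  ring

end

end KGS

namespace KGS

noncomputable section

variable {d : ℕ}

open ComplexConjugate

/-! ### Energy identities -/

lemma re_inner_comm (f g : L2 d) : (inner ℂ f g).re = (inner ℂ g f).re := inner_re_symm (𝕜 := ℂ) f g

lemma abs_re_inner_le (f g : L2 d) : |(inner ℂ f g).re| ≤ ‖f‖ * ‖g‖ :=
  (Complex.abs_re_le_norm _).trans (norm_inner_le_norm f g)

lemma re_inner_I_smul (f g : L2 d) : (inner ℂ f (Complex.I • g)).re = -(inner ℂ f g).im := by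
  rw [inner_smul_right]; simp

lemma re_inner_I_smul_self (f : L2 d) : (inner ℂ (Complex.I • f) f).re = 0 := by
  rw [re_inner_comm, re_inner_I_smul]
  simpa using inner_self_im (𝕜 := ℂ) f

lemma hasDerivAt_norm_sq {f : ℝ → L2 d} {f' : L2 d} {t : ℝ} (hf : HasDerivAt f f' t) :
    HasDerivAt (fun τ => ‖f τ‖ ^ 2) (2 * (inner ℂ (f t) f').re) t := by
  have h := Complex.reCLM.hasFDerivAt.comp_hasDerivAt t (hf.inner ℂ hf)
  have e : ∀ τ, ‖f τ‖ ^ 2 = Complex.reCLM (inner ℂ (f τ) (f τ)) := fun τ =>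
    norm_sq_eq_re_inner (𝕜 := ℂ) (f τ)
  have e2 : Complex.reCLM (inner ℂ (f t) f' + inner ℂ f' (f t)) =
      2 * (inner ℂ (f t) f').re := by
    rw [Complex.reCLM_apply, Complex.add_re, re_inner_comm f' (f t)]; ring
  rw [e2] at h
  exact h.congr_of_eventuallyEq (Eventually.of_forall e)

lemma hasDerivAt_kernelOp {s : ℝ} (K : SmoothingKernel d s) {f g : ℝ → L2 d} {f' g' : L2 d} {t : ℝ}
    (hf : HasDerivAt f f' t) (hg : HasDerivAt g g' t) :
    HasDerivAt (fun τ => K.op (f τ) (g τ)) (K.op (f t) g' + K.op f' (g t)) t :=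
  (K.op.bilinearRestrictScalars ℝ).hasDerivAt_of_bilinear (fun _ => hf) (fun _ => hg)

lemma re_inner_schrodinger {F : Type*} [NormedAddCommGroup F] [InnerProductSpace ℂ F]
    (f₀ f₂ q : F) : (inner ℂ f₀ (-Complex.I • (f₂ - f₀) + Complex.I • q)).re =
      (inner ℂ f₀ f₂).im - (inner ℂ f₀ f₀).im - (inner ℂ f₀ q).im := by
  rw [inner_add_right, inner_smul_right, inner_smul_right, inner_sub_right]
  simp
  ring

lemma re_inner_add_left {F : Type*} [NormedAddCommGroup F] [InnerProductSpace ℂ F]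
    (f g k : F) : (inner ℂ (f + g) k).re = (inner ℂ f k).re + (inner ℂ g k).re := by
  rw [inner_add_left, Complex.add_re]

lemma re_inner_add_right {F : Type*} [NormedAddCommGroup F] [InnerProductSpace ℂ F]
    (f g k : F) : (inner ℂ k (f + g)).re = (inner ℂ k f).re + (inner ℂ k g).re := by
  rw [inner_add_right, Complex.add_re]

lemma I_smul_schrodinger {F : Type*} [AddCommGroup F] [Module ℂ F] (f₀ f₂ q : F) :
    Complex.I • (-Complex.I • (f₂ - f₀) + Complex.I • q) = f₂ - f₀ - q := by
  rw [smul_add, smul_smul, smul_smul, mul_neg, Complex.I_mul_I, neg_neg, one_smul,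
    neg_smul, one_smul, sub_eq_add_neg (f₂ - f₀)]

/-- The linear Schrödinger flow with a Hermitian potential conserves the `L²` norm, so that only
the commutator contributes. -/
lemma abs_re_inner_schrodinger_le (p : GevreyParams d) {f₀ f₂ b : L2 d}
    (hb : ∀ᵐ ξ, b (-ξ) = conj (b ξ)) (h : (inner ℂ f₀ f₂).im = 0) :
    |(inner ℂ f₀ (-Complex.I • (f₂ - f₀) + Complex.I • p.weightedKernel.op f₀ b)).re| ≤
      ‖f₀‖ * ‖p.errorKernel.op f₀ b‖ := by
  -- Multiplication by a real potential is symmetric, so its quadratic form is real. Only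
  -- `plainKernel` has this symmetry, hence the splitting into plain and error parts.
  have h1 : (inner ℂ f₀ (p.plainKernel.op f₀ b)).im = 0 := by
    have := p.plainKernel.inner_op_symm (k := fun η => (bracket η ^ 2)⁻¹) (fun _ _ => rfl)
      (fun η => by rw [bracket_neg]) f₀ f₀ b hb
    rw [← inner_conj_symm] at this
    exact Complex.conj_eq_iff_im.1 this
  have h2 : p.weightedKernel.op f₀ b = p.plainKernel.op f₀ b - p.errorKernel.op f₀ b := by
    rw [p.plainKernel_op_eq]; simp
  have h3 : (inner ℂ f₀ f₀).im = 0 := inner_self_im (𝕜 := ℂ) f₀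
  have e : (inner ℂ f₀ (-Complex.I • (f₂ - f₀) + Complex.I • p.weightedKernel.op f₀ b)).re =
      (inner ℂ f₀ (p.errorKernel.op f₀ b)).im := by
    rw [re_inner_schrodinger, h2, inner_sub_right, Complex.sub_im, h1, h, h3]
    ring
  rw [e]
  exact (Complex.abs_im_le_norm _).trans (norm_inner_le_norm f₀ _)

namespace WeightedSolution

variable {p : GevreyParams d} {A B D V W : ℕ → ℝ → L2 d}
lemma hasDerivAt_mass (h : WeightedSolution p A B D V W) (t : ℝ) :
    ∃ m', HasDerivAt (fun τ => ‖A 0 τ‖ ^ 2) m' t ∧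
      |m'| ≤ 2 * (‖A 0 t‖ * ‖p.errorKernel.op (A 0 t) (B 2 t)‖) := by
  refine ⟨_, hasDerivAt_norm_sq (h.deriv_A 0 t), ?_⟩
  have h1 : (inner ℂ (A 0 t) (A 2 t)).im = 0 := by
    rw [h.scale_A.inner_shift h.scale_A 0 1 1 t]
    exact inner_self_im (𝕜 := ℂ) (A 1 t)
  have := abs_re_inner_schrodinger_le p (h.hermitian_B 2 t) h1
  rw [h.V_eq, abs_mul, abs_two]
  linarith

lemma hasDerivAt_V (h : WeightedSolution p A B D V W) (t : ℝ) :
    HasDerivAt (V 0) (-Complex.I • (V 2 t - V 0 t) + Complex.I • p.weightedKernel.op (V 0 t) (B 2 t)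
      + Complex.I • p.weightedKernel.op (A 0 t) (D 2 t)) t := by
  have e : V 0 = fun t => -Complex.I • (A 2 t - A 0 t) +
    Complex.I • p.weightedKernel.op (A 0 t) (B 2 t) := funext h.V_eq
  have h1 := ((h.deriv_A 2 t).sub (h.deriv_A 0 t)).const_smul (-Complex.I)
  have h2 := (hasDerivAt_kernelOp p.weightedKernel (h.deriv_A 0 t) (h.deriv_B 2 t)).const_smul
    Complex.I
  have h3 := h1.add h2
  rw [smul_add, add_comm (Complex.I • p.weightedKernel.op (A 0 t) (D 2 t)), ← add_assoc] at h3
  rw [funext_iff] at e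
  exact h3.congr_of_eventuallyEq (Eventually.of_forall e)

/-- The time derivative `V` solves the same Schrödinger equation with the forcing `A · ∂ₜn`.
Controlling `V` rather than `A 2` avoids commuting spatial derivatives with the potential. -/
lemma hasDerivAt_norm_V (h : WeightedSolution p A B D V W) (t : ℝ) :
    ∃ m', HasDerivAt (fun τ => ‖V 0 τ‖ ^ 2) m' t ∧
      |m'| ≤ 2 * (‖V 0 t‖ * ‖p.errorKernel.op (V 0 t) (B 2 t)‖) +
        2 * (‖V 0 t‖ * ‖p.weightedKernel.op (A 0 t) (D 2 t)‖) := by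
  refine ⟨_, hasDerivAt_norm_sq (h.hasDerivAt_V t), ?_⟩
  have h1 : (inner ℂ (V 0 t) (V 2 t)).im = 0 := by
    rw [h.scale_V.inner_shift h.scale_V 0 1 1 t]
    exact inner_self_im (𝕜 := ℂ) (V 1 t)
  have h2 := abs_re_inner_schrodinger_le p (h.hermitian_B 2 t) h1
  have h3 := abs_re_inner_le (V 0 t) (Complex.I • p.weightedKernel.op (A 0 t) (D 2 t))
  rw [norm_smul, Complex.norm_I, one_mul] at h3
  rw [inner_add_right, Complex.add_re, abs_mul, abs_two]
  have := abs_add_le ((inner ℂ (V 0 t) (-Complex.I • (V 2 t - V 0 t) +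
    Complex.I • p.weightedKernel.op (V 0 t) (B 2 t))).re)
    ((inner ℂ (V 0 t) (Complex.I • p.weightedKernel.op (A 0 t) (D 2 t))).re)
  linarith

/-- In the energy of the wave equation one derivative higher, the linear terms cancel and the source
`W 1 + B 3 = ⟨ξ⟩ (W 0 + B 2)` remains. -/
lemma hasDerivAt_wave (h : WeightedSolution p A B D V W) (t : ℝ) :
    ∃ m', HasDerivAt (fun τ => ‖B 2 τ‖ ^ 2 + ‖D 1 τ‖ ^ 2) m' t ∧
      |m'| ≤ 2 * (‖D 1 t‖ * ‖W 1 t + B 3 t‖) := by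
  refine ⟨_, (hasDerivAt_norm_sq (h.deriv_B 2 t)).add (hasDerivAt_norm_sq (h.deriv_D 1 t)), ?_⟩
  have h1 : (inner ℂ (D 1 t) (B 3 t)).re = (inner ℂ (B 2 t) (D 2 t)).re := by
    rw [h.scale_D.inner_shift h.scale_B 1 2 1 t, re_inner_comm]
  have h2 := abs_re_inner_le (D 1 t) (W 1 t + B 3 t)
  rw [inner_add_right, Complex.add_re, h1] at h2
  rw [← mul_add, abs_mul, abs_two, add_comm]
  linarith

lemma wave_source_ae (h : WeightedSolution p A B D V W) (t : ℝ) :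
    ((W 1 t + B 3 t : L2 d) : Space d → ℂ) =ᵐ[volume]
      fun ξ => (bracket ξ : ℂ) * p.weightedKernel.op (A 0 t) (conjReflect (A 2 t)) ξ := by
  have e : p.weightedKernel.op (A 0 t) (conjReflect (A 2 t)) = W 0 t + B 2 t := by
    rw [h.W_eq]; abel
  rw [e]
  filter_upwards [Lp.coeFn_add (W 1 t) (B 3 t), Lp.coeFn_add (W 0 t) (B 2 t),
    h.scale_W 1 t, h.scale_B.ae_eq 2 1 t] with ξ h1 h2 h3 h4
  rw [h1, h2, Pi.add_apply, Pi.add_apply, h3, h4]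
  ring

/-- The energy of the weighted solution. -/
def energy (p : GevreyParams d) (A B D : ℕ → ℝ → L2 d) (t : ℝ) : ℝ :=
  ‖A 1 t‖ ^ 2 - ‖A 0 t‖ ^ 2 + (‖B 1 t‖ ^ 2 + ‖D 0 t‖ ^ 2) / 2 -
    (inner ℂ (A 0 t) (p.plainKernel.op (A 0 t) (B 2 t))).re

-- With the exact product, the Schrödinger part would be `2 Re ⟨iV, V⟩ = 0`, and the source of the
-- wave equation would cancel the part of the interaction in which `n` is differentiated. The
-- interaction is taken with `plainKernel` and the equations contain `weightedKernel`, so only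
-- `errorKernel` survives: tested against `V` for Schrödinger and against `D` for the wave.
set_option maxHeartbeats 800000 in
lemma hasDerivAt_energy (h : WeightedSolution p A B D V W) (t : ℝ) :
    ∃ m', HasDerivAt (energy p A B D) m' t ∧
      |m'| ≤ 2 * (‖p.errorKernel.op (A 0 t) (B 2 t)‖ * ‖V 0 t‖) +
        ‖D 0 t‖ * ‖p.errorKernel.op (A 0 t) (conjReflect (A 2 t))‖ := by
  have hT := Complex.reCLM.hasFDerivAt.comp_hasDerivAt t ((h.deriv_A 0 t).inner ℂ
    (hasDerivAt_kernelOp p.plainKernel (h.deriv_A 0 t) (h.deriv_B 2 t)))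
  have hE := ((((hasDerivAt_norm_sq (h.deriv_A 1 t)).sub
    (hasDerivAt_norm_sq (h.deriv_A 0 t))).add
    (((hasDerivAt_norm_sq (h.deriv_B 1 t)).add
      (hasDerivAt_norm_sq (h.deriv_D 0 t))).div_const 2)).sub hT)
  refine ⟨_, hE, ?_⟩
  have e1 : (inner ℂ (A 1 t) (V 1 t)).re = (inner ℂ (A 2 t) (V 0 t)).re := by
    rw [h.scale_A.inner_shift h.scale_V 1 0 1 t]
  have e2 : (inner ℂ (B 1 t) (D 1 t)).re = (inner ℂ (B 2 t) (D 0 t)).re := by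
    rw [h.scale_B.inner_shift h.scale_D 1 0 1 t]
  have e3 : (inner ℂ (D 0 t) (W 0 t)).re = -(inner ℂ (B 2 t) (D 0 t)).re +
      (inner ℂ (D 0 t) (p.weightedKernel.op (A 0 t) (conjReflect (A 2 t)))).re := by
    rw [h.W_eq, inner_add_right, inner_neg_right, Complex.add_re, Complex.neg_re,
      re_inner_comm (D 0 t) (B 2 t)]
  have e4 : (inner ℂ (A 0 t) (p.plainKernel.op (V 0 t) (B 2 t))).re =
      (inner ℂ (p.plainKernel.op (A 0 t) (B 2 t)) (V 0 t)).re := by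
    rw [p.plainKernel.inner_op_symm (k := fun η => (bracket η ^ 2)⁻¹) (fun _ _ => rfl)
      (fun η => by rw [bracket_neg]) (V 0 t) (A 0 t) (B 2 t) (h.hermitian_B 2 t)]
  have e5 : (inner ℂ (A 0 t) (p.plainKernel.op (A 0 t) (D 2 t))).re =
      (inner ℂ (D 0 t) (p.plainKernel.op (A 0 t) (conjReflect (A 2 t)))).re := by
    rw [re_inner_comm (D 0 t), p.plainKernel.inner_op_eq_inner_op_corr
      (k := fun η => (bracket η ^ 2)⁻¹) (fun _ _ => rfl) (A 0 t) (A 0 t) (D 2 t) (D 0 t)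
      (conjReflect (A 2 t)) (GevreyParams.ae_eq_inv_zero h.scale_D t) ?_]
    filter_upwards [coeFn_conjReflect (A 2 t), ae_comp_neg (h.scale_A 2 t)] with ξ h1 h2
    have := bracket_ne_zero' ξ
    rw [h1, h2, bracket_neg]
    simp only [map_mul, map_pow, Complex.conj_ofReal]
    push_cast
    field_simp
  have e6 : (inner ℂ (A 2 t - A 0 t - p.weightedKernel.op (A 0 t) (B 2 t)) (V 0 t)).re = 0 := by
    have : A 2 t - A 0 t - p.weightedKernel.op (A 0 t) (B 2 t) = Complex.I • V 0 t := by
      rw [h.V_eq]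
      exact (I_smul_schrodinger _ _ _).symm
    rw [this]
    exact re_inner_I_smul_self _
  simp only [inner_sub_left, Complex.sub_re] at e6
  have e7 := p.plainKernel_op_eq (A 0 t) (B 2 t)
  have e8 := p.plainKernel_op_eq (A 0 t) (conjReflect (A 2 t))
  have e9 := re_inner_comm (V 0 t) (p.plainKernel.op (A 0 t) (B 2 t))
  have e10 := re_inner_add_left (p.weightedKernel.op (A 0 t) (B 2 t))
    (p.errorKernel.op (A 0 t) (B 2 t)) (V 0 t)
  rw [← e7] at e10
  have e11 := re_inner_add_right (p.weightedKernel.op (A 0 t) (conjReflect (A 2 t)))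
    (p.errorKernel.op (A 0 t) (conjReflect (A 2 t))) (D 0 t)
  rw [← e8] at e11
  have e12 := re_inner_add_right (p.plainKernel.op (A 0 t) (D 2 t))
    (p.plainKernel.op (V 0 t) (B 2 t)) (A 0 t)
  have h1 := abs_re_inner_le (p.errorKernel.op (A 0 t) (B 2 t)) (V 0 t)
  have h2 := abs_re_inner_le (D 0 t) (p.errorKernel.op (A 0 t) (conjReflect (A 2 t)))
  rw [Complex.reCLM_apply, Complex.add_re, e12, e1, e2, e3, e4, e5, e9, e10, e11]
  rw [abs_le] at h1 h2 ⊢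
  constructor <;> linarith

/-- Elliptic recovery: the Schrödinger equation, solved for the Laplacian, returns two spatial
derivatives from one time derivative. -/
lemma norm_A_two_le (h : WeightedSolution p A B D V W) (t : ℝ) :
    ‖A 2 t‖ ≤ ‖A 0 t‖ + ‖V 0 t‖ + p.opConst * ‖A 1 t‖ * ‖B 1 t‖ := by
  have e : A 2 t = A 0 t + Complex.I • V 0 t + p.weightedKernel.op (A 0 t) (B 2 t) := by
    have := I_smul_schrodinger (A 0 t) (A 2 t) (p.weightedKernel.op (A 0 t) (B 2 t))
    rw [← h.V_eq] at this
    rw [this]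
    abel
  have h1 := p.norm_weighted_le h.scale_A h.scale_B t
  have h2 := norm_add_le (A 0 t + Complex.I • V 0 t) (p.weightedKernel.op (A 0 t) (B 2 t))
  have h3 := norm_add_le (A 0 t) (Complex.I • V 0 t)
  rw [norm_smul, Complex.norm_I, one_mul] at h3
  rw [← e] at h2
  linarith

end WeightedSolution

end

end KGS

/-! ### Bootstrap: from almost conservation to bounds uniform in the truncation. -/

namespace KGS

noncomputable section

variable {d : ℕ}

/-! ### The continuity argument -/

/-- At the first time where `φ` reaches one, continuity gives `φ ≤ 1` up to and including that time,
and the hypothesis then forbids the value one. -/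
lemma le_one_of_bootstrap_nonneg {φ : ℝ → ℝ} (hφ : Continuous φ) (h0 : φ 0 < 1) {T : ℝ}
    (h : ∀ t, 0 ≤ t → t ≤ T → (∀ τ ∈ Set.Icc 0 t, φ τ ≤ 1) → φ t < 1) {t : ℝ} (ht0 : 0 ≤ t)
    (htT : t ≤ T) : φ t ≤ 1 := by
  by_contra! hcon
  set S := Set.Icc 0 T ∩ φ ⁻¹' Set.Ici 1 with hS
  have hSc : IsCompact S := isCompact_Icc.inter_right (isClosed_Ici.preimage hφ)
  have hne : S.Nonempty := ⟨t, ⟨ht0, htT⟩, hcon.le⟩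
  obtain ⟨r, hr, hmin⟩ := hSc.exists_isLeast hne
  have hlt : ∀ τ, 0 ≤ τ → τ < r → φ τ < 1 := by
    intro τ h1 h2
    by_contra! h3
    exact absurd (hmin ⟨⟨h1, h2.le.trans hr.1.2⟩, h3⟩) (not_le.2 h2)
  have hr0 : 0 < r := by
    rcases hr.1.1.eq_or_lt with h1 | h1
    · rw [← h1] at hr
      exact absurd hr.2 (not_le.2 h0)
    · exact h1
  have hle : φ r ≤ 1 := by
    have ht : Tendsto φ (𝓝[<] r) (𝓝 (φ r)) := hφ.continuousAt.mono_left nhdsWithin_le_nhds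
    refine le_of_tendsto ht ?_
    filter_upwards [Ioo_mem_nhdsLT hr0] with τ hτ
    exact (hlt τ hτ.1.le hτ.2).le
  refine absurd (h r hr.1.1 hr.1.2 fun τ hτ => ?_) (not_lt.2 hr.2)
  rcases hτ.2.eq_or_lt with h1 | h1
  · rw [h1]; exact hle
  · exact (hlt τ hτ.1 h1).le

lemma le_one_of_bootstrap {φ : ℝ → ℝ} (hφ : Continuous φ) (h0 : φ 0 < 1) {T : ℝ}
    (h : ∀ t, |t| ≤ T → (∀ τ ∈ Set.uIcc 0 t, φ τ ≤ 1) → φ t < 1) {t : ℝ} (ht : |t| ≤ T) :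
    φ t ≤ 1 := by
  rcases le_total 0 t with h1 | h1
  · refine le_one_of_bootstrap_nonneg hφ h0 (T := T) (fun r hr hrT hr1 => ?_) h1
      ((le_abs_self t).trans ht)
    refine h r (by rwa [abs_of_nonneg hr]) ?_
    rwa [Set.uIcc_of_le hr]
  · have := le_one_of_bootstrap_nonneg (φ := fun r => φ (-r)) (by fun_prop) (by simpa using h0)
      (T := T) (fun r hr hrT hr1 => ?_) (t := -t) (by linarith) (by rwa [← abs_of_nonpos h1])
    · simpa using this
    refine h (-r) (by rwa [abs_neg, abs_of_nonneg hr]) fun τ hτ => ?_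
    rw [Set.uIcc_of_ge (by linarith)] at hτ
    have := hr1 (-τ) ⟨by linarith [hτ.2], by linarith [hτ.1]⟩
    simpa using this

lemma abs_sub_le_of_deriv_le {f : ℝ → ℝ} {C t : ℝ}
    (h : ∀ τ ∈ Set.uIcc 0 t, ∃ m', HasDerivAt f m' τ ∧ |m'| ≤ C) : |f t - f 0| ≤ C * |t| := by
  have := Convex.norm_image_sub_le_of_norm_deriv_le (f := f) (s := Set.uIcc 0 t) (C := C)
    (x := 0) (y := t)
    (fun τ hτ => by
      obtain ⟨m', h1, _⟩ := h τ hτ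
      exact h1.differentiableAt)
    (fun τ hτ => by
      obtain ⟨m', h1, h2⟩ := h τ hτ
      rw [h1.deriv]
      exact h2) (convex_uIcc 0 t) Set.left_mem_uIcc Set.right_mem_uIcc
  simpa using this

/-! ### A priori bounds -/

namespace WeightedSolution

variable {p : GevreyParams d} {A B D V W : ℕ → ℝ → L2 d}

lemma exists_deriv_mass_le (h : WeightedSolution p A B D V W) {t K : ℝ} (hA : ‖A 1 t‖ ≤ K)
    (hB : ‖B 1 t‖ ≤ K) :
    ∃ m', HasDerivAt (fun τ => ‖A 0 τ‖ ^ 2) m' t ∧ |m'| ≤ p.gain * (2 * p.opConst * K ^ 3) := by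
  obtain ⟨m', h1, h2⟩ := h.hasDerivAt_mass t
  refine ⟨m', h1, h2.trans ?_⟩
  have h3 := p.norm_error_le h.scale_A h.scale_B t
  have h4 := (h.scale_A.norm_le_succ 0 t).trans hA
  have hC := p.opConst_nonneg
  have hg := p.gain_nonneg
  have hK : 0 ≤ K := (norm_nonneg _).trans hA
  calc 2 * (‖A 0 t‖ * ‖p.errorKernel.op (A 0 t) (B 2 t)‖)
      ≤ 2 * (K * (p.opConst * p.gain * K * K)) := by
        gcongr
        exact h3.trans (by gcongr)
    _ = _ := by ring

lemma exists_deriv_energy_le (h : WeightedSolution p A B D V W) {t K L : ℝ} (hA : ‖A 1 t‖ ≤ K)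
    (hB : ‖B 1 t‖ ≤ K) (hD : ‖D 0 t‖ ≤ K) (hV : ‖V 0 t‖ ≤ L) (hL : 1 ≤ L) :
    ∃ m', HasDerivAt (energy p A B D) m' t ∧
      |m'| ≤ p.gain * L * (2 * p.opConst * K ^ 2 + p.opConst * K ^ 3) := by
  obtain ⟨m', h1, h2⟩ := h.hasDerivAt_energy t
  refine ⟨m', h1, h2.trans ?_⟩
  have h3 := p.norm_error_le h.scale_A h.scale_B t
  have h4 := p.norm_error_le h.scale_A h.scale_A.conjReflect t
  rw [norm_conjReflect] at h4
  have hC := p.opConst_nonneg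
  have hg := p.gain_nonneg
  have hK : 0 ≤ K := (norm_nonneg _).trans hA
  calc 2 * (‖p.errorKernel.op (A 0 t) (B 2 t)‖ * ‖V 0 t‖) +
        ‖D 0 t‖ * ‖p.errorKernel.op (A 0 t) (conjReflect (A 2 t))‖
      ≤ 2 * ((p.opConst * p.gain * K * K) * L) + K * (p.opConst * p.gain * K * K) := by
        gcongr
        · exact h3.trans (by gcongr)
        · exact h4.trans (by gcongr)
    _ ≤ 2 * ((p.opConst * p.gain * K * K) * L) + K * (p.opConst * p.gain * K * K) * L := by
        have : K * (p.opConst * p.gain * K * K) ≤ K * (p.opConst * p.gain * K * K) * L :=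
          le_mul_of_one_le_right (by positivity) hL
        linarith
    _ = _ := by ring

/-- Since `A 2` is of size `L` and `A 1` of size `K`, interpolation at frequency `L` yields
`L^{1-θ}` instead of `L`. This saving makes second order norms grow only polynomially. -/
lemma norm_fractional_A_le (h : WeightedSolution p A B D V W) {t K L : ℝ} (hA : ‖A 1 t‖ ≤ K)
    (hB : ‖B 1 t‖ ≤ K) (hV : ‖V 0 t‖ ≤ L) (hL : 1 ≤ L) :
    ‖p.fractional.op (A 2 t)‖ ≤ L ^ (1 - p.θ) * (2 * K + 1 + p.opConst * K ^ 2) := by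
  have hC := p.opConst_nonneg
  have hL0 : 0 < L := by linarith
  have hK : 0 ≤ K := (norm_nonneg _).trans hA
  have h1 := p.norm_fractional_le h.scale_A 1 t hL0
  have h2 := h.norm_A_two_le t
  have h4 := (h.scale_A.norm_le_succ 0 t).trans hA
  have h5 : ‖A 2 t‖ ≤ L * (K + 1 + p.opConst * K ^ 2) := by
    have : p.opConst * ‖A 1 t‖ * ‖B 1 t‖ ≤ p.opConst * K ^ 2 := by
      calc p.opConst * ‖A 1 t‖ * ‖B 1 t‖ ≤ p.opConst * K * K := by gcongr
        _ = _ := by ring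
    have h6 : K + p.opConst * K ^ 2 ≤ L * (K + p.opConst * K ^ 2) :=
      le_mul_of_one_le_left (by positivity) hL
    nlinarith
  have e : L ^ (-p.θ) * L = L ^ (1 - p.θ) := by
    rw [sub_eq_neg_add, Real.rpow_add hL0, Real.rpow_one]
  have hp1 : 0 < L ^ (1 - p.θ) := Real.rpow_pos_of_pos hL0 _
  have hp2 : 0 < L ^ (-p.θ) := Real.rpow_pos_of_pos hL0 _
  calc ‖p.fractional.op (A 2 t)‖ ≤ L ^ (1 - p.θ) * ‖A 1 t‖ + L ^ (-p.θ) * ‖A 2 t‖ := h1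
    _ ≤ L ^ (1 - p.θ) * K + L ^ (-p.θ) * (L * (K + 1 + p.opConst * K ^ 2)) := by gcongr
    _ = L ^ (1 - p.θ) * (2 * K + 1 + p.opConst * K ^ 2) := by
        rw [← mul_assoc, e]; ring

lemma exists_deriv_norm_V_le (h : WeightedSolution p A B D V W) {t K L : ℝ} (hA : ‖A 1 t‖ ≤ K)
    (hB : ‖B 1 t‖ ≤ K) (hD : ‖D 0 t‖ ≤ K) (hV : ‖V 0 t‖ ≤ L) (hB2 : ‖B 2 t‖ ≤ L) (hL : 1 ≤ L) :
    ∃ m', HasDerivAt (fun τ => ‖V 0 τ‖ ^ 2) m' t ∧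
      |m'| ≤ p.gain * L * (2 * p.opConst * L ^ 2) + L * L ^ (1 - p.θ) *
        (2 * p.opConst * K * (2 * K + 1 + p.opConst * K ^ 2)) := by
  obtain ⟨m', h1, h2⟩ := h.hasDerivAt_norm_V t
  refine ⟨m', h1, h2.trans ?_⟩
  -- `V` is known only in `L²`, so the commutator loss goes onto the wave factor, at the price of
  -- the second order norm of `B`.
  have h3 : ‖p.errorKernel.op (V 0 t) (B 2 t)‖ ≤ p.opConst * p.gain * ‖V 0 t‖ * ‖B 2 t‖ :=
    p.errorKernel.norm_op_le (V 0 t) (B 2 t)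
  have h4 := p.norm_weighted_le_fractional h.scale_A h.scale_D t
  have h5 := h.norm_fractional_A_le hA hB hV hL
  have hC := p.opConst_nonneg
  have hg := p.gain_nonneg
  have hK : 0 ≤ K := (norm_nonneg _).trans hA
  have hL0 : 0 < L := by linarith
  have hp1 : 0 < L ^ (1 - p.θ) := Real.rpow_pos_of_pos hL0 _
  calc 2 * (‖V 0 t‖ * ‖p.errorKernel.op (V 0 t) (B 2 t)‖) +
        2 * (‖V 0 t‖ * ‖p.weightedKernel.op (A 0 t) (D 2 t)‖)
      ≤ 2 * (L * (p.opConst * p.gain * L * L)) +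
        2 * (L * (p.opConst * (L ^ (1 - p.θ) * (2 * K + 1 + p.opConst * K ^ 2)) * K)) := by
        gcongr
        · exact h3.trans (by gcongr)
        · exact h4.trans (by gcongr)
    _ = _ := by ring

lemma exists_deriv_wave_le (h : WeightedSolution p A B D V W) {t K L : ℝ} (hA : ‖A 1 t‖ ≤ K)
    (hB : ‖B 1 t‖ ≤ K) (hV : ‖V 0 t‖ ≤ L) (hD1 : ‖D 1 t‖ ≤ L) (hL : 1 ≤ L) :
    ∃ m', HasDerivAt (fun τ => ‖B 2 τ‖ ^ 2 + ‖D 1 τ‖ ^ 2) m' t ∧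
      |m'| ≤ L * L ^ (1 - p.θ) * (4 * p.opConst * K * (2 * K + 1 + p.opConst * K ^ 2)) := by
  obtain ⟨m', h1, h2⟩ := h.hasDerivAt_wave t
  refine ⟨m', h1, h2.trans ?_⟩
  have h4 := p.norm_bracket_weighted_le h.scale_A t (h.wave_source_ae t)
  rw [p.norm_fractional_conjReflect] at h4
  have h5 := h.norm_fractional_A_le hA hB hV hL
  have hC := p.opConst_nonneg
  have hK : 0 ≤ K := (norm_nonneg _).trans hA
  have hL0 : 0 < L := by linarith
  have hp1 : 0 < L ^ (1 - p.θ) := Real.rpow_pos_of_pos hL0 _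
  calc 2 * (‖D 1 t‖ * ‖W 1 t + B 3 t‖)
      ≤ 2 * (L * (p.opConst * 2 * K *
          (L ^ (1 - p.θ) * (2 * K + 1 + p.opConst * K ^ 2)))) := by
        gcongr
        exact h4.trans (by gcongr)
    _ = _ := by ring

lemma abs_interaction_le (h : WeightedSolution p A B D V W) (t : ℝ) {L : ℝ} (hL : 0 < L) :
    |(inner ℂ (A 0 t) (p.plainKernel.op (A 0 t) (B 2 t))).re| ≤
      ‖A 0 t‖ * (p.opConst * (L ^ (1 - p.θ) * ‖A 0 t‖ + L ^ (-p.θ) * ‖A 1 t‖) * ‖B 1 t‖) := by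
  have hC := p.opConst_nonneg
  refine (abs_re_inner_le _ _).trans ?_
  gcongr
  refine (p.norm_plain_le h.scale_A h.scale_B t).trans ?_
  gcongr
  exact p.norm_fractional_le h.scale_A 0 t hL

/-- Mass and energy control the first order norms. -/
lemma sum_sq_le (h : WeightedSolution p A B D V W) (t : ℝ) {m L e : ℝ} (hL : 0 < L)
    (hm : ‖A 0 t‖ ≤ m) (hmL : p.opConst * m * L ^ (-p.θ) ≤ 1 / 2)
    (he : energy p A B D t + ‖A 0 t‖ ^ 2 ≤ e) :
    ‖A 1 t‖ ^ 2 + ‖B 1 t‖ ^ 2 + ‖D 0 t‖ ^ 2 ≤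
      8 * (e + 2 * (p.opConst * m ^ 2 * L ^ (1 - p.θ)) ^ 2) := by
  have hC := p.opConst_nonneg
  have h1 := h.abs_interaction_le t hL
  have hp1 : 0 < L ^ (1 - p.θ) := Real.rpow_pos_of_pos hL _
  have hp2 : 0 < L ^ (-p.θ) := Real.rpow_pos_of_pos hL _
  have hm0 : 0 ≤ m := (norm_nonneg _).trans hm
  have h2 : ‖A 0 t‖ * (p.opConst * (L ^ (1 - p.θ) * ‖A 0 t‖ + L ^ (-p.θ) * ‖A 1 t‖) * ‖B 1 t‖) ≤
      p.opConst * m ^ 2 * L ^ (1 - p.θ) * ‖B 1 t‖ + 1 / 2 * (‖A 1 t‖ * ‖B 1 t‖) := by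
    calc ‖A 0 t‖ * (p.opConst * (L ^ (1 - p.θ) * ‖A 0 t‖ + L ^ (-p.θ) * ‖A 1 t‖) * ‖B 1 t‖)
        ≤ m * (p.opConst * (L ^ (1 - p.θ) * m + L ^ (-p.θ) * ‖A 1 t‖) * ‖B 1 t‖) := by gcongr
      _ = p.opConst * m ^ 2 * L ^ (1 - p.θ) * ‖B 1 t‖ +
          p.opConst * m * L ^ (-p.θ) * (‖A 1 t‖ * ‖B 1 t‖) := by ring
      _ ≤ _ := by gcongr
  have h3 := le_of_abs_le (h1.trans h2)
  unfold energy at he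
  set x := ‖A 1 t‖
  set y := ‖B 1 t‖
  set c := p.opConst * m ^ 2 * L ^ (1 - p.θ)
  -- Here `x * y / 2 ≤ (x² + y²) / 4` and `c * y ≤ y² / 8 + 2 * c²`, which leaves at least one
  -- eighth of each square.
  nlinarith [sq_nonneg (x - y), sq_nonneg (y - 4 * c), sq_nonneg x, sq_nonneg ‖D 0 t‖]

end WeightedSolution

end

end KGS

namespace KGS

noncomputable section

variable {d : ℕ}

namespace WeightedSolution

variable {p : GevreyParams d} {A B D V W : ℕ → ℝ → L2 d}

/-- The first order norms stay below `K`, and the second order norms below `L`, as long as the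
accumulated errors are small. -/
lemma sum_sq_le_of_small (h : WeightedSolution p A B D V W) {K L T m e l : ℝ}
    (hK : 0 ≤ K) (hL : 1 ≤ L) (hm : 0 ≤ m) (hl : 0 < l)
    (hml : p.opConst * m * l ^ (-p.θ) ≤ 1 / 2)
    (hKe : 8 * (e + 2 * (p.opConst * m ^ 2 * l ^ (1 - p.θ)) ^ 2) < K ^ 2)
    (mass_small : p.gain * (2 * p.opConst * K ^ 3) * T ≤ 1)
    (energy_small : p.gain * L * (2 * p.opConst * K ^ 2 + p.opConst * K ^ 3) * T ≤ 1)
    (V_small : (p.gain * L * (2 * p.opConst * L ^ 2) + L * L ^ (1 - p.θ) *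
      (2 * p.opConst * K * (2 * K + 1 + p.opConst * K ^ 2))) * T ≤ L ^ 2 / 2)
    (wave_small : L * L ^ (1 - p.θ) *
      (4 * p.opConst * K * (2 * K + 1 + p.opConst * K ^ 2)) * T ≤ L ^ 2 / 2)
    (mass_zero : ‖A 0 0‖ ^ 2 + 1 ≤ m ^ 2) (energy_zero : energy p A B D 0 + ‖A 0 0‖ ^ 2 + 2 ≤ e)
    (V_zero : ‖V 0 0‖ ^ 2 < L ^ 2 / 2) (wave_zero : ‖B 2 0‖ ^ 2 + ‖D 1 0‖ ^ 2 < L ^ 2 / 2)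
    {t : ℝ} (ht : |t| ≤ T) :
    ‖A 1 t‖ ^ 2 + ‖B 1 t‖ ^ 2 + ‖D 0 t‖ ^ 2 ≤ K ^ 2 := by
  have cA : ∀ k, Continuous (A k) := fun k =>
    continuous_iff_continuousAt.2 fun t => (h.deriv_A k t).continuousAt
  have cB : ∀ k, Continuous (B k) := fun k =>
    continuous_iff_continuousAt.2 fun t => (h.deriv_B k t).continuousAt
  have cD : ∀ k, Continuous (D k) := fun k =>
    continuous_iff_continuousAt.2 fun t => (h.deriv_D k t).continuousAt
  have cV : Continuous fun τ => ‖V 0 τ‖ ^ 2 :=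
    continuous_iff_continuousAt.2 fun t => by
      obtain ⟨m', h1, _⟩ := h.hasDerivAt_norm_V t
      exact h1.continuousAt
  have hC := p.opConst_nonneg
  have hg := p.gain_nonneg
  have hL0 : 0 < L := by linarith
  have hp1 : 0 < L ^ (1 - p.θ) := Real.rpow_pos_of_pos hL0 _
  -- The first and second order bounds are bootstrapped together; adding one places the threshold at
  -- one.
  set φ : ℝ → ℝ := fun τ => max (‖A 1 τ‖ ^ 2 + ‖B 1 τ‖ ^ 2 + ‖D 0 τ‖ ^ 2 - K ^ 2)
    (max (‖V 0 τ‖ ^ 2 - L ^ 2) (‖B 2 τ‖ ^ 2 + ‖D 1 τ‖ ^ 2 - L ^ 2)) + 1 with hφ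
  have cφ : Continuous φ := by
    have := cA 1; have := cB 1; have := cB 2; have := cD 0; have := cD 1
    fun_prop
  have improve : ∀ τ, |‖A 0 τ‖ ^ 2 - ‖A 0 0‖ ^ 2| ≤ 1 →
      |energy p A B D τ - energy p A B D 0| ≤ 1 → |‖V 0 τ‖ ^ 2 - ‖V 0 0‖ ^ 2| ≤ L ^ 2 / 2 →
      |(‖B 2 τ‖ ^ 2 + ‖D 1 τ‖ ^ 2) - (‖B 2 0‖ ^ 2 + ‖D 1 0‖ ^ 2)| ≤ L ^ 2 / 2 → φ τ < 1 := by
    intro τ h1 h2 h3 h4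
    have h1 := le_of_abs_le h1
    have h2 := le_of_abs_le h2
    have h3 := le_of_abs_le h3
    have h4 := le_of_abs_le h4
    have h5 : ‖A 0 τ‖ ≤ m := abs_le_of_sq_le_sq' (by linarith) hm |>.2
    have h6 := h.sum_sq_le τ hl h5 hml (e := e) (by linarith)
    have : max (‖A 1 τ‖ ^ 2 + ‖B 1 τ‖ ^ 2 + ‖D 0 τ‖ ^ 2 - K ^ 2)
      (max (‖V 0 τ‖ ^ 2 - L ^ 2) (‖B 2 τ‖ ^ 2 + ‖D 1 τ‖ ^ 2 - L ^ 2)) < 0 :=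
      max_lt (by linarith) (max_lt (by linarith) (by linarith))
    simp only [hφ]
    linarith
  have bound : ∀ τ, φ τ ≤ 1 → ‖A 1 τ‖ ^ 2 + ‖B 1 τ‖ ^ 2 + ‖D 0 τ‖ ^ 2 ≤ K ^ 2 ∧
      ‖V 0 τ‖ ^ 2 ≤ L ^ 2 ∧ ‖B 2 τ‖ ^ 2 + ‖D 1 τ‖ ^ 2 ≤ L ^ 2 := by
    intro τ hτ
    have : max (‖A 1 τ‖ ^ 2 + ‖B 1 τ‖ ^ 2 + ‖D 0 τ‖ ^ 2 - K ^ 2)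
      (max (‖V 0 τ‖ ^ 2 - L ^ 2) (‖B 2 τ‖ ^ 2 + ‖D 1 τ‖ ^ 2 - L ^ 2)) ≤ 0 := by
      simp only [hφ] at hτ
      linarith
    simp only [max_le_iff] at this
    exact ⟨by linarith, by linarith, by linarith⟩
  refine (bound t (le_one_of_bootstrap cφ (improve 0 ?_ ?_ ?_ ?_) (T := T) ?_ ht)).1
  · simp
  · simp
  · simp; positivity
  · simp; positivity
  intro t ht hτ
  have key : ∀ τ ∈ Set.uIcc 0 t, ‖A 1 τ‖ ≤ K ∧ ‖B 1 τ‖ ≤ K ∧ ‖D 0 τ‖ ≤ K ∧ ‖V 0 τ‖ ≤ L ∧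
      ‖B 2 τ‖ ≤ L ∧ ‖D 1 τ‖ ≤ L := by
    intro τ h1
    obtain ⟨h2, h3, h4⟩ := bound τ (hτ τ h1)
    refine ⟨?_, ?_, ?_, ?_, ?_, ?_⟩
    · exact (abs_le_of_sq_le_sq' (by linarith [sq_nonneg ‖B 1 τ‖, sq_nonneg ‖D 0 τ‖]) hK).2
    · exact (abs_le_of_sq_le_sq' (by linarith [sq_nonneg ‖A 1 τ‖, sq_nonneg ‖D 0 τ‖]) hK).2
    · exact (abs_le_of_sq_le_sq' (by linarith [sq_nonneg ‖A 1 τ‖, sq_nonneg ‖B 1 τ‖]) hK).2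
    · exact (abs_le_of_sq_le_sq' h3 hL0.le).2
    · exact (abs_le_of_sq_le_sq' (by linarith [sq_nonneg ‖D 1 τ‖]) hL0.le).2
    · exact (abs_le_of_sq_le_sq' (by linarith [sq_nonneg ‖B 2 τ‖]) hL0.le).2
  refine improve t ?_ ?_ ?_ ?_
  · refine (abs_sub_le_of_deriv_le (f := fun τ => ‖A 0 τ‖ ^ 2) fun τ h1 => ?_).trans
      ((mul_le_mul_of_nonneg_left ht ?_).trans mass_small)
    · obtain ⟨kA, kB, kD, kV, kB2, kD1⟩ := key τ h1
      exact h.exists_deriv_mass_le kA kB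
    · positivity
  · refine (abs_sub_le_of_deriv_le fun τ h1 => ?_).trans
      ((mul_le_mul_of_nonneg_left ht ?_).trans energy_small)
    · obtain ⟨kA, kB, kD, kV, kB2, kD1⟩ := key τ h1
      exact h.exists_deriv_energy_le kA kB kD kV hL
    · positivity
  · refine (abs_sub_le_of_deriv_le (f := fun τ => ‖V 0 τ‖ ^ 2) fun τ h1 => ?_).trans
      ((mul_le_mul_of_nonneg_left ht ?_).trans V_small)
    · obtain ⟨kA, kB, kD, kV, kB2, kD1⟩ := key τ h1
      exact h.exists_deriv_norm_V_le kA kB kD kV kB2 hL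
    · positivity
  · refine (abs_sub_le_of_deriv_le (f := fun τ => ‖B 2 τ‖ ^ 2 + ‖D 1 τ‖ ^ 2)
      fun τ h1 => ?_).trans ((mul_le_mul_of_nonneg_left ht ?_).trans wave_small)
    · obtain ⟨kA, kB, kD, kV, kB2, kD1⟩ := key τ h1
      exact h.exists_deriv_wave_le kA kB kV kD1 hL
    · positivity

end WeightedSolution

set_option maxHeartbeats 800000 in
/-- Uniform first order bounds on the time scale on which `gain * T ^ (1 + 1 / θ)` is small. -/
theorem exists_uniform_bound (d : ℕ) {θ : ℝ} (hθ : 0 < θ) (hθ1 : θ < 1) {N : ℝ} (hN : 1 ≤ N) :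
    ∃ K : ℝ, ∃ c > (0 : ℝ), ∀ (p : GevreyParams d) (A B D V W : ℕ → ℝ → L2 d),
      WeightedSolution p A B D V W → p.θ = θ → ‖A 1 0‖ ≤ N → ‖B 1 0‖ ≤ N → ‖D 0 0‖ ≤ N →
      ‖V 0 0‖ ≤ N → ‖B 2 0‖ ≤ N → ‖D 1 0‖ ≤ N → ∀ T : ℝ, 1 ≤ T →
      p.gain * T ^ (1 + 1 / θ) ≤ c → ∀ t : ℝ, |t| ≤ T →
      ‖A 1 t‖ ^ 2 + ‖B 1 t‖ ^ 2 + ‖D 0 t‖ ^ 2 ≤ K ^ 2 := by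
  obtain ⟨C, hC, hpC⟩ : ∃ C : ℝ, 0 ≤ C ∧ ∀ p : GevreyParams d, p.θ = θ → p.opConst = C :=
    ⟨2 * √(decayConst d (2 - θ)).toReal, by positivity, fun p hp => by
      rw [GevreyParams.opConst, GevreyParams.s, hp]⟩
  have hN0 : 0 < N := by linarith
  -- The weighted mass starts below `N ^ 2` and may drift by one.
  set m := √(N ^ 2 + 1) with hm
  have hm0 : 0 < m := by positivity
  have hm2 : m ^ 2 = N ^ 2 + 1 := Real.sq_sqrt (by positivity)
  obtain ⟨l, hl0, hl⟩ : ∃ l : ℝ, 0 < l ∧ C * m * l ^ (-θ) ≤ 1 / 2 := by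
    refine ⟨(2 * (C * m + 1)) ^ (1 / θ), by positivity, ?_⟩
    rw [← Real.rpow_mul (by positivity), mul_neg, one_div_mul_cancel hθ.ne', Real.rpow_neg_one,
      ← div_eq_mul_inv, div_le_iff₀ (by positivity)]
    nlinarith [mul_nonneg hC hm0.le]
  -- Initial quadratic energy and interaction, plus a drift of one each for mass and energy.
  set e := 3 * N ^ 2 + 2 * C * N ^ 3 + 2 with he
  set X := 8 * (e + 2 * (C * m ^ 2 * l ^ (1 - θ)) ^ 2) with hX
  have hX0 : 0 ≤ X := by positivity
  set K := √(X + 1) with hKdef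
  have hK0 : 0 ≤ K := by positivity
  have hK2 : K ^ 2 = X + 1 := Real.sq_sqrt (by positivity)
  set S := 2 * C * K * (2 * K + 1 + C * K ^ 2) with hS
  have hS0 : 0 ≤ S := by positivity
  -- The part `3 * N` makes `L²` dominate the data with room to spare; the part `4 * S` gives `S / b
  -- ≤ 1 / 4`.
  set b := 3 * N + 4 * S with hb
  have hb1 : 1 ≤ b := by linarith
  have hb0 : 0 < b := by linarith
  set E := 1 + 8 * C + 2 * C * K ^ 3 + 2 * C * K ^ 2 + C * K ^ 3 with hE
  have hE1 : 0 < E := by positivity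
  refine ⟨K, 1 / (E * b ^ (1 / θ)), by positivity, ?_⟩
  intro p A B D V W h hp iA iB iD iV iB2 iD1 T hT hgT t ht
  have hT0 : 0 < T := by linarith
  have hg := p.gain_nonneg
  have hCp := hpC p hp
  have hbT : 1 ≤ b * T := one_le_mul_of_one_le_of_one_le hb1 hT
  have hbT0 : 0 < b * T := by positivity
  -- Chosen so that `L^{-θ} T = 1 / b`: growth at rate `S L^{2-θ}` over time `T` then costs only the
  -- fraction `S / b` of `L²`.
  set L := (b * T) ^ (1 / θ) with hL
  have hL0 : 0 < L := by positivity
  have hbL : b * T ≤ L := by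
    have : (b * T) ^ (1 : ℝ) ≤ (b * T) ^ (1 / θ) :=
      Real.rpow_le_rpow_of_exponent_le hbT (by rw [le_div_iff₀ hθ]; linarith)
    rwa [Real.rpow_one] at this
  have hbL' : b ≤ L := (le_mul_of_one_le_right hb0.le hT).trans hbL
  have hL1 : 1 ≤ L := hbT.trans hbL
  have hLθ : L ^ θ = b * T := by
    rw [hL, ← Real.rpow_mul hbT0.le, one_div_mul_cancel hθ.ne', Real.rpow_one]
  have hLL : L ^ (1 - θ) * T = L / b := by
    rw [Real.rpow_sub hL0, Real.rpow_one, hLθ]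
    field_simp
  have hgL : p.gain * L * T * E ≤ 1 := by
    have e1 : L * T = b ^ (1 / θ) * T ^ (1 + 1 / θ) := by
      rw [hL, Real.mul_rpow hb0.le hT0.le, Real.rpow_add hT0, Real.rpow_one]
      ring
    have e2 : p.gain * L * T * E = p.gain * T ^ (1 + 1 / θ) * (E * b ^ (1 / θ)) := by
      rw [mul_assoc p.gain, e1]; ring
    rw [e2]
    exact (le_div_iff₀ (by positivity)).1 hgT
  have hy0 : 0 ≤ p.gain * L * T := by positivity
  have hgT' : p.gain * T ≤ p.gain * L * T := by
    have : p.gain * T * 1 ≤ p.gain * T * L := by gcongr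
    linarith
  have small : ∀ x, 0 ≤ x → x ≤ E → p.gain * L * T * x ≤ 1 := fun x _ hx =>
    (mul_le_mul_of_nonneg_left hx hy0).trans hgL
  have hSb : S / b ≤ 1 / 4 := by
    rw [div_le_iff₀ hb0]; linarith
  have hA0 : ‖A 0 0‖ ≤ N := (h.scale_A.norm_le_succ 0 0).trans iA
  have hA0' : ‖A 0 0‖ ^ 2 ≤ N ^ 2 := by gcongr
  have hL3 : (3 * N) ^ 2 ≤ L ^ 2 := by
    gcongr; linarith
  have hCK2 : 0 ≤ C * K ^ 2 := by positivity
  have hCK3 : 0 ≤ C * K ^ 3 := by positivity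
  refine h.sum_sq_le_of_small (L := L) (T := T) (m := m) (e := e) (l := l) hK0 hL1 hm0.le hl0
    ?_ ?_ ?_ ?_ ?_ ?_ ?_ ?_ ?_ ?_ ht
  · rw [hCp, hp]; exact hl
  · rw [hCp, hp, hK2]; linarith
  · rw [hCp]
    have h1 := small (2 * C * K ^ 3) (by positivity) (by rw [hE]; linarith)
    have h2 : p.gain * T * (2 * C * K ^ 3) ≤ p.gain * L * T * (2 * C * K ^ 3) := by gcongr
    linarith
  · rw [hCp]
    have h1 := small (2 * C * K ^ 2 + C * K ^ 3) (by positivity) (by rw [hE]; linarith)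
    linarith
  · rw [hCp, hp]
    have h1 := small (8 * C) (by positivity) (by rw [hE]; linarith)
    have h2 : (p.gain * L * (2 * C * L ^ 2) + L * L ^ (1 - θ) *
        (2 * C * K * (2 * K + 1 + C * K ^ 2))) * T =
        (p.gain * L * T * (8 * C) / 4 + S / b) * L ^ 2 := by
      calc _ = p.gain * L * T * (2 * C * L ^ 2) + L * (L ^ (1 - θ) * T) * S := by
            rw [hS]; ring
        _ = _ := by rw [hLL]; ring
    rw [h2, div_eq_inv_mul (L ^ 2)]
    exact mul_le_mul_of_nonneg_right (by linarith) (sq_nonneg L)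
  · rw [hCp, hp]
    have h2 : L * L ^ (1 - θ) * (4 * C * K * (2 * K + 1 + C * K ^ 2)) * T =
        2 * (S / b) * L ^ 2 := by
      calc _ = L * (L ^ (1 - θ) * T) * (2 * S) := by rw [hS]; ring
        _ = _ := by rw [hLL]; ring
    rw [h2, div_eq_inv_mul (L ^ 2)]
    exact mul_le_mul_of_nonneg_right (by linarith) (sq_nonneg L)
  · rw [hm2]; linarith
  · have h1 := h.abs_interaction_le 0 one_pos
    rw [Real.one_rpow, Real.one_rpow, one_mul, one_mul, hCp] at h1
    have h2 : ‖A 0 0‖ * (C * (‖A 0 0‖ + ‖A 1 0‖) * ‖B 1 0‖) ≤ N * (C * (N + N) * N) := by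
      gcongr
    have h3 := neg_le_of_abs_le (h1.trans h2)
    have h4 : ‖A 1 0‖ ^ 2 ≤ N ^ 2 := by gcongr
    have h5 : ‖B 1 0‖ ^ 2 ≤ N ^ 2 := by gcongr
    have h6 : ‖D 0 0‖ ^ 2 ≤ N ^ 2 := by gcongr
    have h7 : N * (C * (N + N) * N) = 2 * C * N ^ 3 := by ring
    have h8 : 0 ≤ N ^ 2 := sq_nonneg N
    rw [h7] at h3
    rw [he]
    unfold WeightedSolution.energy
    linarith
  · have : ‖V 0 0‖ ^ 2 ≤ N ^ 2 := by gcongr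
    linarith [sq_pos_of_pos hN0, mul_pow 3 N 2]
  · have h1 : ‖B 2 0‖ ^ 2 ≤ N ^ 2 := by gcongr
    have h2 : ‖D 1 0‖ ^ 2 ≤ N ^ 2 := by gcongr
    linarith [sq_pos_of_pos hN0, mul_pow 3 N 2]

end

end KGS

/-! ### From uniform weighted bounds to the radius of analyticity. -/

namespace KGS

noncomputable section

variable {d : ℕ}

/-! ### Comparison of Gevrey norms -/

lemma bracket_le_one_add_taxicab (ξ : Space d) : bracket ξ ≤ 1 + taxicab ξ := by
  have h0 := taxicab_nonneg ξ
  have h1 : ‖(2 * Real.pi) • ξ‖ ^ 2 ≤ taxicab ξ ^ 2 := by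
    rw [EuclideanSpace.norm_sq_eq]
    exact Finset.sum_sq_le_sq_sum_of_nonneg fun i _ => abs_nonneg _
  rw [bracket]
  refine (Real.sqrt_le_left (by linarith)).2 ?_
  linarith [add_sq 1 (taxicab ξ)]

/-- From `x ^ k / k! ≤ exp x` at `x = δ (1 + taxicab ξ)`, with `k` the natural ceiling of `q`. -/
lemma exists_bracket_rpow_le_exp (d : ℕ) {δ : ℝ} (hδ : 0 < δ) (q : ℝ) :
    ∃ C : ℝ, 0 ≤ C ∧ ∀ ξ : Space d, bracket ξ ^ q ≤ C * Real.exp (δ * taxicab ξ) := by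
  set k := ⌈q⌉₊ with hk
  refine ⟨k.factorial / δ ^ k * Real.exp δ, by positivity, fun ξ => ?_⟩
  have h0 := taxicab_nonneg ξ
  have h1 := Real.pow_div_factorial_le_exp (δ * (1 + taxicab ξ)) (by positivity) k
  rw [mul_pow, mul_add, Real.exp_add, mul_one, div_le_iff₀ (by positivity)] at h1
  calc bracket ξ ^ q ≤ bracket ξ ^ (k : ℝ) :=
        Real.rpow_le_rpow_of_exponent_le (one_le_bracket ξ) (Nat.le_ceil q)
    _ = bracket ξ ^ k := Real.rpow_natCast _ _
    _ ≤ (1 + taxicab ξ) ^ k := by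
        have := (bracket_pos ξ).le
        gcongr
        exact bracket_le_one_add_taxicab ξ
    _ ≤ _ := by
        rw [div_mul_eq_mul_div, div_mul_eq_mul_div, le_div_iff₀ (by positivity)]
        linarith

lemma gevreySymbol_two_pi_smul (σ r : ℝ) (ξ : Space d) :
    gevreySymbol σ r ((2 * Real.pi) • ξ) = Real.exp (σ * taxicab ξ) * bracket ξ ^ r := rfl

/-- A polynomial loss is absorbed by an arbitrarily small loss in the radius. -/
lemma exists_exp_mul_rpow_le (d : ℕ) {δ : ℝ} (hδ : 0 < δ) (q r : ℝ) :
    ∃ C : ℝ, 0 ≤ C ∧ ∀ (σ : ℝ) (ξ : Space d), Real.exp (σ * taxicab ξ) * bracket ξ ^ q ≤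
      C * (Real.exp ((σ + δ) * taxicab ξ) * bracket ξ ^ r) := by
  obtain ⟨C, hC, h⟩ := exists_bracket_rpow_le_exp d hδ (q - r)
  refine ⟨C, hC, fun σ ξ => ?_⟩
  have hb := bracket_pos ξ
  have hr : 0 < bracket ξ ^ r := Real.rpow_pos_of_pos hb r
  calc Real.exp (σ * taxicab ξ) * bracket ξ ^ q
      = Real.exp (σ * taxicab ξ) * (bracket ξ ^ (q - r) * bracket ξ ^ r) := by
        rw [← Real.rpow_add hb, sub_add_cancel]
    _ ≤ Real.exp (σ * taxicab ξ) * (C * Real.exp (δ * taxicab ξ) * bracket ξ ^ r) := by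
        gcongr
        exact h ξ
    _ = _ := by
        rw [add_mul, Real.exp_add]; ring

/-- The weighted norms of the data are bounded by their Gevrey norms. -/
lemma exists_norm_weight_op_le (d : ℕ) {σ₀ : ℝ} (hσ₀ : 0 < σ₀) (r : ℝ) (k : ℕ) :
    ∃ C : ℝ, 0 ≤ C ∧ ∀ (p : GevreyParams d) (f₀ : Space d → ℂ) (f : ℝ → Space d → ℂ)
      (a : ℕ → ℝ → L2 d) (R : ℝ≥0), p.σ ≤ σ₀ / 2 → IsProfile f a → f 0 =ᵐ[volume] f₀ →
      gevreyNorm σ₀ r f₀ ≤ R → ‖p.weight.op (a k 0)‖ ≤ C * R := by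
  obtain ⟨C, hC, h⟩ := exists_exp_mul_rpow_le d (half_pos hσ₀) k r
  refine ⟨C, hC, fun p f₀ f a R hp hfa h0 hR => ?_⟩
  have hf₀ : MemLp f₀ 2 volume :=
    MemGevrey.memLp (σ := σ₀) (r := r) (hR.trans_lt ENNReal.coe_lt_top)
  obtain ⟨hf, ha⟩ := hfa.fourier 0
  have ha' : a 0 0 = 𝓕 (hf₀.toLp f₀) := by
    rw [ha, (MemLp.toLp_eq_toLp_iff hf hf₀).2 h0]
  rw [gevreyNorm, dif_pos hf₀, ← ha'] at hR
  have h1 : eLpNorm (p.weight.op (a k 0)) 2 volume ≤ ENNReal.ofReal C * R := by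
    refine (eLpNorm_le_mul_eLpNorm_of_ae_le_mul ?_ 2).trans (mul_le_mul_right hR _)
    filter_upwards [p.weight.coeFn_op (a k 0), hfa.scale k 0] with ξ h1 h2
    have hb := bracket_pos ξ
    have hw : p.weight.toFun ξ = Real.exp (p.phase ξ) := rfl
    rw [h1, h2, hw, gevreySymbol_two_pi_smul, norm_mul, norm_mul, norm_mul, ← mul_assoc,
      ← mul_assoc, Complex.norm_real, norm_pow, Complex.norm_real, Complex.norm_real,
      Real.norm_of_nonneg hb.le, Real.norm_of_nonneg (Real.exp_pos _).le,
      Real.norm_of_nonneg (by positivity)]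
    refine mul_le_mul_of_nonneg_right ?_ (norm_nonneg _)
    rw [← Real.rpow_natCast]
    have h3 := h (σ₀ / 2) ξ
    rw [add_halves] at h3
    refine le_trans (mul_le_mul_of_nonneg_right (Real.exp_le_exp.2 ?_) (by positivity)) h3
    exact (min_le_left _ _).trans (mul_le_mul_of_nonneg_right hp (taxicab_nonneg ξ))
  rw [Lp.norm_def]
  refine (ENNReal.toReal_mono (by finiteness) h1).trans ?_
  simp [ENNReal.toReal_ofReal hC]

/-- Bounds uniform in the truncation of the weight give membership in the Gevrey space. -/
lemma memGevrey_of_forall_norm_weight_le {σ : ℝ} (hσ : 0 < σ) (r : ℝ) {k : ℕ} {t K : ℝ}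
    {f : ℝ → Space d → ℂ} {a : ℕ → ℝ → L2 d} (hfa : IsProfile f a) (p : ℕ → GevreyParams d)
    (hpσ : ∀ n, (p n).σ = σ) (hpM : ∀ n, (p n).M = n)
    (hK : ∀ n, ‖(p n).weight.op (a k t)‖ ≤ K) : MemGevrey (σ / 2) r (f t) := by
  obtain ⟨C, hC, h⟩ := exists_exp_mul_rpow_le d (half_pos hσ) r k
  obtain ⟨hf, ha⟩ := hfa.fourier t
  have hlim : eLpNorm (fun ξ => (Real.exp (σ * taxicab ξ) : ℂ) * a k t ξ) 2 volume ≤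
      ENNReal.ofReal K := by
    -- Fatou: at each fixed `ξ` the truncation is inactive once `n ≥ σ * taxicab ξ`.
    refine (Lp.eLpNorm_lim_le_liminf_eLpNorm (f := fun n => ((p n).weight.op (a k t) :
      Space d → ℂ)) (fun n => (Lp.memLp _).1) _ ?_).trans ?_
    · filter_upwards [ae_all_iff.2 fun n => (p n).weight.coeFn_op (a k t)] with ξ hξ
      refine tendsto_const_nhds.congr' ?_
      obtain ⟨N, hN⟩ := exists_nat_ge (σ * taxicab ξ)
      filter_upwards [eventually_ge_atTop N] with n hn
      have : σ * taxicab ξ ≤ n := hN.trans (by exact_mod_cast hn)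
      rw [hξ n]
      simp [GevreyParams.weight, GevreyParams.phase, hpσ, hpM, this]
    · refine (liminf_le_liminf (v := fun _ => ENNReal.ofReal K)
        (Eventually.of_forall fun n => ?_)).trans (by simp)
      rw [← ENNReal.ofReal_toReal (Lp.eLpNorm_ne_top ((p n).weight.op (a k t))), ← Lp.norm_def]
      exact ENNReal.ofReal_le_ofReal (hK n)
  rw [MemGevrey, gevreyNorm, dif_pos hf, ← ha]
  refine lt_of_le_of_lt (eLpNorm_le_mul_eLpNorm_of_ae_le_mul (c := C) ?_ 2)
    (ENNReal.mul_lt_top ENNReal.ofReal_lt_top (hlim.trans_lt ENNReal.ofReal_lt_top))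
  filter_upwards [hfa.scale k t] with ξ h2
  have hb := bracket_pos ξ
  rw [h2, gevreySymbol_two_pi_smul, norm_mul, norm_mul, norm_mul, ← mul_assoc, ← mul_assoc,
    Complex.norm_real, norm_pow, Complex.norm_real, Complex.norm_real,
    Real.norm_of_nonneg hb.le, Real.norm_of_nonneg (by positivity),
    Real.norm_of_nonneg (Real.exp_pos _).le]
  refine mul_le_mul_of_nonneg_right ?_ (norm_nonneg _)
  have h3 := h (σ / 2) ξ
  rwa [add_halves, Real.rpow_natCast, ← mul_assoc] at h3

/-- Needed at time zero, where `V` is not part of the data and must be read off the equation. -/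
lemma WeightedSolution.norm_V_le {p : GevreyParams d} {A B D V W : ℕ → ℝ → L2 d}
    (h : WeightedSolution p A B D V W) (t : ℝ) :
    ‖V 0 t‖ ≤ ‖A 2 t‖ + ‖A 0 t‖ + p.opConst * ‖A 1 t‖ * ‖B 1 t‖ := by
  rw [h.V_eq]
  refine (norm_add_le _ _).trans (add_le_add ?_ ?_)
  · rw [norm_smul, norm_neg, Complex.norm_I, one_mul]
    exact norm_sub_le _ _
  · rw [norm_smul, Complex.norm_I, one_mul]
    exact p.norm_weighted_le h.scale_A h.scale_B t

/-! ### The radius of analyticity -/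

/-- The radius of analyticity decays at most like `|t| ^ (-(1 + 1 / θ) / θ)`. -/
theorem exists_radius (hd₁ : 1 ≤ d) (hd₃ : d ≤ 3) {θ : ℝ} (hθ : 0 < θ) (hθ1 : θ < 1)
    (hdθ : (d : ℝ) < 2 * (2 - θ)) {σ₀ : ℝ} (hσ₀ : 0 < σ₀) (r s : ℝ) (R : ℝ≥0) :
    ∃ c > (0 : ℝ), ∀ (u₀ : Space d → ℂ) (n₀ n₁ : Space d → ℝ),
      gevreyNorm σ₀ r u₀ + gevreyNorm σ₀ s (fun x => (n₀ x : ℂ)) +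
        gevreyNorm σ₀ (s - 1) (fun x => (n₁ x : ℂ)) ≤ R →
      ∀ (u : ℝ → Space d → ℂ) (n : ℝ → Space d → ℝ), IsGlobalSmoothSolution u₀ n₀ n₁ u n →
      ∀ t : ℝ, MemGevrey (c * max 1 |t| ^ (-((1 + 1 / θ) / θ))) r (u t) ∧
        MemGevrey (c * max 1 |t| ^ (-((1 + 1 / θ) / θ))) s (fun x => (n t x : ℂ)) ∧
        MemGevrey (c * max 1 |t| ^ (-((1 + 1 / θ) / θ))) (s - 1)
          (fun x => ((deriv (fun τ => n τ x) t : ℝ) : ℂ)) := by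
  obtain ⟨C₁, hC₁, hu⟩ := exists_norm_weight_op_le d hσ₀ r 2
  obtain ⟨C₂, hC₂, hn⟩ := exists_norm_weight_op_le d hσ₀ s 2
  obtain ⟨C₃, hC₃, hdn⟩ := exists_norm_weight_op_le d hσ₀ (s - 1) 1
  obtain ⟨C, hC, hpC⟩ : ∃ C : ℝ, 0 ≤ C ∧ ∀ p : GevreyParams d, p.θ = θ → p.opConst = C :=
    ⟨2 * √(decayConst d (2 - θ)).toReal, by positivity, fun p hp => by
      rw [GevreyParams.opConst, GevreyParams.s, hp]⟩
  have hR : (0 : ℝ) ≤ R := R.2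
  set N : ℝ := 1 + 2 * (C₁ * R) + C₂ * R + C₃ * R + C * (C₁ * R) * (C₂ * R) with hN
  have hCR₁ : 0 ≤ C₁ * R := by positivity
  have hCR₂ : 0 ≤ C₂ * R := by positivity
  have hCR₃ : 0 ≤ C₃ * R := by positivity
  have hCR : 0 ≤ C * (C₁ * R) * (C₂ * R) := by positivity
  obtain ⟨K, c, hc, hK⟩ := exists_uniform_bound d hθ hθ1 (N := N) (by linarith)
  have hd0 : (0 : ℝ) < d := by exact_mod_cast hd₁
  -- The first bound leaves half of `σ₀` to absorb powers of `⟨ξ⟩` in the data; the second makes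
  -- `gain * T ^ (1 + 1 / θ) = (2 * d * c') ^ θ ≤ c`.
  set c' := min (σ₀ / 2) (c ^ (1 / θ) / (2 * d)) with hc'
  have hc'0 : 0 < c' := lt_min (half_pos hσ₀) (by positivity)
  have hc'c : (2 * d * c') ^ θ ≤ c := by
    have h1 : 2 * d * c' ≤ c ^ (1 / θ) := by
      rw [mul_comm]
      exact (le_div_iff₀ (by positivity)).1 (min_le_right _ _)
    calc (2 * d * c') ^ θ ≤ (c ^ (1 / θ)) ^ θ := by gcongr
      _ = c := by rw [← Real.rpow_mul hc.le, one_div_mul_cancel hθ.ne', Real.rpow_one]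
  refine ⟨c' / 2, half_pos hc'0, fun u₀ n₀ n₁ hdata u n hsol t => ?_⟩
  obtain ⟨a, b, f, hfreq, pa, pb, pf⟩ := hsol.exists_frequencySolution hd₃
  set T := max 1 |t| with hT
  have hT1 : 1 ≤ T := le_max_left _ _
  have hT0 : 0 < T := by linarith
  set σ := c' * T ^ (-((1 + 1 / θ) / θ)) with hσ
  have hσ0 : 0 < σ := by positivity
  have hσ1 : σ ≤ σ₀ / 2 := by
    refine le_trans ?_ (min_le_left (σ₀ / 2) (c ^ (1 / θ) / (2 * d)))
    refine mul_le_of_le_one_right hc'0.le (Real.rpow_le_one_of_one_le_of_nonpos hT1 ?_)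
    rw [neg_nonpos]
    positivity
  have hgain : (2 * d * σ) ^ θ * T ^ (1 + 1 / θ) ≤ c := by
    have : (2 * d * σ) ^ θ * T ^ (1 + 1 / θ) = (2 * d * c') ^ θ := by
      rw [hσ, ← mul_assoc, Real.mul_rpow (by positivity) (by positivity),
        ← Real.rpow_mul hT0.le, mul_assoc, ← Real.rpow_add hT0, neg_mul, div_mul_cancel₀ _ hθ.ne',
        neg_add_cancel, Real.rpow_zero, mul_one]
    rw [this]
    exact hc'c
  -- Only the truncation varies in this family; `K` and `c` do not depend on it.
  set p : ℕ → GevreyParams d := fun M => ⟨hd₃, θ, hθ, hθ1, hdθ, σ, hσ0.le, M, M.cast_nonneg⟩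
    with hp
  have bound : ∀ M, ‖(p M).weight.op (a 1 t)‖ ^ 2 + ‖(p M).weight.op (b 1 t)‖ ^ 2 +
      ‖(p M).weight.op (f 0 t)‖ ^ 2 ≤ K ^ 2 := by
    intro M
    obtain ⟨V, W, hw⟩ := hfreq.weighted (p M)
    have ha2 := hu (p M) u₀ u a R hσ1 pa hsol.init_u
      (le_trans (by rw [add_assoc]; exact le_self_add) hdata)
    have hb2 := hn (p M) (fun x => (n₀ x : ℂ)) _ b R hσ1 pb
      (by filter_upwards [hsol.init_n] with x hx; rw [hx])
      (le_trans (le_trans le_add_self le_self_add) hdata)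
    have hf1 := hdn (p M) (fun x => (n₁ x : ℂ)) _ f R hσ1 pf
      (by filter_upwards [hsol.init_dn] with x hx; rw [hx]) (le_trans le_add_self hdata)
    have ha1 := (hw.scale_A.norm_le_succ 1 0).trans ha2
    have ha0 := (hw.scale_A.norm_le_succ 0 0).trans ha1
    have hb1 := (hw.scale_B.norm_le_succ 1 0).trans hb2
    have hf0 := (hw.scale_D.norm_le_succ 0 0).trans hf1
    have hV := hw.norm_V_le 0
    rw [hpC (p M) rfl] at hV
    have hV' : C * ‖(p M).weight.op (a 1 0)‖ * ‖(p M).weight.op (b 1 0)‖ ≤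
        C * (C₁ * R) * (C₂ * R) := by gcongr
    exact hK (p M) _ _ _ V W hw rfl (by linarith) (by linarith) (by linarith) (by linarith)
      (by linarith) (by linarith) T hT1 hgain t (le_max_right _ _)
  have e : c' / 2 * T ^ (-((1 + 1 / θ) / θ)) = σ / 2 := by rw [hσ]; ring
  rw [e]
  have key : ∀ {x : ℝ}, 0 ≤ x → x ^ 2 ≤ K ^ 2 → x ≤ |K| := fun hx h => by
    rw [← abs_of_nonneg hx]
    exact sq_le_sq.1 h
  refine ⟨?_, ?_, ?_⟩
  · refine memGevrey_of_forall_norm_weight_le hσ0 r pa p (fun _ => rfl) (fun _ => rfl) (k := 1)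
      (K := |K|) fun M => key (norm_nonneg _) ?_
    nlinarith [bound M, sq_nonneg ‖(p M).weight.op (b 1 t)‖, sq_nonneg ‖(p M).weight.op (f 0 t)‖]
  · refine memGevrey_of_forall_norm_weight_le hσ0 s pb p (fun _ => rfl) (fun _ => rfl) (k := 1)
      (K := |K|) fun M => key (norm_nonneg _) ?_
    nlinarith [bound M, sq_nonneg ‖(p M).weight.op (a 1 t)‖, sq_nonneg ‖(p M).weight.op (f 0 t)‖]
  · refine memGevrey_of_forall_norm_weight_le hσ0 (s - 1) pf p (fun _ => rfl) (fun _ => rfl)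
      (k := 0) (K := |K|) fun M => key (norm_nonneg _) ?_
    nlinarith [bound M, sq_nonneg ‖(p M).weight.op (a 1 t)‖, sq_nonneg ‖(p M).weight.op (b 1 t)‖]

end

end KGS

theorem theorem1p1 (d : ℕ) (hd₁ : 1 ≤ d) (hd₃ : d ≤ 3)
    (σ₀ : ℝ) (hσ₀ : 0 < σ₀) (r s : ℝ) (ε : ℝ) (hε : 0 < ε) (R : ℝ≥0) :
    ∃ c > (0 : ℝ), ∃ T > (0 : ℝ),
      ∀ (u₀ : EuclideanSpace ℝ (Fin d) → ℂ) (n₀ n₁ : EuclideanSpace ℝ (Fin d) → ℝ),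
        KGS.gevreyNorm σ₀ r u₀ + KGS.gevreyNorm σ₀ s (fun x => (n₀ x : ℂ)) +
            KGS.gevreyNorm σ₀ (s - 1) (fun x => (n₁ x : ℂ)) ≤ R →
        ∀ (u : ℝ → EuclideanSpace ℝ (Fin d) → ℂ) (n : ℝ → EuclideanSpace ℝ (Fin d) → ℝ),
          KGS.IsGlobalSmoothSolution u₀ n₀ n₁ u n →
          ∃ σ : ℝ → ℝ,
            (∀ t, 0 < σ t ∧
              KGS.MemGevrey (σ t) r (u t) ∧
              KGS.MemGevrey (σ t) s (fun x => (n t x : ℂ)) ∧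
              KGS.MemGevrey (σ t) (s - 1) (fun x => ((deriv (fun τ => n τ x) t : ℝ) : ℂ))) ∧
            ∀ t, T ≤ |t| → c * |t| ^ (-(max (8 / (4 - (d : ℝ))) 4 + ε)) ≤ σ t := by
  -- The constraints are `θ < 1` and `θ < 2 - d / 2`. The value `2 / 3` gives the exponent `15 / 4 ≤
  -- 4`; for `d = 3`, where `θ < 1 / 2`, the value `4 / 9` gives `117 / 16 ≤ 8`.
  obtain ⟨θ, hθ, hθ1, hdθ, hexp⟩ : ∃ θ : ℝ, 0 < θ ∧ θ < 1 ∧ (d : ℝ) < 2 * (2 - θ) ∧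
      (1 + 1 / θ) / θ ≤ max (8 / (4 - (d : ℝ))) 4 := by
    obtain rfl | rfl | rfl : d = 1 ∨ d = 2 ∨ d = 3 := by omega
    · exact ⟨2 / 3, by norm_num, by norm_num, by norm_num, le_max_of_le_right (by norm_num)⟩
    · exact ⟨2 / 3, by norm_num, by norm_num, by norm_num, le_max_of_le_right (by norm_num)⟩
    · exact ⟨4 / 9, by norm_num, by norm_num, by norm_num, le_max_of_le_left (by norm_num)⟩
  obtain ⟨c, hc, h⟩ := KGS.exists_radius hd₁ hd₃ hθ hθ1 hdθ hσ₀ r s R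
  refine ⟨c, hc, 1, one_pos, fun u₀ n₀ n₁ hdata u n hsol =>
    ⟨fun t => c * max 1 |t| ^ (-((1 + 1 / θ) / θ)), fun t => ⟨?_, h u₀ n₀ n₁ hdata u n hsol t⟩,
      fun t ht => ?_⟩⟩
  · have : 0 < max 1 |t| := lt_max_of_lt_left one_pos
    positivity
  · simp only [max_eq_right ht]
    gcongr
    linarith
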